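/- Let $0<k<1$, $k'=\sqrt{1-k^2}$, let $K=K(k)=\int_0^{\pi/2}\frac{du}{\sqrt{1-k^2\sin^2u}}$ and $E=E(k)=\int_0^{\pi/2}\sqrt{1-k^2\sin^2u}\,du$ be the complete elliptic integrals, and put $\tau=iK(k')/K(k)$. Let $\mathcal C$ be the compact Riemann surface (elliptic curve) of $$0=\eta^2+\tfrac{K^2}{4}\bigl(\zeta^4+2(k^2-k'^2)\zeta^2+1\bigr),$$ let $\infty_1\in\mathcal C$ be the point over $\zeta=\infty$ at which $\eta/\zeta^2=-iK/2$, and let $P_0=(k'+ik,0)$, a branch point. Let $$\boldsymbol v=\frac{d\zeta}{4\eta},\qquad \gamma_\infty=\frac{K^2}{4\eta}\Bigl(\zeta^2-\frac{2E-K}{K}\Bigr)d\zeta$$ be the normalized holomorphic differential and the normalized differential of the second kind, whose poles are the two points over $\zeta=\infty$. Let $(x_1,x_2,x_3)\in\mathbb R^3$ and $x_-=x_1-ix_2$, with $K^2\neq4x_-^2$, and let $P_i=(\zeta_i,\eta_i)$, $i=1,\dots,4$, be the four points of $\mathcal C$ (counted with multiplicity) that satisfy the Atiyah–Ward (mini-twistor)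 relation $$\eta=(x_2-ix_1)-2x_3\zeta-(x_2+ix_1)\zeta^2;$$ that is, $\zeta_1,\dots,\zeta_4$ are the roots of the quartic obtained by substituting this relation into the equation of the curve. Then for any choice of contours from $\infty_1$ to the $P_i$ there are integers $N,M$ with $$\sum_{i=1}^4\int_{\infty_1}^{P_i}\boldsymbol v=N\tau+M.$$ Moreover, let contours from $P_0$ to the $P_i$, avoiding the points over $\zeta=\infty$, be correlated with these contours in the sense that, for each $i$, up to an integer, $$\int_{\infty_1}^{P_i}\boldsymbol v=\int_{P_0}^{P_i}\boldsymbol v-\frac{1+\tau}{4}.$$ Then, integrating $\gamma_\infty$ along these contours from $P_0$, $$\sum_{i=1}^4\int_{P_0}^{P_i}\gamma_\infty=\frac{4K^2x_3}{K^2-4x_-^2}-i\pi(N+1),$$ and the quantities $\mu_i=\beta_1(P_i)+i\pi N-i\bigl(x_-\zeta_i-ix_3\bigr)$, where $\beta_1(P_i)=\int_{P_0}^{P_i}\gamma_\infty+\frac{i\pi}{4}$, satisfy $$\sum_{i=1}^4\mu_i=3i\pi N.$$ -/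

import Mathlib

open Complex Polynomial

noncomputable section

namespace TwoMonopole

/-- The complete elliptic integral of the first kind, as a function of the modulus `k`. -/
def ellK (k : ℝ) : ℝ :=
  ∫ u in (0 : ℝ)..(Real.pi / 2), 1 / Real.sqrt (1 - k ^ 2 * Real.sin u ^ 2)

/-- The complete elliptic integral of the second kind, as a function of the modulus `k`. -/
def ellE (k : ℝ) : ℝ :=
  ∫ u in (0 : ℝ)..(Real.pi / 2), Real.sqrt (1 - k ^ 2 * Real.sin u ^ 2)

/-- The complementary modulus `k'`. -/
def compl (k : ℝ) : ℝ := Real.sqrt (1 - k ^ 2)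

/-- The period `τ = i K(k') / K(k)`. -/
def tau (k : ℝ) : ℂ := I * (ellK (compl k) : ℂ) / (ellK k : ℂ)

/-- The mini-twistor relation: `η` as a function of `ζ` for the point `(x₁, x₂, x₃)`. -/
def miniTwistor (x₁ x₂ x₃ : ℝ) (ζ : ℂ) : ℂ :=
  ((x₂ : ℂ) - I * x₁) - 2 * (x₃ : ℂ) * ζ - ((x₂ : ℂ) + I * x₁) * ζ ^ 2

/-- The Atiyah–Ward polynomial in `ζ`: the mini-twistor relation substituted into the equation
`η² + (K²/4) (ζ⁴ + 2 (k² - k'²) ζ² + 1) = 0` of the curve. -/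
def atiyahWard (k x₁ x₂ x₃ : ℝ) : ℂ[X] :=
  (C ((x₂ : ℂ) - I * x₁) - C (2 * (x₃ : ℂ)) * X - C ((x₂ : ℂ) + I * x₁) * X ^ 2) ^ 2
    + C ((ellK k : ℂ) ^ 2 / 4) *
      (X ^ 4 + C (2 * ((k : ℂ) ^ 2 - (compl k : ℂ) ^ 2)) * X ^ 2 + 1)

/-- A `C¹` path on the compact curve `𝒞`, the smooth compactification of
`η² + (K²/4) (ζ⁴ + 2 (k² - k'²) ζ² + 1) = 0`, given in the homogeneous coordinates
`[Z₀ : Z₁ : W]` of weights `1, 1, 2`, where `ζ = Z₁ / Z₀` and `η = W / Z₀²`. The two points at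
infinity are the points with `Z₀ = 0`. -/
structure CurvePath (k : ℝ) where
  Z₀ : ℝ → ℂ
  Z₁ : ℝ → ℂ
  W : ℝ → ℂ
  contDiffOn_Z₀ : ContDiffOn ℝ 1 Z₀ (Set.Icc 0 1)
  contDiffOn_Z₁ : ContDiffOn ℝ 1 Z₁ (Set.Icc 0 1)
  contDiffOn_W : ContDiffOn ℝ 1 W (Set.Icc 0 1)
  ne_zero : ∀ s ∈ Set.Icc (0 : ℝ) 1, Z₀ s ≠ 0 ∨ Z₁ s ≠ 0
  on_curve : ∀ s ∈ Set.Icc (0 : ℝ) 1,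
    W s ^ 2 + (ellK k : ℂ) ^ 2 / 4 *
      (Z₁ s ^ 4 + 2 * ((k : ℂ) ^ 2 - (compl k : ℂ) ^ 2) * Z₀ s ^ 2 * Z₁ s ^ 2 + Z₀ s ^ 4) = 0

namespace CurvePath

variable {k : ℝ}

/-- At time `s` the path is at the finite point `(ζ, η)`. -/
def IsAt (c : CurvePath k) (s : ℝ) (ζ η : ℂ) : Prop :=
  c.Z₀ s ≠ 0 ∧ c.Z₁ s = ζ * c.Z₀ s ∧ c.W s = η * c.Z₀ s ^ 2

/-- At time `s` the path is at `∞₁`, the point over `ζ = ∞` on sheet `1`, where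
`η / ζ² = -i K / 2`. -/
def IsAtInftyOne (c : CurvePath k) (s : ℝ) : Prop :=
  c.Z₀ s = 0 ∧ c.W s = -(I * (ellK k : ℂ) / 2) * c.Z₁ s ^ 2

/-- The path avoids both points at infinity. -/
def AvoidsInfty (c : CurvePath k) : Prop := ∀ s ∈ Set.Icc (0 : ℝ) 1, c.Z₀ s ≠ 0

/-- The pull-back of `dζ / η` to the parameter interval. In homogeneous coordinates
`dζ / η = (Z₀ dZ₁ - Z₁ dZ₀) / W`. For almost every `s` at which the path sits at a branch point
(`W s = 0`) the numerator vanishes as well and so does the pull-back of the form, in agreement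
with the value given by division by zero. -/
def dzetaOverEta (c : CurvePath k) (s : ℝ) : ℂ :=
  (c.Z₀ s * deriv c.Z₁ s - c.Z₁ s * deriv c.Z₀ s) / c.W s

/-- The integral along the path of the normalized holomorphic differential `v = dζ / (4 η)`. -/
def intV (c : CurvePath k) : ℂ :=
  ∫ s in (0 : ℝ)..1, c.dzetaOverEta s / 4

/-- The integral along the path of the normalized differential of the second kind
`γ_∞ = (K² / (4 η)) (ζ² - (2 E - K) / K) dζ`, whose poles are the two points at infinity. -/
def intGamma (c : CurvePath k) : ℂ :=
  ∫ s in (0 : ℝ)..1, (ellK k : ℂ) ^ 2 / 4 *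
    ((c.Z₁ s / c.Z₀ s) ^ 2 - (2 * (ellE k : ℂ) - ellK k) / ellK k) * c.dzetaOverEta s

/-- Correlated contours: `δ` runs from `∞₁` to `P` and `c` from the branch point `P₀` to `P`, and
they are related by `∫_{∞₁}^P v = ∫_{P₀}^P v - φ(∞₁)` with `φ(∞₁) = (1 + τ) / 4`, up to
`𝔞`-periods (on which `γ_∞` has integral zero). As homology classes are determined by their
`v`-periods, this says that `δ` is homologous, modulo `𝔞`, to a fixed contour from `∞₁` to `P₀`
followed by `c`. -/
def Correlated (δ c : CurvePath k) : Prop :=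
  ∃ m : ℤ, δ.intV = c.intV - (1 + tau k) / 4 + m

end CurvePath

/-- `β₁(P) = ∫_{P₀}^P γ_∞ + i π / 4`, for the contour `c` from `P₀` to `P`. -/
def betaOne {k : ℝ} (c : CurvePath k) : ℂ := c.intGamma + I * Real.pi / 4

/-- `μ = β₁(P) + i π N - i [(x₁ - i x₂) ζ - i x₃]`, for a point `P` with first coordinate `ζ` and
a contour `c` from `P₀` to `P`. -/
def mu {k : ℝ} (x₁ x₂ x₃ : ℝ) (N : ℤ) (ζ : ℂ) (c : CurvePath k) : ℂ :=
  betaOne c + I * Real.pi * N - I * (((x₁ : ℂ) - I * x₂) * ζ - I * x₃)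

end TwoMonopole

end

noncomputable section

namespace TwoMonopole

open Filter Topology MeasureTheory

/-! The curve is uniformized by theta functions. The function ζ(z) = i sn u / (1 + cn u), u = 4Kz,
has periods 1 and τ and satisfies ζ' = 4η on the curve. So z ↦ (ζ, η) parametrizes 𝒞 by ℂ modulo ℤ +
ℤτ, and v pulls back to dz. The zeros of ζ are 0 and (1 + τ)/2. Its poles are 1/2, which is ∞₁, and
τ/2. By Liouville ζ = B/A, where A and B are products of two translates of one theta function, B up
to a sign (`exists_zetaFun_eq`). With C = (B'A - BA')/4 the triple [A : B : C] gives entire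
homogeneous coordinates on the curve (`thetaC_sq`).

In these terms γ_∞ = d(A'/(4A)). Indeed K²ζ² and (A'/A)'/4 have the same principal parts, so they
differ by a constant, and the mean of ζ² over a period fixes this constant as K(2E - K)
(`gammaNum_eq`).

Write the mini-twistor relation as η = a - bζ - eζ². Its pull-back Ψ = C - (aA² - bAB - eB²)
vanishes exactly at the lifts z_i of the P_i, with multiplicity (`analyticOrderAt_incidence`). Hence
Ψ(w) = c e^{2πinw} ∏ θ(w - z_i) for some integer n. Comparing the factors of automorphy under w ↦ w
+ τ gives ∑ z_i = (1 - n)τ - m (`exists_incidence_eq`). Comparing the logarithmic derivatives of the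
two sides at the two poles of ζ gives ∑ (A'/A)(z_i) (`exists_sum_lifts`). The same n enters both
sums, so N occurs in both conclusions.

To pass to contours, a C¹ path on the compact curve is lifted to the plane by uniqueness for the
differential equation dual to dζ/η (`IsFlow.lifts`). A lift starting at w ends at w + ∫v, and ∫γ_∞
is the increment of A'/(4A) (`CurvePath.lifts_intV`). The starting points are 1/2 for ∞₁ and (1 -
τ)/4 for P₀. The last identity follows by Vieta: the rational terms in x₃ cancel against x_- ∑ ζ_i.
-/

/-! ### A theta function given by an infinite product -/

/-- The product `∏ (1 - qⁿ w)` over `n ≥ 0`. -/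
def qProd (q w : ℂ) : ℂ := ∏' n : ℕ, (1 + -(q ^ n * w))

lemma summable_qProd {q : ℂ} (hq : ‖q‖ < 1) (w : ℂ) :
    Summable fun n : ℕ ↦ ‖-(q ^ n * w)‖ := by
  simpa [norm_mul] using
    (summable_geometric_of_lt_one (norm_nonneg q) hq).mul_right ‖w‖

lemma differentiable_qProd {q : ℂ} (hq : ‖q‖ < 1) : Differentiable ℂ (qProd q) := by
  have h : HasProdLocallyUniformlyOn (fun (n : ℕ) (w : ℂ) ↦ 1 + -(q ^ n * w))
      (fun w ↦ ∏' n : ℕ, (1 + -(q ^ n * w))) Set.univ := by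
    apply hasProdLocallyUniformlyOn_of_forall_compact isOpen_univ
    intro K _ hcK
    obtain ⟨R, hR⟩ := hcK.isBounded.exists_norm_le
    refine ((summable_geometric_of_lt_one (norm_nonneg q) hq).mul_right
      R).hasProdUniformlyOn_nat_one_add hcK (.of_forall fun n x hx ↦ ?_) (fun _ ↦ by fun_prop)
    rw [norm_neg, norm_mul, norm_pow]
    exact mul_le_mul_of_nonneg_left (hR x hx) (by positivity)
  rw [← differentiableOn_univ]
  exact h.differentiableOn (.of_forall fun _ ↦ by
    simpa [Finset.prod_fn] using DifferentiableOn.finsetProd (fun _ _ ↦ by fun_prop)) isOpen_univ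

lemma qProd_eq_mul {q : ℂ} (hq : ‖q‖ < 1) (w : ℂ) : qProd q w = (1 - w) * qProd q (q * w) := by
  have h' : Multipliable fun n : ℕ ↦ (1 + -(q ^ (n + 1) * w)) := by
    refine (multipliable_one_add_of_summable (summable_qProd hq (q * w))).congr fun n ↦ ?_
    ring
  have h := tprod_eq_zero_mul' (f := fun n : ℕ ↦ (1 + -(q ^ n * w))) h'
  have h2 : ∏' n : ℕ, (1 + -(q ^ (n + 1) * w)) = qProd q (q * w) :=
    tprod_congr fun n ↦ by ring
  rw [h2, pow_zero, one_mul, ← sub_eq_add_neg] at h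
  exact h

lemma qProd_ne_zero {q : ℂ} (hq : ‖q‖ < 1) {w : ℂ} (hw : ∀ n : ℕ, q ^ n * w ≠ 1) :
    qProd q w ≠ 0 := by
  refine tprod_one_add_ne_zero_of_summable (f := fun n ↦ -(q ^ n * w)) (fun n h ↦ hw n ?_)
    (summable_qProd hq w)
  linear_combination -h

/-- The lattice `ℤ + ℤ τ`. -/
def InLattice (τ z : ℂ) : Prop := ∃ m n : ℤ, z = m * τ + n

/-- `e^{2πiz}` -/
def expTwoPi (z : ℂ) : ℂ := exp (2 * Real.pi * I * z)

lemma expTwoPi_ne_zero (z : ℂ) : expTwoPi z ≠ 0 := exp_ne_zero _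

lemma expTwoPi_add (z w : ℂ) : expTwoPi (z + w) = expTwoPi z * expTwoPi w := by
  rw [expTwoPi, mul_add, exp_add]; rfl

lemma expTwoPi_neg (z : ℂ) : expTwoPi (-z) = (expTwoPi z)⁻¹ := by
  rw [expTwoPi, mul_neg, exp_neg]; rfl

lemma expTwoPi_int (n : ℤ) : expTwoPi n = 1 := by
  rw [expTwoPi, mul_comm]; exact exp_int_mul_two_pi_mul_I n

lemma expTwoPi_one : expTwoPi 1 = 1 := by simpa using expTwoPi_int 1

lemma expTwoPi_half : expTwoPi (1 / 2) = -1 := by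
  rw [expTwoPi, show 2 * (Real.pi : ℂ) * I * (1 / 2) = Real.pi * I by ring, exp_pi_mul_I]

lemma expTwoPi_nat_mul (n : ℕ) (z : ℂ) : expTwoPi (n * z) = expTwoPi z ^ n := by
  rw [expTwoPi, expTwoPi, ← exp_nat_mul]; ring_nf

lemma expTwoPi_eq_one_iff {z : ℂ} : expTwoPi z = 1 ↔ ∃ n : ℤ, z = n := by
  rw [expTwoPi, exp_eq_one_iff]
  refine exists_congr fun n ↦ ?_
  have : (2 * (Real.pi : ℂ) * I) ≠ 0 := two_pi_I_ne_zero
  rw [mul_comm]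
  exact mul_left_inj' this

lemma hasDerivAt_expTwoPi (z : ℂ) :
    HasDerivAt expTwoPi (2 * Real.pi * I * expTwoPi z) z := by
  have := ((hasDerivAt_id z).const_mul (2 * (Real.pi : ℂ) * I)).cexp
  exact this.congr_deriv (by rw [mul_one]; exact mul_comm _ _)

lemma differentiable_expTwoPi : Differentiable ℂ expTwoPi :=
  fun z ↦ (hasDerivAt_expTwoPi z).differentiableAt

lemma norm_expTwoPi_lt_one {τ : ℂ} (hτ : 0 < τ.im) : ‖expTwoPi τ‖ < 1 := by
  rw [expTwoPi, norm_exp, Real.exp_lt_one_iff]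
  have : (2 * (Real.pi : ℂ) * I * τ).re = -(2 * Real.pi * τ.im) := by simp
  rw [this]
  have := Real.pi_pos
  nlinarith [mul_pos this hτ]

/-- The entire function with simple zeros at the points of `ℤ + ℤ τ` and nowhere else that is
given by the product `∏ (1 - qⁿ w) ∏ (1 - qⁿ⁺¹ / w)`, `q = e^{2πiτ}`, `w = e^{2πiz}`. -/
def theta (τ z : ℂ) : ℂ :=
  qProd (expTwoPi τ) (expTwoPi z) * qProd (expTwoPi τ) (expTwoPi (τ - z))

section

variable {τ : ℂ} (hτ : 0 < τ.im)
include hτ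

lemma differentiable_theta : Differentiable ℂ (theta τ) := by
  have hq := differentiable_qProd (norm_expTwoPi_lt_one hτ)
  have h1 := differentiable_expTwoPi
  exact (hq.comp h1).mul (hq.comp (h1.comp (by fun_prop : Differentiable ℂ fun z ↦ τ - z)))

/-- Splitting off the n = 0 factor isolates the zero at the origin and leaves a cofactor that is
even in z. The τ-shift, the reflection formula and the simplicity of the zeros all follow from this
form. -/
lemma theta_eq_mul (z : ℂ) : theta τ z = (1 - expTwoPi z) *
    (qProd (expTwoPi τ) (expTwoPi (τ + z)) * qProd (expTwoPi τ) (expTwoPi (τ - z))) := by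
  rw [theta, qProd_eq_mul (norm_expTwoPi_lt_one hτ), expTwoPi_add, mul_assoc]

omit hτ in
lemma theta_add_one (z : ℂ) : theta τ (z + 1) = theta τ z := by
  have h : expTwoPi (τ - (z + 1)) = expTwoPi (τ - z) := by
    have := expTwoPi_add (τ - (z + 1)) 1
    rw [expTwoPi_one, mul_one] at this
    rw [← this]; ring_nf
  rw [theta, theta, h, expTwoPi_add, expTwoPi_one, mul_one]

lemma theta_add_tau (z : ℂ) : theta τ (z + τ) = -expTwoPi (-z) * theta τ z := by
  rw [theta_eq_mul hτ z, theta, show τ - (z + τ) = -z by ring,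
    qProd_eq_mul (norm_expTwoPi_lt_one hτ) (expTwoPi (-z)), ← expTwoPi_add, ← sub_eq_add_neg,
    add_comm z τ]
  have : expTwoPi (-z) * expTwoPi z = 1 := by
    rw [expTwoPi_neg, inv_mul_cancel₀ (expTwoPi_ne_zero z)]
  linear_combination (-qProd (expTwoPi τ) (expTwoPi (τ + z)) *
    qProd (expTwoPi τ) (expTwoPi (τ - z))) * this

lemma theta_neg (z : ℂ) : theta τ (-z) = -expTwoPi (-z) * theta τ z := by
  rw [theta_eq_mul hτ z, theta_eq_mul hτ (-z), sub_neg_eq_add, ← sub_eq_add_neg]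
  have : expTwoPi (-z) * expTwoPi z = 1 := by
    rw [expTwoPi_neg, inv_mul_cancel₀ (expTwoPi_ne_zero z)]
  linear_combination (-qProd (expTwoPi τ) (expTwoPi (τ + z)) *
    qProd (expTwoPi τ) (expTwoPi (τ - z))) * this

omit hτ in
lemma theta_add_int (z : ℂ) (n : ℤ) : theta τ (z + n) = theta τ z := by
  induction n using Int.induction_on with
  | zero => simp
  | succ n ih => push_cast at ih ⊢; rw [← add_assoc, theta_add_one, ih]
  | pred n ih =>
    push_cast at ih ⊢
    rw [← theta_add_one (τ := τ) (z + (-n - 1)), ← ih]; ring_nf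

/-- The exact factor is irrelevant. Since it never vanishes and is holomorphic, a zero and its
multiplicity can be carried from the origin to any lattice point. -/
lemma exists_theta_add_lattice {l : ℂ} (hl : InLattice τ l) :
    ∃ a b : ℂ, a ≠ 0 ∧ ∀ z, theta τ (z + l) = a * exp (b * z) * theta τ z := by
  obtain ⟨m, n, rfl⟩ := hl
  suffices ∃ a b : ℂ, a ≠ 0 ∧ ∀ z, theta τ (z + m * τ) = a * exp (b * z) * theta τ z by
    obtain ⟨a, b, ha, h⟩ := this
    refine ⟨a, b, ha, fun z ↦ ?_⟩
    rw [← add_assoc, theta_add_int, h]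
  induction m using Int.induction_on with
  | zero => exact ⟨1, 0, by simp, by simp⟩
  | succ m ih =>
    obtain ⟨a, b, ha, h⟩ := ih
    push_cast at h ⊢
    refine ⟨-a * expTwoPi (-(m * τ)), b + -(2 * Real.pi * I),
      mul_ne_zero (neg_ne_zero.2 ha) (expTwoPi_ne_zero _), fun z ↦ ?_⟩
    rw [show z + (m + 1) * τ = z + m * τ + τ by ring, theta_add_tau hτ, h, neg_add, expTwoPi_add,
      add_mul, exp_add, show expTwoPi (-z) = exp (-(2 * Real.pi * I) * z) by
        rw [expTwoPi]; ring_nf]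
    ring
  | pred m ih =>
    obtain ⟨a, b, ha, h⟩ := ih
    push_cast at h ⊢
    refine ⟨-a * expTwoPi (-m * τ - τ), b + (2 * Real.pi * I),
      mul_ne_zero (neg_ne_zero.2 ha) (expTwoPi_ne_zero _), fun z ↦ ?_⟩
    have h1 := theta_add_tau hτ (z + (-m - 1) * τ)
    rw [show z + (-m - 1) * τ + τ = z + -m * τ by ring, h, expTwoPi_neg] at h1
    have h2 := expTwoPi_ne_zero (z + (-m - 1) * τ)
    have h3 : theta τ (z + (-m - 1) * τ) =
        -expTwoPi (z + (-m - 1) * τ) * (a * exp (b * z) * theta τ z) := by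
      rw [h1]; field_simp
    rw [h3, expTwoPi_add, add_mul, exp_add, show expTwoPi z = exp ((2 * Real.pi * I) * z) from rfl]
    ring_nf

lemma qProd_sq_ne_zero {z : ℂ} (h1 : ∀ n : ℕ, expTwoPi ((n + 1) * τ + z) ≠ 1)
    (h2 : ∀ n : ℕ, expTwoPi ((n + 1) * τ - z) ≠ 1) :
    qProd (expTwoPi τ) (expTwoPi (τ + z)) * qProd (expTwoPi τ) (expTwoPi (τ - z)) ≠ 0 := by
  have hq := norm_expTwoPi_lt_one hτ
  refine mul_ne_zero (qProd_ne_zero hq fun n ↦ ?_) (qProd_ne_zero hq fun n ↦ ?_)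
  · rw [← expTwoPi_nat_mul, ← expTwoPi_add]
    convert h1 n using 2; ring
  · rw [← expTwoPi_nat_mul, ← expTwoPi_add]
    convert h2 n using 2; ring

lemma theta_eq_zero_iff {z : ℂ} : theta τ z = 0 ↔ InLattice τ z := by
  constructor
  · intro h
    by_contra hz
    rw [theta_eq_mul hτ] at h
    refine mul_ne_zero ?_ (qProd_sq_ne_zero hτ (fun n h1 ↦ ?_) (fun n h1 ↦ ?_)) h
    · intro h1
      obtain ⟨n, hn⟩ := expTwoPi_eq_one_iff.1 (sub_eq_zero.1 h1).symm
      exact hz ⟨0, n, by simp [hn]⟩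
    · obtain ⟨j, hj⟩ := expTwoPi_eq_one_iff.1 h1
      exact hz ⟨-(n + 1), j, by push_cast; linear_combination hj⟩
    · obtain ⟨j, hj⟩ := expTwoPi_eq_one_iff.1 h1
      exact hz ⟨n + 1, -j, by push_cast; linear_combination -hj⟩
  · intro h
    obtain ⟨a, b, -, h⟩ := exists_theta_add_lattice hτ h
    have h0 := h 0
    rw [zero_add] at h0
    rw [h0, theta_eq_mul hτ 0]
    simp [expTwoPi]

lemma deriv_theta_zero_ne_zero : deriv (theta τ) 0 ≠ 0 := by
  have hq := differentiable_qProd (norm_expTwoPi_lt_one hτ)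
  have h1 := differentiable_expTwoPi
  have hg : Differentiable ℂ fun z ↦
      (qProd (expTwoPi τ) (expTwoPi (τ + z)) * qProd (expTwoPi τ) (expTwoPi (τ - z))) :=
    (hq.comp (h1.comp (by fun_prop : Differentiable ℂ fun z ↦ τ + z))).mul
      (hq.comp (h1.comp (by fun_prop : Differentiable ℂ fun z ↦ τ - z)))
  have h2 := ((hasDerivAt_expTwoPi 0).const_sub 1).mul (hg 0).hasDerivAt
  have h3 : theta τ = (fun z ↦ 1 - expTwoPi z) * fun z ↦
      (qProd (expTwoPi τ) (expTwoPi (τ + z)) * qProd (expTwoPi τ) (expTwoPi (τ - z))) :=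
    funext (theta_eq_mul hτ)
  have h0 : expTwoPi 0 = 1 := by simp [expTwoPi]
  rw [h3, h2.deriv, h0]
  have him : ∀ n : ℕ, expTwoPi ((n + 1) * τ) ≠ 1 := by
    intro n h
    obtain ⟨j, hj⟩ := expTwoPi_eq_one_iff.1 h
    have := congrArg Complex.im hj
    have h4 : ((n + 1 : ℂ) * τ).im = (n + 1) * τ.im := by simp
    rw [h4] at this
    simp only [intCast_im] at this
    have : 0 < ((n : ℝ) + 1) * τ.im := by positivity
    linarith
  have := qProd_sq_ne_zero hτ (z := 0) (fun n ↦ by simpa using him n)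
    (fun n ↦ by simpa using him n)
  simp only [sub_self, zero_mul, add_zero, mul_one]
  refine mul_ne_zero (neg_ne_zero.2 two_pi_I_ne_zero) ?_
  simpa using this

end

/-! ### Entire functions with two periods -/

lemma exists_real_coords {τ : ℂ} (hτ : 0 < τ.im) (z : ℂ) : ∃ a b : ℝ, z = a * τ + b := by
  refine ⟨z.im / τ.im, z.re - z.im / τ.im * τ.re, ?_⟩
  have := hτ.ne'
  apply Complex.ext
  · simp
  · simp; field_simp

lemma add_lattice_eq_of_periodic {τ : ℂ} {E : Type*} {f : ℂ → E} (h1 : ∀ z, f (z + 1) = f z)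
    (h2 : ∀ z, f (z + τ) = f z) {l : ℂ} (hl : InLattice τ l) (z : ℂ) : f (z + l) = f z := by
  obtain ⟨m, n, rfl⟩ := hl
  have hm : Function.Periodic f (m * τ) := (show Function.Periodic f τ from h2).int_mul m
  have hn : Function.Periodic f (n * 1) := (show Function.Periodic f 1 from h1).int_mul n
  rw [mul_one] at hn
  rw [← add_assoc, hn, hm]

/-- Liouville's theorem: all values are already taken on a compact period parallelogram. -/
lemma exists_eq_const_of_periodic {τ : ℂ} (hτ : 0 < τ.im) {f : ℂ → ℂ} (hf : Differentiable ℂ f)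
    (h1 : ∀ z, f (z + 1) = f z) (h2 : ∀ z, f (z + τ) = f z) : ∃ c, ∀ z, f z = c := by
  refine hf.exists_const_forall_eq_of_bounded ?_
  have hc : IsCompact ((fun p : ℝ × ℝ ↦ f (p.1 * τ + p.2)) '' (Set.Icc 0 1 ×ˢ Set.Icc 0 1)) := by
    refine (isCompact_Icc.prod isCompact_Icc).image ?_
    have := hf.continuous
    fun_prop
  refine hc.isBounded.subset ?_
  rintro _ ⟨z, rfl⟩
  obtain ⟨a, b, rfl⟩ := exists_real_coords hτ z
  refine ⟨(Int.fract a, Int.fract b), ⟨⟨Int.fract_nonneg _, (Int.fract_lt_one _).le⟩,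
    ⟨Int.fract_nonneg _, (Int.fract_lt_one _).le⟩⟩, ?_⟩
  have := add_lattice_eq_of_periodic h1 h2 (l := ⌊a⌋ * τ + ⌊b⌋) ⟨_, _, rfl⟩
    ((Int.fract a : ℝ) * τ + (Int.fract b : ℝ))
  refine this.symm.trans ?_
  simp only [Int.fract]
  push_cast
  ring_nf

/-! ### Removing singularities of meromorphic functions -/

/-- Meant for quotients, whose value at a zero of the denominator is the default 0. The meromorphic
normal form replaces these values by the limits. It agrees with f wherever f is continuous and is
nonzero wherever the order is 0. -/
lemma exists_differentiable_of_meromorphicOrderAt_nonneg {f : ℂ → ℂ}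
    (hf : ∀ z, MeromorphicAt f z) (h0 : ∀ z, 0 ≤ meromorphicOrderAt f z) :
    ∃ g : ℂ → ℂ, Differentiable ℂ g ∧ (∀ z, f =ᶠ[𝓝[≠] z] g) ∧
      (∀ z, ContinuousAt f z → f z = g z) ∧ ∀ z, meromorphicOrderAt f z = 0 → g z ≠ 0 := by
  have hf' : MeromorphicOn f Set.univ := fun z _ ↦ hf z
  have hnf := meromorphicNFOn_toMeromorphicNFOn f Set.univ
  have heq : ∀ z, f =ᶠ[𝓝[≠] z] toMeromorphicNFOn f Set.univ := fun z ↦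
    hf'.toMeromorphicNFOn_eq_self_on_nhdsNE (Set.mem_univ z) |>.symm
  have hord : ∀ z, meromorphicOrderAt (toMeromorphicNFOn f Set.univ) z = meromorphicOrderAt f z :=
    fun z ↦ meromorphicOrderAt_toMeromorphicNFOn hf' (Set.mem_univ z)
  have han : ∀ z, AnalyticAt ℂ (toMeromorphicNFOn f Set.univ) z := fun z ↦
    (hnf (Set.mem_univ z)).meromorphicOrderAt_nonneg_iff_analyticAt.1 (by rw [hord]; exact h0 z)
  refine ⟨_, fun z ↦ (han z).differentiableAt, heq, fun z hz ↦ ?_, fun z hz ↦ ?_⟩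
  · refine tendsto_nhds_unique (hz.tendsto.mono_left nhdsWithin_le_nhds)
      (((han z).continuousAt.tendsto.mono_left nhdsWithin_le_nhds).congr' (heq z).symm)
  · rw [← hord] at hz
    exact (hnf (Set.mem_univ z)).meromorphicOrderAt_eq_zero_iff.1 hz

/-! ### Zeros and logarithmic derivative of the theta function -/

section

variable {τ : ℂ} (hτ : 0 < τ.im)
include hτ

lemma deriv_theta_ne_zero {l : ℂ} (hl : InLattice τ l) : deriv (theta τ) l ≠ 0 := by
  obtain ⟨a, b, ha, h⟩ := exists_theta_add_lattice hτ hl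
  have h1 : deriv (fun z ↦ theta τ (z + l)) 0 = deriv (theta τ) l := by
    rw [deriv_comp_add_const, zero_add]
  have hd : HasDerivAt (fun z ↦ a * exp (b * z)) (a * (exp (b * 0) * (b * 1))) 0 :=
    (((hasDerivAt_id (0 : ℂ)).const_mul b).cexp).const_mul a
  have h2 := hd.mul (differentiable_theta hτ 0).hasDerivAt
  have h3 : (fun z ↦ theta τ (z + l)) = (fun z ↦ a * exp (b * z)) * theta τ := funext h
  rw [← h1, h3, h2.deriv, (theta_eq_zero_iff hτ).2 ⟨0, 0, by simp⟩]
  simpa using ⟨ha, deriv_theta_zero_ne_zero hτ⟩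

lemma differentiable_theta_sub (a : ℂ) : Differentiable ℂ fun z ↦ theta τ (z - a) :=
  (differentiable_theta hτ).comp (by fun_prop)

open Classical in
lemma analyticOrderAt_theta_sub (a z : ℂ) :
    analyticOrderAt (fun z ↦ theta τ (z - a)) z = if InLattice τ (z - a) then 1 else 0 := by
  have han : AnalyticAt ℂ (fun z ↦ theta τ (z - a)) z := (differentiable_theta_sub hτ a).analyticAt z
  split_ifs with h
  · refine han.analyticOrderAt_eq_one_of_zero_deriv_ne_zero ((theta_eq_zero_iff hτ).2 h) ?_
    rw [deriv_comp_sub_const]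
    exact deriv_theta_ne_zero hτ h
  · exact han.analyticOrderAt_eq_zero.2 fun h1 ↦ h ((theta_eq_zero_iff hτ).1 h1)

omit hτ in
lemma logDeriv_theta_add_one (z : ℂ) : logDeriv (theta τ) (z + 1) = logDeriv (theta τ) z := by
  have : (fun z ↦ theta τ (z + 1)) = theta τ := funext theta_add_one
  rw [logDeriv_apply, logDeriv_apply, ← deriv_comp_add_const, this, theta_add_one]

omit hτ in
lemma hasDerivAt_neg_expTwoPi_neg (z : ℂ) :
    HasDerivAt (fun z ↦ -expTwoPi (-z)) (2 * Real.pi * I * expTwoPi (-z)) z := by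
  have h := ((hasDerivAt_expTwoPi (-z)).comp z (hasDerivAt_neg z)).neg
  exact h.congr_deriv (by ring)

/-- Logarithmic differentiation turns the exponential factor of `theta_add_tau` into an additive
constant. The reflection formula below comes from `theta_neg` in the same way. -/
lemma logDeriv_theta_add_tau {z : ℂ} (hz : ¬ InLattice τ z) :
    logDeriv (theta τ) (z + τ) = logDeriv (theta τ) z - 2 * Real.pi * I := by
  have h1 : (fun z ↦ theta τ (z + τ)) = (fun z ↦ -expTwoPi (-z)) * theta τ :=
    funext (theta_add_tau hτ)
  have h2 := (hasDerivAt_neg_expTwoPi_neg z).mul (differentiable_theta hτ z).hasDerivAt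
  have h0 : theta τ z ≠ 0 := fun h ↦ hz ((theta_eq_zero_iff hτ).1 h)
  have he := expTwoPi_ne_zero (-z)
  rw [logDeriv_apply, logDeriv_apply, ← deriv_comp_add_const, h1, h2.deriv, theta_add_tau hτ]
  field_simp
  ring

lemma logDeriv_theta_neg {z : ℂ} (hz : ¬ InLattice τ z) :
    logDeriv (theta τ) (-z) = 2 * Real.pi * I - logDeriv (theta τ) z := by
  have h1 : (fun z ↦ theta τ (-z)) = (fun z ↦ -expTwoPi (-z)) * theta τ :=
    funext (theta_neg hτ)
  have h2 := (hasDerivAt_neg_expTwoPi_neg z).mul (differentiable_theta hτ z).hasDerivAt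
  have h3 : deriv (theta τ) (-z) = - deriv (fun z ↦ theta τ (-z)) z := by
    rw [deriv_comp_neg, neg_neg]
  have h0 : theta τ z ≠ 0 := fun h ↦ hz ((theta_eq_zero_iff hτ).1 h)
  have he := expTwoPi_ne_zero (-z)
  rw [logDeriv_apply, logDeriv_apply, h3, h1, h2.deriv, theta_neg hτ]
  field_simp
  ring

lemma not_inLattice_of_coords {a b : ℝ} (h : (∀ m : ℤ, a ≠ m) ∨ ∀ n : ℤ, b ≠ n) :
    ¬ InLattice τ (a * τ + b) := by
  rintro ⟨m, n, hmn⟩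
  have him := congrArg Complex.im hmn
  have hre := congrArg Complex.re hmn
  simp at him hre
  have ha : a = m := by
    rcases him with h | h
    · exact h
    · exact absurd h hτ.ne'
  subst ha
  rcases h with h | h
  · exact h m rfl
  · exact h n (by linarith)

end

/-! ### The amplitude function -/

/-- The function `√(1 - k² sin² φ)`. -/
def ellDelta (k φ : ℝ) : ℝ := Real.sqrt (1 - k ^ 2 * Real.sin φ ^ 2)

/-- The incomplete elliptic integral of the first kind. -/
def ellF (k φ : ℝ) : ℝ := ∫ u in (0 : ℝ)..φ, 1 / ellDelta k u

section

variable {k : ℝ} (hk0 : 0 < k) (hk1 : k < 1)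
include hk0 hk1

lemma one_sub_sq_mul_sin_sq_pos (φ : ℝ) : 0 < 1 - k ^ 2 * Real.sin φ ^ 2 := by
  have h1 : k ^ 2 < 1 := by nlinarith
  nlinarith [Real.sin_sq_le_one φ, sq_nonneg (Real.sin φ), sq_nonneg k]

lemma ellDelta_pos (φ : ℝ) : 0 < ellDelta k φ :=
  Real.sqrt_pos.2 (one_sub_sq_mul_sin_sq_pos hk0 hk1 φ)

lemma ellDelta_sq (φ : ℝ) : ellDelta k φ ^ 2 = 1 - k ^ 2 * Real.sin φ ^ 2 :=
  Real.sq_sqrt (one_sub_sq_mul_sin_sq_pos hk0 hk1 φ).le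

omit hk0 hk1 in
lemma ellDelta_le_one (φ : ℝ) : ellDelta k φ ≤ 1 := by
  rw [ellDelta, Real.sqrt_le_one]
  nlinarith [mul_nonneg (sq_nonneg k) (sq_nonneg (Real.sin φ))]

omit hk0 hk1 in
lemma continuous_ellDelta : Continuous (ellDelta k) := by
  unfold ellDelta; fun_prop

lemma continuous_one_div_ellDelta : Continuous fun φ ↦ 1 / ellDelta k φ :=
  continuous_const.div continuous_ellDelta fun φ ↦ (ellDelta_pos hk0 hk1 φ).ne'

lemma hasDerivAt_ellF (φ : ℝ) : HasDerivAt (ellF k) (1 / ellDelta k φ) φ :=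
  intervalIntegral.integral_hasDerivAt_right
    ((continuous_one_div_ellDelta hk0 hk1).intervalIntegrable _ _)
    ((continuous_one_div_ellDelta hk0 hk1).stronglyMeasurableAtFilter _ _)
    (continuous_one_div_ellDelta hk0 hk1).continuousAt

lemma strictMono_ellF : StrictMono (ellF k) :=
  strictMono_of_hasDerivAt_pos (hasDerivAt_ellF hk0 hk1)
    fun φ ↦ one_div_pos.2 (ellDelta_pos hk0 hk1 φ)

/-- The integrand is at least 1. This forces F to be unbounded in both directions, hence surjective.
-/
lemma monotone_ellF_sub : Monotone fun φ ↦ ellF k φ - φ := by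
  refine monotone_of_hasDerivAt_nonneg
    (fun φ ↦ (hasDerivAt_ellF hk0 hk1 φ).sub (hasDerivAt_id φ)) fun φ ↦ ?_
  have h1 := ellDelta_pos hk0 hk1 φ
  have : 1 ≤ 1 / ellDelta k φ := (one_le_div h1).2 (ellDelta_le_one φ)
  simpa using this

lemma surjective_ellF : Function.Surjective (ellF k) := by
  have h0 : ellF k 0 = 0 := by simp [ellF]
  have hc : Continuous (ellF k) :=
    continuous_iff_continuousAt.2 fun φ ↦ (hasDerivAt_ellF hk0 hk1 φ).continuousAt
  refine hc.surjective ?_ ?_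
  · refine tendsto_atTop_mono' _ ?_ tendsto_id
    filter_upwards [eventually_ge_atTop 0] with φ hφ
    have := monotone_ellF_sub hk0 hk1 hφ
    simp only [h0] at this
    simp only [id]; linarith
  · refine tendsto_atBot_mono' _ ?_ tendsto_id
    filter_upwards [eventually_le_atBot 0] with φ hφ
    have := monotone_ellF_sub hk0 hk1 hφ
    simp only [h0] at this
    simp only [id]; linarith

lemma exists_amplitude : ∃ am : ℝ → ℝ, (∀ u, ellF k (am u) = u) ∧ (∀ φ, am (ellF k φ) = φ) ∧
    ∀ u, HasDerivAt am (ellDelta k (am u)) u := by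
  let e := (strictMono_ellF hk0 hk1).orderIsoOfSurjective _ (surjective_ellF hk0 hk1)
  have he : ∀ φ, e φ = ellF k φ := fun φ ↦ rfl
  have h1 : ∀ u, ellF k (e.symm u) = u := fun u ↦ by rw [← he, e.apply_symm_apply]
  refine ⟨e.symm, h1, fun φ ↦ by rw [← he, e.symm_apply_apply], fun u ↦ ?_⟩
  have h := HasDerivAt.of_local_left_inverse (e.symm.continuous.continuousAt (x := u))
    (hasDerivAt_ellF hk0 hk1 (e.symm u)) (one_div_ne_zero (ellDelta_pos hk0 hk1 _).ne')
    (Eventually.of_forall h1)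
  simpa using h

end

/-- Jacobi's amplitude, the inverse function of `ellF`. -/
def amplitude (k : ℝ) : ℝ → ℝ := Function.invFun (ellF k)

section

variable {k : ℝ} (hk0 : 0 < k) (hk1 : k < 1)
include hk0 hk1

lemma ellF_amplitude (u : ℝ) : ellF k (amplitude k u) = u :=
  Function.invFun_eq (surjective_ellF hk0 hk1 u)

lemma amplitude_ellF (φ : ℝ) : amplitude k (ellF k φ) = φ :=
  Function.leftInverse_invFun (strictMono_ellF hk0 hk1).injective φ

lemma hasDerivAt_amplitude (u : ℝ) : HasDerivAt (amplitude k) (ellDelta k (amplitude k u)) u := by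
  obtain ⟨am, h1, -, h3⟩ := exists_amplitude hk0 hk1
  have : amplitude k = am :=
    funext fun u ↦ (strictMono_ellF hk0 hk1).injective (by rw [ellF_amplitude hk0 hk1, h1])
  rw [this]; exact h3 u

omit hk0 hk1 in
lemma ellDelta_pi_sub (φ : ℝ) : ellDelta k (Real.pi - φ) = ellDelta k φ := by simp [ellDelta]

omit hk0 hk1 in
lemma ellDelta_add_pi (φ : ℝ) : ellDelta k (φ + Real.pi) = ellDelta k φ := by simp [ellDelta]

omit hk0 hk1 in
lemma ellDelta_neg (φ : ℝ) : ellDelta k (-φ) = ellDelta k φ := by simp [ellDelta]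

omit hk0 hk1 in
lemma ellF_half_pi : ellF k (Real.pi / 2) = ellK k := rfl

omit hk0 hk1 in
lemma ellF_zero : ellF k 0 = 0 := by simp [ellF]

lemma ellF_pi : ellF k Real.pi = 2 * ellK k := by
  have h1 : ∀ a b, IntervalIntegrable (fun u ↦ 1 / ellDelta k u) MeasureTheory.volume a b :=
    fun a b ↦ (continuous_one_div_ellDelta hk0 hk1).intervalIntegrable a b
  have h := intervalIntegral.integral_comp_sub_left (a := 0) (b := Real.pi / 2)
    (fun u ↦ 1 / ellDelta k u) Real.pi
  simp only [ellDelta_pi_sub, sub_zero] at h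
  rw [ellF, ← intervalIntegral.integral_add_adjacent_intervals (h1 0 (Real.pi / 2)) (h1 _ _)]
  rw [show Real.pi - Real.pi / 2 = Real.pi / 2 by ring] at h
  rw [← h]
  exact (two_mul _).symm

lemma ellF_add_pi (φ : ℝ) : ellF k (φ + Real.pi) = ellF k φ + 2 * ellK k := by
  have h1 : ∀ a b, IntervalIntegrable (fun u ↦ 1 / ellDelta k u) MeasureTheory.volume a b :=
    fun a b ↦ (continuous_one_div_ellDelta hk0 hk1).intervalIntegrable a b
  have h := intervalIntegral.integral_comp_add_right (a := 0) (b := φ)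
    (fun u ↦ 1 / ellDelta k u) Real.pi
  simp only [ellDelta_add_pi, zero_add] at h
  rw [← ellF_pi hk0 hk1, ellF, ellF, ellF, h, add_comm (∫ _ in _.._, _),
    intervalIntegral.integral_add_adjacent_intervals (h1 _ _) (h1 _ _)]

omit hk0 hk1 in
lemma ellF_neg (φ : ℝ) : ellF k (-φ) = -ellF k φ := by
  have h := intervalIntegral.integral_comp_neg (a := 0) (b := φ) (fun u ↦ 1 / ellDelta k u)
  simp only [ellDelta_neg, neg_zero] at h
  rw [ellF, ellF, h, intervalIntegral.integral_symm]

lemma ellK_pos : 0 < ellK k := by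
  rw [← ellF_half_pi, ← ellF_zero (k := k)]
  exact strictMono_ellF hk0 hk1 (by positivity)

lemma amplitude_eq_iff {u φ : ℝ} : amplitude k u = φ ↔ u = ellF k φ :=
  ⟨fun h ↦ by rw [← h, ellF_amplitude hk0 hk1], fun h ↦ by rw [h, amplitude_ellF hk0 hk1]⟩

lemma amplitude_add (u : ℝ) : amplitude k (u + 2 * ellK k) = amplitude k u + Real.pi := by
  rw [amplitude_eq_iff hk0 hk1, ellF_add_pi hk0 hk1, ellF_amplitude hk0 hk1]

lemma ellF_int_mul_pi (n : ℤ) : ellF k (n * Real.pi) = n * (2 * ellK k) := by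
  induction n using Int.induction_on with
  | zero => simp [ellF_zero]
  | succ n ih =>
    push_cast at ih ⊢
    rw [add_mul, one_mul, ellF_add_pi hk0 hk1, ih]; ring
  | pred n ih =>
    have := ellF_add_pi hk0 hk1 ((-n - 1 : ℝ) * Real.pi)
    push_cast at ih ⊢
    rw [show ((-n - 1 : ℝ) * Real.pi) + Real.pi = -n * Real.pi by ring, ih] at this
    linarith

end

/-! ### Jacobi's elliptic functions of a real argument -/

/-- Jacobi's `sn`. -/
def sn (k u : ℝ) : ℝ := Real.sin (amplitude k u)
/-- Jacobi's `cn`. -/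
def cn (k u : ℝ) : ℝ := Real.cos (amplitude k u)
/-- Jacobi's `dn`. -/
def dn (k u : ℝ) : ℝ := ellDelta k (amplitude k u)

section

variable {k : ℝ}

lemma sn_sq_add_cn_sq (u : ℝ) : sn k u ^ 2 + cn k u ^ 2 = 1 := Real.sin_sq_add_cos_sq _

variable (hk0 : 0 < k) (hk1 : k < 1)
include hk0 hk1

lemma dn_sq (u : ℝ) : dn k u ^ 2 = 1 - k ^ 2 * sn k u ^ 2 := ellDelta_sq hk0 hk1 _

lemma dn_pos (u : ℝ) : 0 < dn k u := ellDelta_pos hk0 hk1 _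

lemma hasDerivAt_sn (u : ℝ) : HasDerivAt (sn k) (cn k u * dn k u) u :=
  (hasDerivAt_amplitude hk0 hk1 u).sin

lemma hasDerivAt_cn (u : ℝ) : HasDerivAt (cn k) (-(sn k u * dn k u)) u :=
  (hasDerivAt_amplitude hk0 hk1 u).cos.congr_deriv (by simp [sn, dn])

lemma hasDerivAt_dn (u : ℝ) : HasDerivAt (dn k) (-(k ^ 2 * sn k u * cn k u)) u := by
  have h1 : HasDerivAt (fun u ↦ 1 - k ^ 2 * sn k u ^ 2)
      (-(k ^ 2 * (2 * sn k u * (cn k u * dn k u)))) u := by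
    have := (((hasDerivAt_sn hk0 hk1 u).pow 2).const_mul (k ^ 2)).const_sub 1
    exact this.congr_deriv (by simp)
  have h2 := h1.sqrt (one_sub_sq_mul_sin_sq_pos hk0 hk1 _).ne'
  have hd := (dn_pos hk0 hk1 u).ne'
  refine h2.congr_deriv ?_
  change _ / (2 * dn k u) = _
  field_simp

lemma sn_add (u : ℝ) : sn k (u + 2 * ellK k) = -sn k u := by
  simp [sn, amplitude_add hk0 hk1]

lemma cn_add (u : ℝ) : cn k (u + 2 * ellK k) = -cn k u := by
  simp [cn, amplitude_add hk0 hk1]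

lemma dn_add (u : ℝ) : dn k (u + 2 * ellK k) = dn k u := by
  rw [dn, amplitude_add hk0 hk1, ellDelta_add_pi]; rfl

lemma amplitude_zero : amplitude k 0 = 0 := by
  rw [amplitude_eq_iff hk0 hk1, ellF_zero]

lemma amplitude_ellK : amplitude k (ellK k) = Real.pi / 2 := by
  rw [amplitude_eq_iff hk0 hk1, ellF_half_pi]

lemma amplitude_neg_ellK : amplitude k (-ellK k) = -(Real.pi / 2) := by
  rw [amplitude_eq_iff hk0 hk1, ellF_neg, ellF_half_pi]

lemma sn_eq_zero_iff {u : ℝ} : sn k u = 0 ↔ ∃ n : ℤ, u = n * (2 * ellK k) := by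
  rw [sn, Real.sin_eq_zero_iff]
  refine exists_congr fun n ↦ ?_
  rw [eq_comm, amplitude_eq_iff hk0 hk1, ellF_int_mul_pi hk0 hk1]

lemma cn_int_mul (n : ℤ) : cn k (n * (2 * ellK k)) = (-1) ^ n := by
  have h : amplitude k (n * (2 * ellK k)) = n * Real.pi := by
    rw [amplitude_eq_iff hk0 hk1, ellF_int_mul_pi hk0 hk1]
  rw [cn, h, Real.cos_int_mul_pi]

end

/-! ### The coordinate `ζ` as an elliptic function -/

/-- A function on `ℂ` whose partial derivatives satisfy the Cauchy–Riemann equations. -/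
lemma hasDerivAt_of_partial {f : ℂ → ℂ} {a z : ℂ} (hf : DifferentiableAt ℝ f z)
    (h1 : HasDerivAt (fun t : ℝ ↦ f (z + t)) a 0)
    (h2 : HasDerivAt (fun t : ℝ ↦ f (z + t * I)) (I * a) 0) : HasDerivAt f a z := by
  have e : ∀ w : ℂ, HasDerivAt (fun t : ℝ ↦ f (z + t * w)) (fderiv ℝ f z w) 0 := by
    intro w
    have hw : HasDerivAt (fun t : ℝ ↦ z + t * w) w 0 := by
      simpa using ((ofRealCLM.hasDerivAt (x := (0 : ℝ))).mul_const w).const_add z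
    have hf' : HasFDerivAt f (fderiv ℝ f z) (z + ((0 : ℝ) : ℂ) * w) := by
      simpa using hf.hasFDerivAt
    exact hf'.comp_hasDerivAt (0 : ℝ) hw
  have e1 : fderiv ℝ f z 1 = a := (e 1).unique (by simpa using h1)
  have e2 : fderiv ℝ f z I = I * a := (e I).unique h2
  have hC : fderiv ℝ f z I = I • fderiv ℝ f z 1 := by rw [e1, e2, smul_eq_mul]
  have hd := (differentiableAt_complex_iff_differentiableAt_real.2 ⟨hf, hC⟩).hasDerivAt
  rwa [complexOfReal_deriv hf hC, e1] at hd

lemma compl_pos {k : ℝ} (hk0 : 0 < k) (hk1 : k < 1) : 0 < compl k :=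
  Real.sqrt_pos.2 (by nlinarith)

lemma compl_sq {k : ℝ} (hk0 : 0 < k) (hk1 : k < 1) : compl k ^ 2 = 1 - k ^ 2 :=
  Real.sq_sqrt (by nlinarith)

lemma compl_lt_one {k : ℝ} (hk0 : 0 < k) (hk1 : k < 1) : compl k < 1 := by
  nlinarith [compl_pos hk0 hk1, compl_sq hk0 hk1]

/-- The denominator of `zetaFun`. -/
def zetaDen (k : ℝ) (z : ℂ) : ℝ :=
  1 + cn k (4 * ellK k * z.re) * cn (compl k) (4 * ellK k * z.im)

/-- The coordinate `ζ` of the curve as a function of `z = ∫ v`. -/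
def zetaFun (k : ℝ) (z : ℂ) : ℂ :=
  (I * sn k (4 * ellK k * z.re) * dn (compl k) (4 * ellK k * z.im)
    - sn (compl k) (4 * ellK k * z.im) * dn k (4 * ellK k * z.re)) / zetaDen k z

/-- The derivative of `zetaFun`. -/
def zetaFunDeriv (k : ℝ) (z : ℂ) : ℂ :=
  4 * ellK k * (I * dn k (4 * ellK k * z.re) * dn (compl k) (4 * ellK k * z.im) *
      (cn k (4 * ellK k * z.re) + cn (compl k) (4 * ellK k * z.im))
    + sn k (4 * ellK k * z.re) * sn (compl k) (4 * ellK k * z.im) *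
      (k ^ 2 * cn k (4 * ellK k * z.re) - compl k ^ 2 * cn (compl k) (4 * ellK k * z.im)))
    / zetaDen k z ^ 2

section

variable {k : ℝ} (hk0 : 0 < k) (hk1 : k < 1)
include hk0 hk1

lemma differentiable_sn : Differentiable ℝ (sn k) :=
  fun u ↦ (hasDerivAt_sn hk0 hk1 u).differentiableAt

lemma differentiable_cn : Differentiable ℝ (cn k) :=
  fun u ↦ (hasDerivAt_cn hk0 hk1 u).differentiableAt

lemma differentiable_dn : Differentiable ℝ (dn k) :=
  fun u ↦ (hasDerivAt_dn hk0 hk1 u).differentiableAt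

omit hk0 hk1 in
lemma differentiable_ofReal_comp_re {f : ℝ → ℝ} (hf : Differentiable ℝ f) (a : ℝ) :
    Differentiable ℝ fun z : ℂ ↦ (f (a * z.re) : ℂ) :=
  ofRealCLM.differentiable.comp (hf.comp (reCLM.differentiable.const_mul a))

omit hk0 hk1 in
lemma differentiable_ofReal_comp_im {f : ℝ → ℝ} (hf : Differentiable ℝ f) (a : ℝ) :
    Differentiable ℝ fun z : ℂ ↦ (f (a * z.im) : ℂ) :=
  ofRealCLM.differentiable.comp (hf.comp (imCLM.differentiable.const_mul a))

lemma continuous_zetaDen : Continuous (zetaDen k) := by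
  have h1 := (differentiable_cn hk0 hk1).continuous
  have h2 := (differentiable_cn (compl_pos hk0 hk1) (compl_lt_one hk0 hk1)).continuous
  unfold zetaDen
  fun_prop

lemma differentiableAt_real_zetaFun {z : ℂ} (hz : zetaDen k z ≠ 0) :
    DifferentiableAt ℝ (zetaFun k) z := by
  have h0 := compl_pos hk0 hk1
  have h1 := compl_lt_one hk0 hk1
  have s := differentiable_ofReal_comp_re (differentiable_sn hk0 hk1) (4 * ellK k)
  have c := differentiable_ofReal_comp_re (differentiable_cn hk0 hk1) (4 * ellK k)
  have d := differentiable_ofReal_comp_re (differentiable_dn hk0 hk1) (4 * ellK k)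
  have s1 := differentiable_ofReal_comp_im (differentiable_sn h0 h1) (4 * ellK k)
  have c1 := differentiable_ofReal_comp_im (differentiable_cn h0 h1) (4 * ellK k)
  have d1 := differentiable_ofReal_comp_im (differentiable_dn h0 h1) (4 * ellK k)
  have hD : Differentiable ℝ fun z ↦ (zetaDen k z : ℂ) := by
    have : (fun z ↦ (zetaDen k z : ℂ)) = fun z ↦ 1 + (cn k (4 * ellK k * z.re) : ℂ) *
        (cn (compl k) (4 * ellK k * z.im) : ℂ) := by
      funext z; simp [zetaDen]
    rw [this]
    exact (c.mul c1).const_add 1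
  have hN := ((s.const_mul I).mul d1).sub (s1.mul d)
  have h := (hN z).mul ((hD z).inv (by exact_mod_cast hz))
  exact h

omit hk0 hk1 in
lemma hasDerivAt_ofReal_shift {f : ℝ → ℝ} {f' : ℝ} (a x : ℝ) (hf : HasDerivAt f f' (a * x)) :
    HasDerivAt (fun t : ℝ ↦ (f (a * (x + t)) : ℂ)) (a * f') 0 := by
  have h1 : HasDerivAt (fun t : ℝ ↦ a * (x + t)) a 0 := by
    simpa using ((hasDerivAt_id (0 : ℝ)).const_add x).const_mul a
  have h2 : HasDerivAt f f' (a * (x + 0)) := by simpa using hf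
  have := (h2.comp (0 : ℝ) h1).ofReal_comp
  refine this.congr_deriv ?_
  push_cast; ring

/-- `zetaFun` is i sn(4Kz) / (1 + cn(4Kz)) after the half-argument addition formula and Jacobi's
imaginary transformation, so only real functions of Re z and Im z occur. Holomorphy is the
Cauchy–Riemann equations. Both partial derivatives reduce to `zetaFunDeriv` by the quadratic
relations between sn, cn, dn and by k² + k'² = 1. -/
lemma hasDerivAt_zetaFun {z : ℂ} (hz : zetaDen k z ≠ 0) :
    HasDerivAt (zetaFun k) (zetaFunDeriv k z) z := by
  have h0 := compl_pos hk0 hk1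
  have h1 := compl_lt_one hk0 hk1
  have hk' : (compl k : ℂ) ^ 2 = 1 - k ^ 2 := by exact_mod_cast compl_sq hk0 hk1
  have hsc : (sn k (4 * ellK k * z.re) : ℂ) ^ 2 = 1 - (cn k (4 * ellK k * z.re) : ℂ) ^ 2 := by
    rw [eq_sub_iff_add_eq]; exact_mod_cast sn_sq_add_cn_sq _
  have hsc1 : (sn (compl k) (4 * ellK k * z.im) : ℂ) ^ 2 =
      1 - (cn (compl k) (4 * ellK k * z.im) : ℂ) ^ 2 := by
    rw [eq_sub_iff_add_eq]; exact_mod_cast sn_sq_add_cn_sq _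
  have hd : (dn k (4 * ellK k * z.re) : ℂ) ^ 2 = 1 - k ^ 2 * (sn k (4 * ellK k * z.re) : ℂ) ^ 2 := by
    exact_mod_cast dn_sq hk0 hk1 _
  have hd1 : (dn (compl k) (4 * ellK k * z.im) : ℂ) ^ 2 =
      1 - (compl k) ^ 2 * (sn (compl k) (4 * ellK k * z.im) : ℂ) ^ 2 := by
    exact_mod_cast dn_sq h0 h1 _
  have hz' : (1 + (cn k (4 * ellK k * z.re) : ℂ) * (cn (compl k) (4 * ellK k * z.im) : ℂ)) ≠ 0 := by
    have : (zetaDen k z : ℂ) ≠ 0 := by exact_mod_cast hz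
    simpa [zetaDen] using this
  refine hasDerivAt_of_partial (differentiableAt_real_zetaFun hk0 hk1 hz) ?_ ?_
  · have s := hasDerivAt_ofReal_shift (4 * ellK k) z.re (hasDerivAt_sn hk0 hk1 _)
    have c := hasDerivAt_ofReal_shift (4 * ellK k) z.re (hasDerivAt_cn hk0 hk1 _)
    have d := hasDerivAt_ofReal_shift (4 * ellK k) z.re (hasDerivAt_dn hk0 hk1 _)
    have h := (((s.const_mul I).mul_const (dn (compl k) (4 * ellK k * z.im) : ℂ)).sub
      (d.const_mul (sn (compl k) (4 * ellK k * z.im) : ℂ))).div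
      ((c.mul_const (cn (compl k) (4 * ellK k * z.im) : ℂ)).const_add 1) (by simpa using hz')
    have e : (fun t : ℝ ↦ zetaFun k (z + t)) = _ := funext fun t ↦ by
      simp only [zetaFun, zetaDen, add_re, add_im, ofReal_re, ofReal_im, add_zero, ofReal_add,
        ofReal_one, ofReal_mul]
      rfl
    rw [e]
    refine h.congr_deriv ?_
    simp only [zetaFunDeriv, zetaDen, add_zero, Pi.sub_apply]
    push_cast
    generalize (sn k (4 * ellK k * z.re) : ℂ) = S at *
    generalize (cn k (4 * ellK k * z.re) : ℂ) = C at *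
    generalize (dn k (4 * ellK k * z.re) : ℂ) = D at *
    generalize (sn (compl k) (4 * ellK k * z.im) : ℂ) = S1 at *
    generalize (cn (compl k) (4 * ellK k * z.im) : ℂ) = C1 at *
    generalize (dn (compl k) (4 * ellK k * z.im) : ℂ) = D1 at *
    congr 1
    linear_combination 4 * ellK k * (I * D * D1 * C1 * hsc + S * S1 * C1 * (-hd + k ^ 2 * hsc + hk'))
  · have s := hasDerivAt_ofReal_shift (4 * ellK k) z.im (hasDerivAt_sn h0 h1 _)
    have c := hasDerivAt_ofReal_shift (4 * ellK k) z.im (hasDerivAt_cn h0 h1 _)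
    have d := hasDerivAt_ofReal_shift (4 * ellK k) z.im (hasDerivAt_dn h0 h1 _)
    have h := ((d.const_mul (I * (sn k (4 * ellK k * z.re) : ℂ))).sub
      (s.mul_const (dn k (4 * ellK k * z.re) : ℂ))).div
      ((c.const_mul (cn k (4 * ellK k * z.re) : ℂ)).const_add 1) (by simpa using hz')
    have e : (fun t : ℝ ↦ zetaFun k (z + t * I)) = _ := funext fun t ↦ by
      simp only [zetaFun, zetaDen, add_re, add_im, re_ofReal_mul, im_ofReal_mul, I_re, I_im,
        mul_zero, mul_one, add_zero, ofReal_add, ofReal_one, ofReal_mul]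
      rfl
    rw [e]
    refine h.congr_deriv ?_
    simp only [zetaFunDeriv, zetaDen, add_zero, Pi.sub_apply]
    push_cast
    generalize (sn k (4 * ellK k * z.re) : ℂ) = S at *
    generalize (cn k (4 * ellK k * z.re) : ℂ) = C at *
    generalize (dn k (4 * ellK k * z.re) : ℂ) = D at *
    generalize (sn (compl k) (4 * ellK k * z.im) : ℂ) = S1 at *
    generalize (cn (compl k) (4 * ellK k * z.im) : ℂ) = C1 at *
    generalize (dn (compl k) (4 * ellK k * z.im) : ℂ) = D1 at *
    rw [← mul_div_assoc]
    congr 1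
    linear_combination 4 * ellK k * (-D * D1 * C * hsc1 +
      I * S * S1 * C * (hd1 - compl k ^ 2 * hsc1 - hk')) -
      4 * ellK k * D * D1 * (C + C1) * I_sq

/-- This is the equation of the curve for η = ζ'/4, so that dζ/(4η) = dz. -/
lemma zetaFunDeriv_sq {z : ℂ} (hz : zetaDen k z ≠ 0) :
    zetaFunDeriv k z ^ 2 = -4 * ellK k ^ 2 *
      (zetaFun k z ^ 4 + 2 * (k ^ 2 - compl k ^ 2) * zetaFun k z ^ 2 + 1) := by
  have h0 := compl_pos hk0 hk1
  have h1 := compl_lt_one hk0 hk1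
  have hk' : (compl k : ℂ) ^ 2 = 1 - k ^ 2 := by exact_mod_cast compl_sq hk0 hk1
  have hsc : (sn k (4 * ellK k * z.re) : ℂ) ^ 2 = 1 - (cn k (4 * ellK k * z.re) : ℂ) ^ 2 := by
    rw [eq_sub_iff_add_eq]; exact_mod_cast sn_sq_add_cn_sq _
  have hsc1 : (sn (compl k) (4 * ellK k * z.im) : ℂ) ^ 2 =
      1 - (cn (compl k) (4 * ellK k * z.im) : ℂ) ^ 2 := by
    rw [eq_sub_iff_add_eq]; exact_mod_cast sn_sq_add_cn_sq _
  have hd : (dn k (4 * ellK k * z.re) : ℂ) ^ 2 = 1 - k ^ 2 * (sn k (4 * ellK k * z.re) : ℂ) ^ 2 := by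
    exact_mod_cast dn_sq hk0 hk1 _
  have hd1 : (dn (compl k) (4 * ellK k * z.im) : ℂ) ^ 2 =
      1 - (compl k) ^ 2 * (sn (compl k) (4 * ellK k * z.im) : ℂ) ^ 2 := by
    exact_mod_cast dn_sq h0 h1 _
  have hz' : (1 + (cn k (4 * ellK k * z.re) : ℂ) * (cn (compl k) (4 * ellK k * z.im) : ℂ)) ≠ 0 := by
    have : (zetaDen k z : ℂ) ≠ 0 := by exact_mod_cast hz
    simpa [zetaDen] using this
  simp only [zetaFunDeriv, zetaFun, zetaDen]
  push_cast
  rw [hk'] at *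
  generalize (sn k (4 * ellK k * z.re) : ℂ) = S at *
  generalize (cn k (4 * ellK k * z.re) : ℂ) = C at *
  generalize (dn k (4 * ellK k * z.re) : ℂ) = D at *
  generalize (sn (compl k) (4 * ellK k * z.im) : ℂ) = S1 at *
  generalize (cn (compl k) (4 * ellK k * z.im) : ℂ) = C1 at *
  generalize (dn (compl k) (4 * ellK k * z.im) : ℂ) = D1 at *
  rw [hsc] at hd
  rw [hsc1] at hd1
  -- The squares of S, S1, D, D1 are polynomials in C and C1. After squaring, these four enter
  -- otherwise only through β = S S1 D D1, whose square is again such a polynomial.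
  have hN2 : (I * S * D1 - S1 * D) ^ 2 = -(1 - C ^ 2) * (1 - (1 - k ^ 2) * (1 - C1 ^ 2)) +
      (1 - C1 ^ 2) * (1 - k ^ 2 * (1 - C ^ 2)) - 2 * I * (S * S1 * D * D1) := by
    rw [← hd, ← hd1, ← hsc, ← hsc1]; linear_combination (S ^ 2 * D1 ^ 2) * I_sq
  have hβ : (S * S1 * D * D1) ^ 2 = (1 - C ^ 2) * (1 - C1 ^ 2) * (1 - k ^ 2 * (1 - C ^ 2)) *
      (1 - (1 - k ^ 2) * (1 - C1 ^ 2)) := by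
    rw [← hd, ← hd1, ← hsc, ← hsc1]; ring
  have hM2 : (I * D * D1 * (C + C1) + S * S1 * (k ^ 2 * C - (1 - k ^ 2) * C1)) ^ 2 =
      -(1 - k ^ 2 * (1 - C ^ 2)) * (1 - (1 - k ^ 2) * (1 - C1 ^ 2)) * (C + C1) ^ 2 +
      (1 - C ^ 2) * (1 - C1 ^ 2) * (k ^ 2 * C - (1 - k ^ 2) * C1) ^ 2 +
      2 * I * (S * S1 * D * D1) * (C + C1) * (k ^ 2 * C - (1 - k ^ 2) * C1) := by
    rw [← hd, ← hd1, ← hsc, ← hsc1]; linear_combination (D ^ 2 * D1 ^ 2 * (C + C1) ^ 2) * I_sq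
  rw [div_pow, div_pow, div_pow, mul_pow, hM2,
    show (I * S * D1 - S1 * D) ^ 4 = ((I * S * D1 - S1 * D) ^ 2) ^ 2 by ring, hN2]
  generalize S * S1 * D * D1 = β at *
  field_simp
  linear_combination (4 * ellK k ^ 2 * β ^ 2) * I_sq - 4 * ellK k ^ 2 * hβ


lemma zetaDen_add_half (z : ℂ) : zetaDen k (z + 1 / 2) =
    1 - cn k (4 * ellK k * z.re) * cn (compl k) (4 * ellK k * z.im) := by
  have h : 4 * ellK k * (z + 1 / 2).re = 4 * ellK k * z.re + 2 * ellK k := by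
    simp; ring
  have h2 : (z + 1 / 2).im = z.im := by simp
  rw [zetaDen, h, h2, cn_add hk0 hk1]; ring

lemma zetaDen_add_half_ne_zero {z : ℂ} (hz : zetaDen k z = 0) : zetaDen k (z + 1 / 2) ≠ 0 := by
  rw [zetaDen_add_half hk0 hk1]
  rw [zetaDen] at hz
  intro h; linarith

/-- Translation by 1/2 is the involution (ζ, η) ↦ (1/ζ, -η/ζ²). It exchanges zeros and poles of ζ,
so a statement at a pole reduces to one at a finite point. -/
lemma zetaFun_mul_zetaFun_add_half {z : ℂ} (hz : zetaDen k z ≠ 0)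
    (hz2 : zetaDen k (z + 1 / 2) ≠ 0) : zetaFun k z * zetaFun k (z + 1 / 2) = 1 := by
  have h : 4 * ellK k * (z + 1 / 2).re = 4 * ellK k * z.re + 2 * ellK k := by
    simp; ring
  have h2 : (z + 1 / 2).im = z.im := by simp
  rw [zetaFun, zetaFun, div_mul_div_comm, div_eq_one_iff_eq (by
    exact mul_ne_zero (by exact_mod_cast hz) (by exact_mod_cast hz2)), zetaDen_add_half hk0 hk1,
    h, h2, sn_add hk0 hk1, dn_add hk0 hk1, zetaDen]
  have hk' : (compl k : ℂ) ^ 2 = 1 - k ^ 2 := by exact_mod_cast compl_sq hk0 hk1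
  have hsc : (sn k (4 * ellK k * z.re) : ℂ) ^ 2 = 1 - (cn k (4 * ellK k * z.re) : ℂ) ^ 2 := by
    rw [eq_sub_iff_add_eq]; exact_mod_cast sn_sq_add_cn_sq _
  have hsc1 : (sn (compl k) (4 * ellK k * z.im) : ℂ) ^ 2 =
      1 - (cn (compl k) (4 * ellK k * z.im) : ℂ) ^ 2 := by
    rw [eq_sub_iff_add_eq]; exact_mod_cast sn_sq_add_cn_sq _
  have hd : (dn k (4 * ellK k * z.re) : ℂ) ^ 2 = 1 - k ^ 2 * (sn k (4 * ellK k * z.re) : ℂ) ^ 2 := by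
    exact_mod_cast dn_sq hk0 hk1 _
  have hd1 : (dn (compl k) (4 * ellK k * z.im) : ℂ) ^ 2 =
      1 - (compl k) ^ 2 * (sn (compl k) (4 * ellK k * z.im) : ℂ) ^ 2 := by
    exact_mod_cast dn_sq (compl_pos hk0 hk1) (compl_lt_one hk0 hk1) _
  rw [hk', hsc1] at hd1
  rw [hsc] at hd
  push_cast
  generalize (sn k (4 * ellK k * z.re) : ℂ) = S at *
  generalize (cn k (4 * ellK k * z.re) : ℂ) = C at *
  generalize (dn k (4 * ellK k * z.re) : ℂ) = D at *
  generalize (sn (compl k) (4 * ellK k * z.im) : ℂ) = S1 at *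
  generalize (cn (compl k) (4 * ellK k * z.im) : ℂ) = C1 at *
  generalize (dn (compl k) (4 * ellK k * z.im) : ℂ) = D1 at *
  have : (I * S * D1 - S1 * D) * (I * -S * D1 - S1 * D) = S ^ 2 * D1 ^ 2 + S1 ^ 2 * D ^ 2 := by
    linear_combination (-S ^ 2 * D1 ^ 2) * I_sq
  rw [this, hsc, hsc1, hd, hd1]
  ring

omit hk0 hk1 in
lemma tau_re : (tau k).re = 0 := by simp [tau, div_re, normSq]

lemma tau_im : (tau k).im = ellK (compl k) / ellK k := by
  have hK := (ellK_pos hk0 hk1).ne'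
  have : tau k = ((ellK (compl k) / ellK k : ℝ) : ℂ) * I := by
    rw [tau]; push_cast; ring
  rw [this]; simp

lemma tau_im_pos : 0 < (tau k).im := by
  rw [tau_im hk0 hk1]
  exact div_pos (ellK_pos (compl_pos hk0 hk1) (compl_lt_one hk0 hk1)) (ellK_pos hk0 hk1)

lemma four_mul_ellK_mul_tau_im : 4 * ellK k * (tau k).im = 2 * (2 * ellK (compl k)) := by
  have hK := (ellK_pos hk0 hk1).ne'
  rw [tau_im hk0 hk1]; field_simp; ring

lemma zeta_add_one (z : ℂ) : zetaDen k (z + 1) = zetaDen k z ∧ zetaFun k (z + 1) = zetaFun k z := by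
  have h : 4 * ellK k * (z + 1).re = 4 * ellK k * z.re + 2 * ellK k + 2 * ellK k := by
    simp; ring
  have h2 : (z + 1).im = z.im := by simp
  have hD : zetaDen k (z + 1) = zetaDen k z := by
    rw [zetaDen, h, h2, cn_add hk0 hk1, cn_add hk0 hk1, zetaDen, neg_neg]
  refine ⟨hD, ?_⟩
  rw [zetaFun, hD, h, h2, sn_add hk0 hk1, sn_add hk0 hk1, dn_add hk0 hk1, dn_add hk0 hk1, neg_neg,
    zetaFun]

lemma zeta_add_tau (z : ℂ) :
    zetaDen k (z + tau k) = zetaDen k z ∧ zetaFun k (z + tau k) = zetaFun k z := by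
  have h0 := compl_pos hk0 hk1
  have h1 := compl_lt_one hk0 hk1
  have h : 4 * ellK k * (z + tau k).im =
      4 * ellK k * z.im + 2 * ellK (compl k) + 2 * ellK (compl k) := by
    rw [add_im, mul_add, four_mul_ellK_mul_tau_im hk0 hk1]; ring
  have h2 : (z + tau k).re = z.re := by simp [tau_re]
  have hD : zetaDen k (z + tau k) = zetaDen k z := by
    rw [zetaDen, h, h2, cn_add h0 h1, cn_add h0 h1, zetaDen, neg_neg]
  refine ⟨hD, ?_⟩
  rw [zetaFun, hD, h, h2, sn_add h0 h1, sn_add h0 h1, dn_add h0 h1, dn_add h0 h1, neg_neg,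
    zetaFun]

/-- The values of the Jacobi functions at the half periods. -/
lemma half_period_values (m n : ℤ) :
    sn k (4 * ellK k * ((m * tau k + n) / 2).re) = 0 ∧
    sn (compl k) (4 * ellK k * ((m * tau k + n) / 2).im) = 0 ∧
    zetaDen k ((m * tau k + n) / 2) = 1 + (-1) ^ n * (-1) ^ m := by
  have h0 := compl_pos hk0 hk1
  have h1 := compl_lt_one hk0 hk1
  have hre : 4 * ellK k * ((m * tau k + n) / 2).re = n * (2 * ellK k) := by
    simp [tau_re]; ring
  have him : 4 * ellK k * ((m * tau k + n) / 2).im = m * (2 * ellK (compl k)) := by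
    have := four_mul_ellK_mul_tau_im hk0 hk1
    simp; linear_combination (m / 2 : ℝ) * this
  rw [zetaDen, hre, him, cn_int_mul hk0 hk1, cn_int_mul h0 h1]
  exact ⟨(sn_eq_zero_iff hk0 hk1).2 ⟨n, rfl⟩, (sn_eq_zero_iff h0 h1).2 ⟨m, rfl⟩, rfl⟩

lemma exists_half_period_of_sn_eq_zero {z : ℂ} (hs : sn k (4 * ellK k * z.re) = 0)
    (hs1 : sn (compl k) (4 * ellK k * z.im) = 0) : ∃ m n : ℤ, z = (m * tau k + n) / 2 := by
  have hK := (ellK_pos hk0 hk1).ne'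
  obtain ⟨n, hn⟩ := (sn_eq_zero_iff hk0 hk1).1 hs
  obtain ⟨m, hm⟩ := (sn_eq_zero_iff (compl_pos hk0 hk1) (compl_lt_one hk0 hk1)).1 hs1
  refine ⟨m, n, Complex.ext ?_ ?_⟩
  · simp [tau_re]
    have : ellK k * (2 * z.re) = ellK k * n := by linear_combination hn / 2
    linarith [mul_left_cancel₀ hK this]
  · simp [tau_im hk0 hk1]
    field_simp
    linear_combination hm / 2

end

/-! ### Homogeneous coordinates on the curve by theta functions -/

/-- The denominator of `ζ` as a theta function. -/
def thetaA (k : ℝ) (z : ℂ) : ℂ := theta (tau k) (z - 1 / 2) * theta (tau k) (z - tau k / 2)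

/-- The numerator of `ζ` as a theta function, up to a constant factor. -/
def thetaNum (k : ℝ) (z : ℂ) : ℂ := theta (tau k) z * theta (tau k) (z - (1 + tau k) / 2)

section

variable {k : ℝ} (hk0 : 0 < k) (hk1 : k < 1)
include hk0 hk1

lemma differentiable_thetaA : Differentiable ℂ (thetaA k) :=
  (differentiable_theta_sub (tau_im_pos hk0 hk1) _).mul
    (differentiable_theta_sub (tau_im_pos hk0 hk1) _)

lemma differentiable_thetaNum : Differentiable ℂ (thetaNum k) :=
  (differentiable_theta (tau_im_pos hk0 hk1)).mul (differentiable_theta_sub (tau_im_pos hk0 hk1) _)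

omit hk0 hk1 in
lemma thetaA_add_half (z : ℂ) : thetaA k (z + 1 / 2) = thetaNum k z := by
  have h : theta (tau k) (z + 1 / 2 - tau k / 2) = theta (tau k) (z - (1 + tau k) / 2) := by
    rw [← theta_add_one (z - (1 + tau k) / 2)]; ring_nf
  rw [thetaA, thetaNum, h, add_sub_cancel_right]

omit hk0 hk1 in
lemma thetaA_add_one (z : ℂ) : thetaA k (z + 1) = thetaA k z := by
  rw [thetaA, thetaA, add_sub_right_comm, theta_add_one, add_sub_right_comm, theta_add_one]

omit hk0 hk1 in
lemma thetaNum_add_half (z : ℂ) : thetaNum k (z + 1 / 2) = thetaA k z := by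
  rw [← thetaA_add_half, ← thetaA_add_one z]; ring_nf

omit hk0 hk1 in
lemma thetaNum_add_one (z : ℂ) : thetaNum k (z + 1) = thetaNum k z := by
  rw [← thetaA_add_half, ← thetaA_add_half, add_right_comm, thetaA_add_one]

/-- The factor of automorphy of `thetaA` and `thetaNum` for the period `τ`. -/
def thetaFactor (k : ℝ) (z : ℂ) : ℂ := -expTwoPi (tau k / 2 - 2 * z)

lemma thetaA_add_tau (z : ℂ) : thetaA k (z + tau k) = thetaFactor k z * thetaA k z := by
  have hτ := tau_im_pos hk0 hk1
  rw [thetaA, thetaA, add_sub_right_comm, theta_add_tau hτ, add_sub_right_comm, theta_add_tau hτ,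
    thetaFactor]
  have : expTwoPi (-(z - 1 / 2)) * expTwoPi (-(z - tau k / 2)) =
      -expTwoPi (tau k / 2 - 2 * z) := by
    rw [← expTwoPi_add, show -(z - 1 / 2) + -(z - tau k / 2) = 1 / 2 + (tau k / 2 - 2 * z) by ring,
      expTwoPi_add, expTwoPi_half]; ring
  rw [← this]; ring

lemma thetaNum_add_tau (z : ℂ) : thetaNum k (z + tau k) = thetaFactor k z * thetaNum k z := by
  have h : thetaFactor k (z + 1 / 2) = thetaFactor k z := by
    rw [thetaFactor, thetaFactor, show tau k / 2 - 2 * z = tau k / 2 - 2 * (z + 1 / 2) + 1 by ring,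
      expTwoPi_add _ 1, expTwoPi_one, mul_one]
  rw [← thetaA_add_half, ← thetaA_add_half, add_right_comm, thetaA_add_tau hk0 hk1, h]

omit hk0 hk1 in
lemma thetaFactor_ne_zero (z : ℂ) : thetaFactor k z ≠ 0 := neg_ne_zero.2 (expTwoPi_ne_zero _)

/-- The zeros of A are half periods (mτ + n)/2 with m + n odd. There the denominator of ζ is 1 +
(-1)^(m+n) = 0. -/
lemma thetaA_ne_zero_of_zetaDen {z : ℂ} (hz : zetaDen k z ≠ 0) : thetaA k z ≠ 0 := by
  have hτ := tau_im_pos hk0 hk1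
  refine mul_ne_zero (fun h ↦ hz ?_) (fun h ↦ hz ?_)
  · obtain ⟨m, n, h⟩ := (theta_eq_zero_iff hτ).1 h
    have : z = ((2 * m : ℤ) * tau k + (2 * n + 1 : ℤ)) / 2 := by
      push_cast; linear_combination h
    rw [this, (half_period_values hk0 hk1 _ _).2.2, zpow_add₀ (by norm_num), zpow_mul, zpow_mul]
    norm_num
  · obtain ⟨m, n, h⟩ := (theta_eq_zero_iff hτ).1 h
    have : z = ((2 * m + 1 : ℤ) * tau k + (2 * n : ℤ)) / 2 := by
      push_cast; linear_combination h
    rw [this, (half_period_values hk0 hk1 _ _).2.2, zpow_add₀ (by norm_num), zpow_mul, zpow_mul]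
    norm_num

lemma zetaFun_eq_zero_of_thetaNum {z : ℂ} (h : thetaNum k z = 0) :
    sn k (4 * ellK k * z.re) = 0 ∧ sn (compl k) (4 * ellK k * z.im) = 0 := by
  have hτ := tau_im_pos hk0 hk1
  have : ∃ m n : ℤ, z = (m * tau k + n) / 2 := by
    rcases mul_eq_zero.1 h with h | h
    · obtain ⟨m, n, h⟩ := (theta_eq_zero_iff hτ).1 h
      exact ⟨2 * m, 2 * n, by push_cast; linear_combination h⟩
    · obtain ⟨m, n, h⟩ := (theta_eq_zero_iff hτ).1 h
      exact ⟨2 * m + 1, 2 * n + 1, by push_cast; linear_combination h⟩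
  obtain ⟨m, n, rfl⟩ := this
  have := half_period_values hk0 hk1 m n
  exact ⟨this.1, this.2.1⟩

lemma sn_eq_zero_of_zetaFun {z : ℂ} (hz : zetaDen k z ≠ 0) (h : zetaFun k z = 0) :
    sn k (4 * ellK k * z.re) = 0 ∧ sn (compl k) (4 * ellK k * z.im) = 0 := by
  have hd := dn_pos hk0 hk1 (4 * ellK k * z.re)
  have hd1 := dn_pos (compl_pos hk0 hk1) (compl_lt_one hk0 hk1) (4 * ellK k * z.im)
  rw [zetaFun, div_eq_zero_iff] at h
  have h := h.resolve_right (by exact_mod_cast hz)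
  have him := congrArg Complex.im h
  have hre := congrArg Complex.re h
  simp at him hre
  exact ⟨him.resolve_right hd1.ne', hre.resolve_right hd.ne'⟩

/-- A zero of ζ is a half period (mτ + n)/2 with m + n even. If m and n are even only the first
theta factor vanishes, if they are odd only the second. -/
lemma analyticOrderAt_thetaNum_of_zetaFun {z : ℂ} (hz : zetaDen k z ≠ 0) (h : zetaFun k z = 0) :
    analyticOrderAt (thetaNum k) z = 1 := by
  have hτ := tau_im_pos hk0 hk1
  obtain ⟨hs, hs1⟩ := sn_eq_zero_of_zetaFun hk0 hk1 hz h
  obtain ⟨m, n, hmn⟩ := exists_half_period_of_sn_eq_zero hk0 hk1 hs hs1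
  have hD := (half_period_values hk0 hk1 m n).2.2
  rw [← hmn] at hD
  rw [hD, ← zpow_add₀ (by norm_num)] at hz
  have hev : Even (n + m) := by
    by_contra hodd
    rw [Int.not_even_iff_odd] at hodd
    rw [hodd.neg_one_zpow] at hz
    norm_num at hz
  have hmul : analyticOrderAt (thetaNum k) z = analyticOrderAt (fun z ↦ theta (tau k) (z - 0)) z +
      analyticOrderAt (fun z ↦ theta (tau k) (z - (1 + tau k) / 2)) z := by
    rw [← analyticOrderAt_mul ((differentiable_theta_sub hτ _).analyticAt z)
      ((differentiable_theta_sub hτ _).analyticAt z)]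
    congr 1; funext w; simp [thetaNum]
  rw [hmul, analyticOrderAt_theta_sub hτ, analyticOrderAt_theta_sub hτ, sub_zero]
  have key : ∀ j l : ℤ, ((j : ℝ) + 1 / 2) ≠ l := by
    intro j l h
    have : (2 * j + 1 : ℤ) = 2 * l := by
      have : (2 * j + 1 : ℝ) = 2 * l := by linarith
      exact_mod_cast this
    omega
  rcases Int.even_or_odd n with hn | hn
  · obtain ⟨a, ha⟩ := hn
    obtain ⟨b, hb⟩ : Even m := by
      rw [Int.even_add] at hev; exact hev.1 ⟨a, ha⟩
    rw [if_pos ⟨b, a, by rw [hmn, ha, hb]; push_cast; ring⟩, if_neg, add_zero]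
    have := not_inLattice_of_coords hτ (a := ((b - 1 : ℤ) : ℝ) + 1 / 2)
      (b := ((a - 1 : ℤ) : ℝ) + 1 / 2) (Or.inl (key _))
    convert this using 1
    rw [hmn, ha, hb]; push_cast; ring_nf
  · obtain ⟨a, ha⟩ := hn
    obtain ⟨b, hb⟩ : Odd m := by
      rw [Int.even_add'] at hev; exact hev.1 ⟨a, ha⟩
    rw [if_neg, if_pos ⟨b, a, by rw [hmn, ha, hb]; push_cast; ring⟩, zero_add]
    have := not_inLattice_of_coords hτ (a := (b : ℝ) + 1 / 2)
      (b := (a : ℝ) + 1 / 2) (Or.inl (key _))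
    convert this using 1
    rw [hmn, ha, hb]; push_cast; ring_nf

lemma eventually_zetaDen_ne_zero {z : ℂ} (hz : zetaDen k z ≠ 0) : ∀ᶠ w in 𝓝 z, zetaDen k w ≠ 0 :=
  (continuous_zetaDen hk0 hk1).continuousAt.eventually_ne hz

lemma analyticAt_zetaFun {z : ℂ} (hz : zetaDen k z ≠ 0) : AnalyticAt ℂ (zetaFun k) z := by
  rw [analyticAt_iff_eventually_differentiableAt]
  filter_upwards [eventually_zetaDen_ne_zero hk0 hk1 hz] with w hw
  exact (hasDerivAt_zetaFun hk0 hk1 hw).differentiableAt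

lemma zetaFunDeriv_ne_zero_of_zetaFun {z : ℂ} (hz : zetaDen k z ≠ 0) (h : zetaFun k z = 0) :
    zetaFunDeriv k z ≠ 0 := by
  intro h'
  have := zetaFunDeriv_sq hk0 hk1 hz
  rw [h, h'] at this
  have hK := (ellK_pos hk0 hk1).ne'
  have hK' : (ellK k : ℂ) ≠ 0 := by exact_mod_cast hK
  simp [hK'] at this

/-! ### Comparison of ζ with the quotient of theta functions -/

/-- The quotient of `ζ` by the corresponding quotient of theta functions. -/
def zetaRatio (k : ℝ) (z : ℂ) : ℂ := zetaFun k z * thetaA k z / thetaNum k z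

lemma zetaRatio_order {z : ℂ} (hz : zetaDen k z ≠ 0) :
    MeromorphicAt (zetaRatio k) z ∧ meromorphicOrderAt (zetaRatio k) z = 0 := by
  have ha := analyticAt_zetaFun hk0 hk1 hz
  have hA := (differentiable_thetaA hk0 hk1).analyticAt z
  have hB := (differentiable_thetaNum hk0 hk1).analyticAt z
  have hA0 := thetaA_ne_zero_of_zetaDen hk0 hk1 hz
  refine ⟨(ha.mul hA).meromorphicAt.div hB.meromorphicAt, ?_⟩
  have h1 : meromorphicOrderAt (zetaRatio k) z = meromorphicOrderAt (zetaFun k) z +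
      meromorphicOrderAt (thetaA k) z - meromorphicOrderAt (thetaNum k) z := by
    rw [← meromorphicOrderAt_mul ha.meromorphicAt hA.meromorphicAt,
      ← meromorphicOrderAt_div (ha.mul hA).meromorphicAt hB.meromorphicAt]
    rfl
  rw [h1, ha.meromorphicOrderAt_eq, hA.meromorphicOrderAt_eq, hB.meromorphicOrderAt_eq,
    hA.analyticOrderAt_eq_zero.2 hA0]
  by_cases h : zetaFun k z = 0
  · rw [analyticOrderAt_thetaNum_of_zetaFun hk0 hk1 hz h,
      ha.analyticOrderAt_eq_one_of_zero_deriv_ne_zero h (by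
        rw [(hasDerivAt_zetaFun hk0 hk1 hz).deriv]
        exact zetaFunDeriv_ne_zero_of_zetaFun hk0 hk1 hz h)]
    rfl
  · rw [ha.analyticOrderAt_eq_zero.2 h, hB.analyticOrderAt_eq_zero.2 (fun h0 ↦ h (by
      obtain ⟨hs, hs1⟩ := zetaFun_eq_zero_of_thetaNum hk0 hk1 h0
      simp [zetaFun, hs, hs1]))]
    rfl

end

lemma eq_of_eventuallyEq_nhdsNE {f g : ℂ → ℂ} {z : ℂ} (hf : ContinuousAt f z)
    (hg : ContinuousAt g z) (h : f =ᶠ[𝓝[≠] z] g) : f z = g z :=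
  tendsto_nhds_unique (hf.tendsto.mono_left nhdsWithin_le_nhds)
    ((hg.tendsto.mono_left nhdsWithin_le_nhds).congr' h.symm)

lemma tendsto_add_const_nhdsNE (z a : ℂ) : Tendsto (fun w ↦ w + a) (𝓝[≠] z) (𝓝[≠] (z + a)) := by
  refine tendsto_nhdsWithin_iff.2 ⟨?_, ?_⟩
  · exact ((continuous_add_const a).tendsto z).mono_left nhdsWithin_le_nhds
  · filter_upwards [self_mem_nhdsWithin] with w hw
    simpa using hw

section

variable {k : ℝ} (hk0 : 0 < k) (hk1 : k < 1)
include hk0 hk1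

omit hk0 hk1 in
-- Two numbers of modulus at most 1 have product -1 only if both are ±1, and then the corresponding
-- sn vanish.
lemma sn_eq_zero_of_zetaDen {z : ℂ} (h : zetaDen k z = 0) :
    sn k (4 * ellK k * z.re) = 0 ∧ sn (compl k) (4 * ellK k * z.im) = 0 := by
  rw [zetaDen] at h
  have h1 := sn_sq_add_cn_sq (k := k) (4 * ellK k * z.re)
  have h2 := sn_sq_add_cn_sq (k := compl k) (4 * ellK k * z.im)
  generalize cn k (4 * ellK k * z.re) = c at *
  generalize cn (compl k) (4 * ellK k * z.im) = c' at *
  generalize sn k (4 * ellK k * z.re) = s at *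
  generalize sn (compl k) (4 * ellK k * z.im) = s' at *
  have h3 : s ^ 2 + s' ^ 2 = s ^ 2 * s' ^ 2 := by
    have h4 : (c * c') ^ 2 = 1 := by rw [show c * c' = -1 by linarith]; norm_num
    have : (1 - s ^ 2) * (1 - s' ^ 2) = 1 := by
      rw [show 1 - s ^ 2 = c ^ 2 by linarith, show 1 - s' ^ 2 = c' ^ 2 by linarith, ← mul_pow, h4]
    linarith
  have hs1 : s ^ 2 ≤ 1 := by nlinarith [sq_nonneg c]
  have hs2 : s' ^ 2 ≤ 1 := by nlinarith [sq_nonneg c']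
  constructor
  · have : s ^ 2 = 0 := by nlinarith [sq_nonneg s, sq_nonneg s']
    exact pow_eq_zero_iff (by norm_num) |>.1 this
  · have : s' ^ 2 = 0 := by nlinarith [sq_nonneg s, sq_nonneg s']
    exact pow_eq_zero_iff (by norm_num) |>.1 this

lemma zetaFun_add_half_eq_zero {z : ℂ} (h : zetaDen k z = 0) : zetaFun k (z + 1 / 2) = 0 := by
  obtain ⟨h1, h2⟩ := sn_eq_zero_of_zetaDen h
  have e : 4 * ellK k * (z + 1 / 2).re = 4 * ellK k * z.re + 2 * ellK k := by
    simp; ring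
  have e2 : (z + 1 / 2).im = z.im := by simp
  rw [zetaFun, e, e2, sn_add hk0 hk1, h1, h2]
  simp

/-- The half-period shift inverts ζ and swaps the two theta products, hence inverts the ratio. This
gives the order at the poles of ζ, and later the square of the constant. -/
lemma eventually_zetaRatio_eq_inv {z : ℂ} (hz : zetaDen k z = 0) :
    zetaRatio k =ᶠ[𝓝[≠] z] fun w ↦ (zetaRatio k (w + 1 / 2))⁻¹ := by
  have hz2 := zetaDen_add_half_ne_zero hk0 hk1 hz
  have hd := (hasDerivAt_zetaFun hk0 hk1 hz2)
  have h0 := zetaFun_add_half_eq_zero hk0 hk1 hz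
  have hne := hd.eventually_ne (c := 0) (zetaFunDeriv_ne_zero_of_zetaFun hk0 hk1 hz2 h0)
  have hD : ∀ᶠ w in 𝓝[≠] (z + 1 / 2), zetaDen k w ≠ 0 :=
    (eventually_zetaDen_ne_zero hk0 hk1 hz2).filter_mono nhdsWithin_le_nhds
  filter_upwards [(tendsto_add_const_nhdsNE z (1 / 2)).eventually hne,
    (tendsto_add_const_nhdsNE z (1 / 2)).eventually hD] with w hw1 hw2
  have hw3 : zetaDen k w ≠ 0 := fun h ↦ hw1 (zetaFun_add_half_eq_zero hk0 hk1 h)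
  have hA := thetaA_ne_zero_of_zetaDen hk0 hk1 hw3
  have hN := thetaA_ne_zero_of_zetaDen hk0 hk1 hw2
  rw [thetaA_add_half] at hN
  have hm := zetaFun_mul_zetaFun_add_half hk0 hk1 hw3 hw2
  rw [zetaRatio, zetaRatio, thetaA_add_half, thetaNum_add_half]
  refine eq_inv_of_mul_eq_one_left ?_
  generalize zetaFun k (w + 1 / 2) = u at *
  field_simp
  linear_combination hm

lemma zetaRatio_order' (z : ℂ) :
    MeromorphicAt (zetaRatio k) z ∧ meromorphicOrderAt (zetaRatio k) z = 0 := by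
  by_cases hz : zetaDen k z = 0
  · have h := eventually_zetaRatio_eq_inv hk0 hk1 hz
    obtain ⟨h1, h2⟩ := zetaRatio_order hk0 hk1 (zetaDen_add_half_ne_zero hk0 hk1 hz)
    have h3 : MeromorphicAt (fun w ↦ zetaRatio k (w + 1 / 2)) z :=
      h1.comp_analyticAt (f := zetaRatio k) (g := fun w ↦ w + 1 / 2) (by fun_prop)
    refine ⟨h3.inv.congr h.symm, ?_⟩
    rw [meromorphicOrderAt_congr h]
    have := meromorphicOrderAt_inv (f := fun w ↦ zetaRatio k (w + 1 / 2)) (x := z)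
    have h4 : meromorphicOrderAt (fun w ↦ zetaRatio k (w + 1 / 2)) z =
      meromorphicOrderAt (zetaRatio k) (z + 1 / 2) :=
      meromorphicOrderAt_comp_add_const_eq_meromorphicOrderAt (f := zetaRatio k)
    rw [h4, h2] at this
    exact this.trans neg_zero
  · exact zetaRatio_order hk0 hk1 hz

lemma zetaRatio_add_one (z : ℂ) : zetaRatio k (z + 1) = zetaRatio k z := by
  rw [zetaRatio, (zeta_add_one hk0 hk1 z).2, thetaA_add_one, thetaNum_add_one, zetaRatio]

lemma zetaRatio_add_tau (z : ℂ) : zetaRatio k (z + tau k) = zetaRatio k z := by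
  rw [zetaRatio, (zeta_add_tau hk0 hk1 z).2, thetaA_add_tau hk0 hk1, thetaNum_add_tau hk0 hk1,
    zetaRatio, mul_left_comm, mul_div_mul_left _ _ (thetaFactor_ne_zero z)]

lemma zetaDen_half : zetaDen k (1 / 2) = 0 := by
  have := (half_period_values hk0 hk1 0 1).2.2
  simpa using this

/-- The ratio is elliptic and of order 0 everywhere, so its normal form is a nonzero constant κ. -/
lemma exists_zetaFun_eq : ∃ κ : ℂ, κ ^ 2 = 1 ∧
    ∀ z, zetaDen k z ≠ 0 → zetaFun k z * thetaA k z = κ * thetaNum k z := by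
  obtain ⟨g, hg, heq, hcont, hne⟩ := exists_differentiable_of_meromorphicOrderAt_nonneg
    (fun z ↦ (zetaRatio_order' hk0 hk1 z).1) (fun z ↦ (zetaRatio_order' hk0 hk1 z).2.ge)
  have hper : ∀ a, (∀ z, zetaRatio k (z + a) = zetaRatio k z) → ∀ z, g (z + a) = g z := by
    intro a ha z
    -- The ratio may carry default values at isolated points, so its period passes to g through
    -- punctured neighbourhoods.
    refine eq_of_eventuallyEq_nhdsNE (f := fun z ↦ g (z + a))
      (hg.continuous.comp (continuous_add_const a)).continuousAt hg.continuous.continuousAt ?_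
    filter_upwards [heq z, (tendsto_add_const_nhdsNE z a).eventually (heq (z + a))] with w h1 h2
    rw [← h1, ← h2, ha]
  obtain ⟨κ, hκ⟩ := exists_eq_const_of_periodic (tau_im_pos hk0 hk1) hg
    (hper 1 (zetaRatio_add_one hk0 hk1)) (hper _ (zetaRatio_add_tau hk0 hk1))
  have hκ0 : κ ≠ 0 := by
    rw [← hκ 0]; exact hne 0 (zetaRatio_order' hk0 hk1 0).2
  refine ⟨κ, ?_, fun z hz ↦ ?_⟩
  -- Near the pole 1/2 the inversion reads κ = κ⁻¹.
  · have h1 := eventually_zetaRatio_eq_inv hk0 hk1 (zetaDen_half hk0 hk1)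
    obtain ⟨w, h2, h3, h4⟩ := (h1.and ((heq (1 / 2)).and
      ((tendsto_add_const_nhdsNE (1 / 2) (1 / 2)).eventually (heq (1 / 2 + 1 / 2))))).exists
    simp only [h3, h4, hκ] at h2
    rw [sq]
    nth_rewrite 1 [h2]
    exact inv_mul_cancel₀ hκ0
  · by_cases hN : thetaNum k z = 0
    · obtain ⟨hs, hs1⟩ := zetaFun_eq_zero_of_thetaNum hk0 hk1 hN
      simp [zetaFun, hs, hs1, hN]
    · have h := hcont z (((analyticAt_zetaFun hk0 hk1 hz).continuousAt.mul
        (differentiable_thetaA hk0 hk1).continuous.continuousAt).div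
        (differentiable_thetaNum hk0 hk1).continuous.continuousAt hN)
      rw [hκ, zetaRatio, div_eq_iff hN] at h
      exact h

end

/-! ### The entire coordinates A, B, C and the equation of the curve -/

/-- The sign that relates `ζ` to the quotient of theta functions. -/
def thetaSign (k : ℝ) : ℂ := Classical.epsilon fun κ : ℂ ↦ κ ^ 2 = 1 ∧
    ∀ z, zetaDen k z ≠ 0 → zetaFun k z * thetaA k z = κ * thetaNum k z

/-- The numerator of `ζ` as a theta function. -/
def thetaB (k : ℝ) (z : ℂ) : ℂ := thetaSign k * thetaNum k z

/-- The coordinate of weight two of the curve, as a theta function. -/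
def thetaC (k : ℝ) (z : ℂ) : ℂ :=
  (deriv (thetaB k) z * thetaA k z - thetaB k z * deriv (thetaA k) z) / 4

section

variable {k : ℝ} (hk0 : 0 < k) (hk1 : k < 1)
include hk0 hk1

lemma thetaSign_sq : thetaSign k ^ 2 = 1 :=
  (Classical.epsilon_spec (exists_zetaFun_eq hk0 hk1)).1

lemma zetaFun_mul_thetaA {z : ℂ} (hz : zetaDen k z ≠ 0) :
    zetaFun k z * thetaA k z = thetaB k z :=
  (Classical.epsilon_spec (exists_zetaFun_eq hk0 hk1)).2 z hz

lemma differentiable_thetaB : Differentiable ℂ (thetaB k) :=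
  (differentiable_thetaNum hk0 hk1).const_mul _

lemma differentiable_thetaC : Differentiable ℂ (thetaC k) :=
  ((((differentiable_thetaB hk0 hk1).deriv.mul (differentiable_thetaA hk0 hk1)).sub
    ((differentiable_thetaB hk0 hk1).mul (differentiable_thetaA hk0 hk1).deriv))).div_const 4

lemma thetaA_add_half' (z : ℂ) : thetaA k (z + 1 / 2) = thetaSign k * thetaB k z := by
  rw [thetaA_add_half, thetaB]
  linear_combination -thetaNum k z * thetaSign_sq hk0 hk1

omit hk0 hk1 in
lemma thetaB_add_half (z : ℂ) : thetaB k (z + 1 / 2) = thetaSign k * thetaA k z := by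
  rw [thetaB, thetaNum_add_half]

omit hk0 hk1 in
lemma thetaB_add_one (z : ℂ) : thetaB k (z + 1) = thetaB k z := by
  rw [thetaB, thetaNum_add_one, thetaB]

lemma thetaB_add_tau (z : ℂ) : thetaB k (z + tau k) = thetaFactor k z * thetaB k z := by
  rw [thetaB, thetaNum_add_tau hk0 hk1, thetaB]; ring

lemma thetaC_add_half (z : ℂ) : thetaC k (z + 1 / 2) = -thetaC k z := by
  have h1 : deriv (thetaB k) (z + 1 / 2) = thetaSign k * deriv (thetaA k) z := by
    rw [← deriv_comp_add_const, show (fun x ↦ thetaB k (x + 1 / 2)) = fun x ↦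
      thetaSign k * thetaA k x from funext thetaB_add_half, deriv_const_mul _
      (differentiable_thetaA hk0 hk1 z)]
  have h2 : deriv (thetaA k) (z + 1 / 2) = thetaSign k * deriv (thetaB k) z := by
    rw [← deriv_comp_add_const, show (fun x ↦ thetaA k (x + 1 / 2)) = fun x ↦
      thetaSign k * thetaB k x from funext (thetaA_add_half' hk0 hk1), deriv_const_mul _
      (differentiable_thetaB hk0 hk1 z)]
  rw [thetaC, thetaC, h1, h2, thetaA_add_half' hk0 hk1, thetaB_add_half]
  linear_combination ((deriv (thetaA k) z * thetaB k z - thetaA k z * deriv (thetaB k) z) / 4) *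
    thetaSign_sq hk0 hk1

lemma thetaC_add_one (z : ℂ) : thetaC k (z + 1) = thetaC k z := by
  rw [show z + 1 = z + 1 / 2 + 1 / 2 by ring, thetaC_add_half hk0 hk1, thetaC_add_half hk0 hk1,
    neg_neg]

/-- C is a Wronskian of two functions with the same factor of automorphy, so the terms with the
derivative of that factor cancel. -/
lemma thetaC_add_tau (z : ℂ) : thetaC k (z + tau k) = thetaFactor k z ^ 2 * thetaC k z := by
  have hf : DifferentiableAt ℂ (thetaFactor k) z := by
    have := differentiable_expTwoPi
    unfold thetaFactor; fun_prop
  have h1 : deriv (thetaB k) (z + tau k) =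
      deriv (thetaFactor k) z * thetaB k z + thetaFactor k z * deriv (thetaB k) z := by
    rw [← deriv_comp_add_const, show (fun x ↦ thetaB k (x + tau k)) =
      thetaFactor k * thetaB k from funext (thetaB_add_tau hk0 hk1),
      deriv_mul hf (differentiable_thetaB hk0 hk1 z)]
  have h2 : deriv (thetaA k) (z + tau k) =
      deriv (thetaFactor k) z * thetaA k z + thetaFactor k z * deriv (thetaA k) z := by
    rw [← deriv_comp_add_const, show (fun x ↦ thetaA k (x + tau k)) =
      thetaFactor k * thetaA k from funext (thetaA_add_tau hk0 hk1),
      deriv_mul hf (differentiable_thetaA hk0 hk1 z)]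
  rw [thetaC, thetaC, h1, h2, thetaA_add_tau hk0 hk1, thetaB_add_tau hk0 hk1]
  ring

lemma thetaC_eq {z : ℂ} (hz : zetaDen k z ≠ 0) :
    4 * thetaC k z = zetaFunDeriv k z * thetaA k z ^ 2 := by
  have h1 : (fun w ↦ zetaFun k w * thetaA k w) =ᶠ[𝓝 z] thetaB k := by
    filter_upwards [eventually_zetaDen_ne_zero hk0 hk1 hz] with w hw
    exact zetaFun_mul_thetaA hk0 hk1 hw
  have h2 := (hasDerivAt_zetaFun hk0 hk1 hz).fun_mul (differentiable_thetaA hk0 hk1 z).hasDerivAt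
  rw [thetaC, ← h1.deriv_eq, h2.deriv, ← zetaFun_mul_thetaA hk0 hk1 hz]
  ring

/-- The theta functions parametrize the curve. -/
lemma thetaC_sq (z : ℂ) : thetaC k z ^ 2 + (ellK k : ℂ) ^ 2 / 4 *
    (thetaB k z ^ 4 + 2 * ((k : ℂ) ^ 2 - (compl k : ℂ) ^ 2) * thetaA k z ^ 2 * thetaB k z ^ 2 +
      thetaA k z ^ 4) = 0 := by
  have main : ∀ z, zetaDen k z ≠ 0 → thetaC k z ^ 2 + (ellK k : ℂ) ^ 2 / 4 *
    (thetaB k z ^ 4 + 2 * ((k : ℂ) ^ 2 - (compl k : ℂ) ^ 2) * thetaA k z ^ 2 * thetaB k z ^ 2 +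
      thetaA k z ^ 4) = 0 := by
    intro z hz
    have h1 := thetaC_eq hk0 hk1 hz
    have h2 := zetaFunDeriv_sq hk0 hk1 hz
    rw [← zetaFun_mul_thetaA hk0 hk1 hz]
    linear_combination (1 / 16) * (4 * thetaC k z + zetaFunDeriv k z * thetaA k z ^ 2) * h1 +
      (1 / 16) * thetaA k z ^ 4 * h2
  by_cases hz : zetaDen k z = 0
  -- At a pole of ζ the homogeneous equation is transported from z + 1/2. It is symmetric in A and B
  -- and even in C.
  · have h := main _ (zetaDen_add_half_ne_zero hk0 hk1 hz)
    rw [thetaC_add_half hk0 hk1, thetaA_add_half' hk0 hk1, thetaB_add_half] at h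
    have h2 := thetaSign_sq hk0 hk1
    have h4 : thetaSign k ^ 4 = 1 := by
      rw [show thetaSign k ^ 4 = (thetaSign k ^ 2) ^ 2 by ring, h2]; ring
    simp only [mul_pow, h2, h4] at h
    linear_combination h
  · exact main z hz

lemma thetaA_eq_zero_iff {z : ℂ} : thetaA k z = 0 ↔ zetaDen k z = 0 := by
  refine ⟨fun h ↦ not_ne_iff.1 fun hz ↦ thetaA_ne_zero_of_zetaDen hk0 hk1 hz h, fun h ↦ ?_⟩
  have h1 := zetaFun_mul_thetaA hk0 hk1 (zetaDen_add_half_ne_zero hk0 hk1 h)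
  rw [zetaFun_add_half_eq_zero hk0 hk1 h, thetaB_add_half, zero_mul] at h1
  have : thetaSign k ≠ 0 := fun h0 ↦ by simpa [h0] using thetaSign_sq hk0 hk1
  simpa [this] using h1.symm

lemma thetaA_or_thetaB_ne_zero (z : ℂ) : thetaA k z ≠ 0 ∨ thetaB k z ≠ 0 := by
  by_contra! h
  have hz := (thetaA_eq_zero_iff hk0 hk1).1 h.1
  have h1 := thetaA_add_half' hk0 hk1 z
  rw [h.2, mul_zero, thetaA_eq_zero_iff hk0 hk1] at h1
  exact zetaDen_add_half_ne_zero hk0 hk1 hz h1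

/-- This sign decides the sheets. The origin is the point (0, iK/2), so 1/2 is ∞₁, while (1 + τ)/2
lies over ζ = 0 on the other sheet. -/
lemma thetaC_zero : thetaC k 0 = I * ellK k / 2 * thetaA k 0 ^ 2 := by
  have hD : zetaDen k 0 ≠ 0 := by
    have := (half_period_values hk0 hk1 0 0).2.2
    norm_num at this
    rw [this]; norm_num
  have h := thetaC_eq hk0 hk1 hD
  have h2 : zetaFunDeriv k 0 = 2 * I * ellK k := by
    have e1 := amplitude_zero hk0 hk1
    have e2 := amplitude_zero (compl_pos hk0 hk1) (compl_lt_one hk0 hk1)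
    simp [zetaFunDeriv, zetaDen, sn, cn, dn, e1, e2, ellDelta]
    norm_num; ring
  rw [h2] at h
  linear_combination h / 4

lemma thetaC_half : thetaC k (1 / 2) = -(I * ellK k / 2) * thetaB k (1 / 2) ^ 2 := by
  have h1 := thetaC_add_half hk0 hk1 0
  have h2 := thetaB_add_half (k := k) 0
  rw [zero_add] at h1 h2
  rw [h1, h2, thetaC_zero hk0 hk1]
  linear_combination (I * ellK k / 2) * thetaA k 0 ^ 2 * thetaSign_sq hk0 hk1

lemma thetaC_half_period : thetaC k ((1 + tau k) / 2) =
    -(I * ellK k / 2) * thetaA k ((1 + tau k) / 2) ^ 2 ∧ thetaA k ((1 + tau k) / 2) ≠ 0 := by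
  have hv := half_period_values hk0 hk1 1 1
  have e : (((1 : ℤ) : ℂ) * tau k + ((1 : ℤ) : ℂ)) / 2 = (1 + tau k) / 2 := by push_cast; ring
  rw [e] at hv
  obtain ⟨v1, v2, v3⟩ := hv
  have hD : zetaDen k ((1 + tau k) / 2) ≠ 0 := by
    rw [v3]; norm_num
  refine ⟨?_, thetaA_ne_zero_of_zetaDen hk0 hk1 hD⟩
  have h := thetaC_eq hk0 hk1 hD
  have h0 := compl_pos hk0 hk1
  have h1 := compl_lt_one hk0 hk1
  have hK := (ellK_pos hk0 hk1).ne'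
  have a1 : 4 * ellK k * ((1 + tau k) / 2).re = 0 + 2 * ellK k := by
    simp [tau_re]; ring
  have a2 : 4 * ellK k * ((1 + tau k) / 2).im = 0 + 2 * ellK (compl k) := by
    have := four_mul_ellK_mul_tau_im hk0 hk1
    simp; linear_combination this / 2
  have h2 : zetaFunDeriv k ((1 + tau k) / 2) = -(2 * I * ellK k) := by
    have e1 := amplitude_zero hk0 hk1
    have e2 := amplitude_zero h0 h1
    rw [zetaFunDeriv, v3, a1, a2, sn_add hk0 hk1, cn_add hk0 hk1, dn_add hk0 hk1, sn_add h0 h1,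
      cn_add h0 h1, dn_add h0 h1]
    simp [sn, cn, dn, e1, e2, ellDelta]
    norm_num; ring
  rw [h2] at h
  linear_combination h / 4

lemma thetaC_half_tau : thetaC k (tau k / 2) = I * ellK k / 2 * thetaB k (tau k / 2) ^ 2 := by
  obtain ⟨h, -⟩ := thetaC_half_period hk0 hk1
  have h1 := thetaC_add_half hk0 hk1 (tau k / 2)
  have h2 := thetaA_add_half' hk0 hk1 (tau k / 2)
  rw [show tau k / 2 + 1 / 2 = (1 + tau k) / 2 by ring] at h1 h2
  rw [h1, h2] at h
  linear_combination -h + (I * ellK k / 2) * thetaB k (tau k / 2) ^ 2 * thetaSign_sq hk0 hk1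

/-- The derivative of the equation of the curve. -/
lemma thetaC_mul_deriv (z : ℂ) : 2 * thetaC k z * deriv (thetaC k) z + (ellK k : ℂ) ^ 2 / 4 *
    (4 * thetaB k z ^ 3 * deriv (thetaB k) z + 2 * ((k : ℂ) ^ 2 - (compl k : ℂ) ^ 2) *
      (2 * thetaA k z * deriv (thetaA k) z * thetaB k z ^ 2 +
        thetaA k z ^ 2 * (2 * thetaB k z * deriv (thetaB k) z)) +
      4 * thetaA k z ^ 3 * deriv (thetaA k) z) = 0 := by
  have hA := (differentiable_thetaA hk0 hk1 z).hasDerivAt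
  have hB := (differentiable_thetaB hk0 hk1 z).hasDerivAt
  have hC := (differentiable_thetaC hk0 hk1 z).hasDerivAt
  have h := (hC.fun_pow 2).fun_add ((((hB.fun_pow 4).fun_add
    (((hA.fun_pow 2).const_mul (2 * ((k : ℂ) ^ 2 - (compl k : ℂ) ^ 2))).fun_mul
      (hB.fun_pow 2))).fun_add (hA.fun_pow 4)).const_mul ((ellK k : ℂ) ^ 2 / 4))
  have h0 : HasDerivAt (fun z ↦ thetaC k z ^ 2 + (ellK k : ℂ) ^ 2 / 4 *
    (thetaB k z ^ 4 + 2 * ((k : ℂ) ^ 2 - (compl k : ℂ) ^ 2) * thetaA k z ^ 2 * thetaB k z ^ 2 +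
    thetaA k z ^ 4)) 0 z := by
    rw [show (fun z ↦ thetaC k z ^ 2 + (ellK k : ℂ) ^ 2 / 4 *
      (thetaB k z ^ 4 + 2 * ((k : ℂ) ^ 2 - (compl k : ℂ) ^ 2) * thetaA k z ^ 2 * thetaB k z ^ 2 +
      thetaA k z ^ 4)) = fun _ ↦ 0 from funext (thetaC_sq hk0 hk1)]
    exact hasDerivAt_const _ _
  have he := h.unique h0
  norm_num at he
  linear_combination he

/-- The differential equation satisfied by the coordinate `η`. -/
lemma deriv_thetaC (z : ℂ) : deriv (thetaC k) z * thetaA k z - 2 * thetaC k z * deriv (thetaA k) z =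
    -(ellK k : ℂ) ^ 2 / 2 * (4 * thetaB k z ^ 3 +
      4 * ((k : ℂ) ^ 2 - (compl k : ℂ) ^ 2) * thetaA k z ^ 2 * thetaB k z) := by
  have dA := differentiable_thetaA hk0 hk1
  have dB := differentiable_thetaB hk0 hk1
  have dC := differentiable_thetaC hk0 hk1
  have dA' := dA.deriv
  have dC' := dC.deriv
  -- Differentiating the curve gives the identity only after multiplication by C. The factor is
  -- cancelled near 0, where C ≠ 0, and the identity theorem does the rest.
  have hmul : ∀ z, thetaC k z * (deriv (thetaC k) z * thetaA k z -
      2 * thetaC k z * deriv (thetaA k) z + (ellK k : ℂ) ^ 2 / 2 * (4 * thetaB k z ^ 3 +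
      4 * ((k : ℂ) ^ 2 - (compl k : ℂ) ^ 2) * thetaA k z ^ 2 * thetaB k z)) = 0 := by
    intro z
    have he := thetaC_mul_deriv hk0 hk1 z
    have hcurve := thetaC_sq hk0 hk1 z
    have hdef : 4 * thetaC k z = deriv (thetaB k) z * thetaA k z -
      thetaB k z * deriv (thetaA k) z := by rw [thetaC]; ring
    linear_combination thetaA k z / 2 * he - 2 * deriv (thetaA k) z * hcurve +
      ((ellK k : ℂ) ^ 2 / 8) * (4 * thetaB k z ^ 3 +
      4 * ((k : ℂ) ^ 2 - (compl k : ℂ) ^ 2) * thetaA k z ^ 2 * thetaB k z) * hdef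
  have hX : Differentiable ℂ fun z ↦ (deriv (thetaC k) z * thetaA k z -
      2 * thetaC k z * deriv (thetaA k) z + (ellK k : ℂ) ^ 2 / 2 * (4 * thetaB k z ^ 3 +
      4 * ((k : ℂ) ^ 2 - (compl k : ℂ) ^ 2) * thetaA k z ^ 2 * thetaB k z)) := by
    fun_prop
  have hC0 : thetaC k 0 ≠ 0 := by
    rw [thetaC_zero hk0 hk1]
    have hD : zetaDen k 0 ≠ 0 := by
      have := (half_period_values hk0 hk1 0 0).2.2
      norm_num at this
      rw [this]; norm_num
    have hK : (ellK k : ℂ) ≠ 0 := by exact_mod_cast (ellK_pos hk0 hk1).ne'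
    have := thetaA_ne_zero_of_zetaDen hk0 hk1 hD
    simp [hK, this]
  have hev : (fun z ↦ (deriv (thetaC k) z * thetaA k z -
      2 * thetaC k z * deriv (thetaA k) z + (ellK k : ℂ) ^ 2 / 2 * (4 * thetaB k z ^ 3 +
      4 * ((k : ℂ) ^ 2 - (compl k : ℂ) ^ 2) * thetaA k z ^ 2 * thetaB k z))) =ᶠ[𝓝 0]
      fun _ ↦ (0 : ℂ) := by
    filter_upwards [dC.continuous.continuousAt.eventually_ne hC0] with w hw
    exact (mul_eq_zero.1 (hmul w)).resolve_left hw
  have := AnalyticOnNhd.eq_of_eventuallyEq (𝕜 := ℂ) (fun z _ ↦ hX.analyticAt z)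
    (fun z _ ↦ analyticAt_const) hev
  have := congrFun this z
  linear_combination this

end

/-! ### The differential of the second kind -/

lemma two_le_analyticOrderAt {f : ℂ → ℂ} {z : ℂ} (hf : AnalyticAt ℂ f z) (h0 : f z = 0)
    (h1 : deriv f z = 0) : 2 ≤ analyticOrderAt f z := by
  have h := hf.analyticOrderAt_deriv_add_one
  simp only [h0, sub_zero] at h
  have h2 : analyticOrderAt (deriv f) z ≠ 0 := by
    rw [hf.deriv.analyticOrderAt_ne_zero]; exact h1
  have h3 : 1 ≤ analyticOrderAt (deriv f) z := Order.one_le_iff_ne_zero.2 h2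
  change 2 ≤ analyticOrderAt (fun x ↦ f x) z
  rw [← h]
  calc (2 : ℕ∞) = 1 + 1 := by norm_num
    _ ≤ _ := by gcongr

lemma meromorphicOrderAt_div_sq_nonneg {f g : ℂ → ℂ} {z : ℂ} (hf : AnalyticAt ℂ f z)
    (hg : AnalyticAt ℂ g z) (h2 : 2 ≤ analyticOrderAt f z) (h1 : analyticOrderAt g z = 1) :
    0 ≤ meromorphicOrderAt (fun z ↦ f z / g z ^ 2) z := by
  have hd : meromorphicOrderAt (fun z ↦ f z / g z ^ 2) z =
      meromorphicOrderAt f z - meromorphicOrderAt (g ^ 2) z := by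
    rw [← meromorphicOrderAt_div hf.meromorphicAt (hg.pow 2).meromorphicAt]; rfl
  rw [hd, hf.meromorphicOrderAt_eq, (hg.pow 2).meromorphicOrderAt_eq, analyticOrderAt_pow hg, h1]
  generalize analyticOrderAt f z = m at *
  cases m with
  | top => simp
  | coe m =>
    have : 2 ≤ m := by exact_mod_cast h2
    have h3 : ((m : ℤ) - 2 : ℤ) ≥ 0 := by omega
    have h4 : ((0 : ℤ) : WithTop ℤ) ≤ (((m : ℤ) - 2 : ℤ) : WithTop ℤ) := WithTop.coe_le_coe.2 h3
    simpa using h4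

section

variable {k : ℝ} (hk0 : 0 < k) (hk1 : k < 1)
include hk0 hk1

/-- The curve equation and its derivative at a pole of ζ, where C = -BA'/4 and C' = -BA''/4. The two
relations match the double pole and the absence of a residue, so that `gammaNum` vanishes to second
order. -/
lemma deriv_thetaA_sq_of_zero {z : ℂ} (hz : thetaA k z = 0) :
    deriv (thetaA k) z ^ 2 = -4 * (ellK k : ℂ) ^ 2 * thetaB k z ^ 2 ∧
    deriv (thetaA k) z * deriv (deriv (thetaA k)) z =
      -8 * (ellK k : ℂ) ^ 2 * thetaB k z * deriv (thetaB k) z := by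
  have hB := (thetaA_or_thetaB_ne_zero hk0 hk1 z).resolve_left (not_not.2 hz)
  have h1 := thetaC_sq hk0 hk1 z
  have h2 := thetaC_mul_deriv hk0 hk1 z
  have hC : thetaC k z = -(thetaB k z * deriv (thetaA k) z) / 4 := by rw [thetaC, hz]; ring
  have hC' : deriv (thetaC k) z = -(thetaB k z * deriv (deriv (thetaA k)) z) / 4 := by
    have hA := (differentiable_thetaA hk0 hk1 z).hasDerivAt
    have hB := (differentiable_thetaB hk0 hk1 z).hasDerivAt
    have hA' := ((differentiable_thetaA hk0 hk1).deriv z).hasDerivAt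
    have hB' := ((differentiable_thetaB hk0 hk1).deriv z).hasDerivAt
    have h := ((hB'.fun_mul hA).fun_sub (hB.fun_mul hA')).div_const 4
    have h' : HasDerivAt (thetaC k) _ z := h
    rw [h'.deriv, hz]; ring
  rw [hC, hz] at h1
  rw [hC, hC', hz] at h2
  constructor
  · refine mul_left_cancel₀ (pow_ne_zero 2 hB) ?_
    linear_combination 16 * h1
  · refine mul_left_cancel₀ (pow_ne_zero 2 hB) ?_
    linear_combination 8 * h2

lemma deriv_thetaA_ne_zero {z : ℂ} (hz : thetaA k z = 0) : deriv (thetaA k) z ≠ 0 := by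
  intro h
  have h1 := (deriv_thetaA_sq_of_zero hk0 hk1 hz).1
  have hB := (thetaA_or_thetaB_ne_zero hk0 hk1 z).resolve_left (not_not.2 hz)
  have hK : (ellK k : ℂ) ≠ 0 := by exact_mod_cast (ellK_pos hk0 hk1).ne'
  rw [h] at h1
  simp [hB, hK] at h1

/-- The numerator of `K² ζ² - (A'/A)'/4`. -/
def gammaNum (k : ℝ) (z : ℂ) : ℂ := (ellK k : ℂ) ^ 2 * thetaB k z ^ 2 -
  (deriv (deriv (thetaA k)) z * thetaA k z - deriv (thetaA k) z ^ 2) / 4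

lemma differentiable_gammaNum : Differentiable ℂ (gammaNum k) := by
  have dA := differentiable_thetaA hk0 hk1
  have dB := differentiable_thetaB hk0 hk1
  have dA' := dA.deriv
  have dA'' := dA'.deriv
  unfold gammaNum
  fun_prop

lemma gammaNum_of_zero {z : ℂ} (hz : thetaA k z = 0) :
    gammaNum k z = 0 ∧ deriv (gammaNum k) z = 0 := by
  obtain ⟨h1, h2⟩ := deriv_thetaA_sq_of_zero hk0 hk1 hz
  have hA := (differentiable_thetaA hk0 hk1 z).hasDerivAt
  have hB := (differentiable_thetaB hk0 hk1 z).hasDerivAt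
  have hA' := ((differentiable_thetaA hk0 hk1).deriv z).hasDerivAt
  have hA'' := ((differentiable_thetaA hk0 hk1).deriv.deriv z).hasDerivAt
  have h := ((hB.fun_pow 2).const_mul ((ellK k : ℂ) ^ 2)).fun_sub
    (((hA''.fun_mul hA).fun_sub (hA'.fun_pow 2)).div_const 4)
  have h' : HasDerivAt (gammaNum k) _ z := h
  constructor
  · rw [gammaNum, hz]; linear_combination h1 / 4
  · rw [h'.deriv, hz]; norm_num; linear_combination h2 / 4

omit hk0 hk1 in
lemma hasDerivAt_thetaFactor (z : ℂ) :
    HasDerivAt (thetaFactor k) (-(4 * Real.pi * I) * thetaFactor k z) z := by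
  have h1 : HasDerivAt (fun z : ℂ ↦ tau k / 2 - 2 * z) (-2) z := by
    simpa using ((hasDerivAt_id z).const_mul 2).const_sub (tau k / 2)
  have h := ((hasDerivAt_expTwoPi (tau k / 2 - 2 * z)).comp z h1).neg
  refine h.congr_deriv ?_
  rw [thetaFactor]; ring

lemma deriv_thetaA_add_tau (z : ℂ) : deriv (thetaA k) (z + tau k) =
    thetaFactor k z * (deriv (thetaA k) z - 4 * Real.pi * I * thetaA k z) := by
  rw [← deriv_comp_add_const, show (fun x ↦ thetaA k (x + tau k)) =
    thetaFactor k * thetaA k from funext (thetaA_add_tau hk0 hk1),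
    ((hasDerivAt_thetaFactor z).mul (differentiable_thetaA hk0 hk1 z).hasDerivAt).deriv]
  ring

lemma deriv_deriv_thetaA_add_tau (z : ℂ) : deriv (deriv (thetaA k)) (z + tau k) =
    thetaFactor k z * (deriv (deriv (thetaA k)) z - 8 * Real.pi * I * deriv (thetaA k) z +
      (4 * Real.pi * I) ^ 2 * thetaA k z) := by
  have h1 := (differentiable_thetaA hk0 hk1 z).hasDerivAt
  have h2 := ((differentiable_thetaA hk0 hk1).deriv z).hasDerivAt
  rw [← deriv_comp_add_const, show (fun x ↦ deriv (thetaA k) (x + tau k)) = fun z ↦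
    thetaFactor k z * (deriv (thetaA k) z - 4 * Real.pi * I * thetaA k z) from
    funext (deriv_thetaA_add_tau hk0 hk1),
    ((hasDerivAt_thetaFactor z).fun_mul (h2.fun_sub (h1.const_mul _))).deriv]
  ring

omit hk0 hk1 in
lemma deriv_thetaA_add_one (z : ℂ) : deriv (thetaA k) (z + 1) = deriv (thetaA k) z := by
  rw [← deriv_comp_add_const, show (fun x ↦ thetaA k (x + 1)) = thetaA k from
    funext thetaA_add_one]

omit hk0 hk1 in
lemma deriv_deriv_thetaA_add_one (z : ℂ) :
    deriv (deriv (thetaA k)) (z + 1) = deriv (deriv (thetaA k)) z := by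
  rw [← deriv_comp_add_const, show (fun x ↦ deriv (thetaA k) (x + 1)) = deriv (thetaA k) from
    funext deriv_thetaA_add_one]

/-- At each zero of A, which is simple, the numerator vanishes doubly. The quotient by A² therefore
extends to an entire elliptic function. -/
lemma exists_gammaNum_eq : ∃ c : ℂ, ∀ z, gammaNum k z = c * thetaA k z ^ 2 := by
  have dA := differentiable_thetaA hk0 hk1
  have dn := differentiable_gammaNum hk0 hk1
  have hmer : ∀ z, MeromorphicAt (fun z ↦ gammaNum k z / thetaA k z ^ 2) z := fun z ↦
    (dn.analyticAt z).meromorphicAt.div ((dA.analyticAt z).pow 2).meromorphicAt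
  have hcts : ∀ z, thetaA k z ≠ 0 → ContinuousAt (fun z ↦ gammaNum k z / thetaA k z ^ 2) z :=
    fun z hz ↦ dn.continuous.continuousAt.div (dA.continuous.continuousAt.pow 2) (pow_ne_zero 2 hz)
  obtain ⟨g, hg, heq, hcont, -⟩ := exists_differentiable_of_meromorphicOrderAt_nonneg hmer (by
    intro z
    by_cases hz : thetaA k z = 0
    · obtain ⟨h0, h1⟩ := gammaNum_of_zero hk0 hk1 hz
      exact meromorphicOrderAt_div_sq_nonneg (dn.analyticAt z) (dA.analyticAt z)
        (two_le_analyticOrderAt (dn.analyticAt z) h0 h1)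
        ((dA.analyticAt z).analyticOrderAt_eq_one_of_zero_deriv_ne_zero hz
          (deriv_thetaA_ne_zero hk0 hk1 hz))
    · exact (((dn.analyticAt z).div ((dA.analyticAt z).pow 2)
        (pow_ne_zero 2 hz))).meromorphicOrderAt_nonneg)
  have hper : ∀ a, (∀ z, gammaNum k (z + a) / thetaA k (z + a) ^ 2 =
      gammaNum k z / thetaA k z ^ 2) → ∀ z, g (z + a) = g z := by
    intro a ha z
    refine eq_of_eventuallyEq_nhdsNE (f := fun z ↦ g (z + a))
      (hg.continuous.comp (continuous_add_const a)).continuousAt hg.continuous.continuousAt ?_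
    filter_upwards [heq z, (tendsto_add_const_nhdsNE z a).eventually (heq (z + a))] with w h1 h2
    rw [← h1, ← h2, ha]
  obtain ⟨c, hc⟩ := exists_eq_const_of_periodic (tau_im_pos hk0 hk1) hg
    (hper 1 fun z ↦ by
      rw [gammaNum, thetaA_add_one, thetaB_add_one, deriv_thetaA_add_one,
        deriv_deriv_thetaA_add_one, gammaNum])
    (hper (tau k) fun z ↦ by
      rw [gammaNum, thetaA_add_tau hk0 hk1, thetaB_add_tau hk0 hk1, deriv_thetaA_add_tau hk0 hk1,
        deriv_deriv_thetaA_add_tau hk0 hk1, mul_pow (thetaFactor k z) (thetaA k z), ←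
        mul_div_mul_left (gammaNum k z) (thetaA k z ^ 2) (pow_ne_zero 2 (thetaFactor_ne_zero z)),
        gammaNum]
      ring)
  refine ⟨c, fun z ↦ ?_⟩
  by_cases hz : thetaA k z = 0
  · rw [(gammaNum_of_zero hk0 hk1 hz).1, hz]; ring
  · have h := hcont z (hcts z hz)
    rw [hc, div_eq_iff (pow_ne_zero 2 hz)] at h
    exact h

lemma hasDerivAt_logDeriv_thetaA {z : ℂ} (hz : thetaA k z ≠ 0) :
    HasDerivAt (logDeriv (thetaA k))
      ((deriv (deriv (thetaA k)) z * thetaA k z - deriv (thetaA k) z ^ 2) / thetaA k z ^ 2) z := by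
  have h1 := (differentiable_thetaA hk0 hk1 z).hasDerivAt
  have h2 := ((differentiable_thetaA hk0 hk1).deriv z).hasDerivAt
  exact (h2.div h1 hz).congr_deriv (by ring)

/-! #### The constant -/

/-- The incomplete elliptic integral of the second kind. -/
def ellEInt (k φ : ℝ) : ℝ := ∫ u in (0 : ℝ)..φ, ellDelta k u

omit hk0 hk1 in
lemma hasDerivAt_ellEInt (φ : ℝ) : HasDerivAt (ellEInt k) (ellDelta k φ) φ :=
  intervalIntegral.integral_hasDerivAt_right (continuous_ellDelta.intervalIntegrable _ _)
    (continuous_ellDelta.stronglyMeasurableAtFilter _ _) continuous_ellDelta.continuousAt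

omit hk0 hk1 in
lemma ellEInt_two_pi : ellEInt k (2 * Real.pi) = 4 * ellE k := by
  have h1 : ∀ a b, IntervalIntegrable (ellDelta k) MeasureTheory.volume a b :=
    fun a b ↦ continuous_ellDelta.intervalIntegrable a b
  have h := intervalIntegral.integral_comp_sub_left (a := 0) (b := Real.pi / 2)
    (ellDelta k) Real.pi
  simp only [ellDelta_pi_sub, sub_zero] at h
  rw [show Real.pi - Real.pi / 2 = Real.pi / 2 by ring] at h
  have h2 := intervalIntegral.integral_comp_add_right (a := 0) (b := Real.pi)
    (ellDelta k) Real.pi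
  simp only [ellDelta_add_pi, zero_add] at h2
  have e1 := intervalIntegral.integral_add_adjacent_intervals (h1 0 (Real.pi / 2))
    (h1 (Real.pi / 2) Real.pi)
  have e2 := intervalIntegral.integral_add_adjacent_intervals (h1 0 Real.pi)
    (h1 Real.pi (Real.pi + Real.pi))
  have e : ellE k = ∫ x in (0 : ℝ)..Real.pi / 2, ellDelta k x := rfl
  rw [ellEInt, two_mul, ← e2, ← h2, ← e1, ← h, ← e]
  ring

/-- The line ℝ + τ/4 is parallel to the period 1 and avoids the poles. On it the cn of modulus k'
vanishes, so the denominator is 1 and ζ is linear in sn and dn. -/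
lemma zetaFun_quarter (x : ℝ) : zetaDen k (x + tau k / 4) ≠ 0 ∧ zetaFun k (x + tau k / 4) =
    I * k * sn k (4 * ellK k * x) - dn k (4 * ellK k * x) := by
  have h0 := compl_pos hk0 hk1
  have h1 := compl_lt_one hk0 hk1
  have a1 : (x + tau k / 4).re = x := by simp [tau_re]
  have a2 : 4 * ellK k * (x + tau k / 4).im = ellK (compl k) := by
    have := four_mul_ellK_mul_tau_im hk0 hk1
    simp; linear_combination this / 4
  have hD : zetaDen k (x + tau k / 4) = 1 := by
    rw [zetaDen, a2, cn, cn, amplitude_ellK h0 h1]; simp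
  refine ⟨by rw [hD]; exact one_ne_zero, ?_⟩
  have hd : dn (compl k) (ellK (compl k)) = k := by
    rw [dn, amplitude_ellK h0 h1, ellDelta, Real.sin_pi_div_two, compl_sq hk0 hk1]
    rw [show 1 - (1 - k ^ 2) * 1 ^ 2 = k ^ 2 by ring, Real.sqrt_sq hk0.le]
  have hs : sn (compl k) (ellK (compl k)) = 1 := by
    rw [sn, amplitude_ellK h0 h1, Real.sin_pi_div_two]
  rw [zetaFun, hD, a1, a2, hd, hs]
  push_cast; ring

/-- On this line ζ² = 2 dn² - 1 - 2ik sn dn. The first term integrates to the incomplete integral of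
the second kind, the last to cn. -/
lemma hasDerivAt_primitive_zeta_sq (x : ℝ) : HasDerivAt (fun x : ℝ ↦
    ((ellEInt k (amplitude k (4 * ellK k * x)) / (2 * ellK k) - x : ℝ) : ℂ) +
      I * k / (2 * ellK k) * (cn k (4 * ellK k * x) : ℝ)) (zetaFun k (x + tau k / 4) ^ 2) x := by
  have hK := (ellK_pos hk0 hk1).ne'
  have hK' : (ellK k : ℂ) ≠ 0 := by exact_mod_cast hK
  have hl : HasDerivAt (fun x : ℝ ↦ 4 * ellK k * x) (4 * ellK k) x := by
    simpa using (hasDerivAt_id x).const_mul (4 * ellK k)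
  have h1 := (hasDerivAt_ellEInt (k := k) _).comp x ((hasDerivAt_amplitude hk0 hk1 _).comp x hl)
  have h2 := ((h1.div_const (2 * ellK k)).sub (hasDerivAt_id x)).ofReal_comp
  have h3 := (((hasDerivAt_cn hk0 hk1 _).comp x hl).ofReal_comp).const_mul
    (I * (k : ℂ) / (2 * ellK k))
  refine (h2.add h3).congr_deriv ?_
  rw [(zetaFun_quarter hk0 hk1 x).2]
  change ((dn k (4 * ellK k * x) * (dn k (4 * ellK k * x) * (4 * ellK k)) / (2 * ellK k) - 1 : ℝ) : ℂ)
    + _ = _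
  have hd : (dn k (4 * ellK k * x) : ℂ) ^ 2 = 1 - k ^ 2 * (sn k (4 * ellK k * x) : ℂ) ^ 2 := by
    exact_mod_cast dn_sq hk0 hk1 _
  push_cast
  field_simp
  linear_combination 2 * hd - 2 * k ^ 2 * sn k (4 * ellK k * x) ^ 2 * I_sq

omit hk0 hk1 in
lemma logDeriv_thetaA_add_one (z : ℂ) : logDeriv (thetaA k) (z + 1) = logDeriv (thetaA k) z := by
  rw [logDeriv_apply, logDeriv_apply, deriv_thetaA_add_one, thetaA_add_one]

/-- A'/A has period 1, so the constant is the mean of K²ζ² along ℝ + τ/4. The mean of ζ² is 4E/(2K)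
- 1. -/
lemma gammaNum_eq (z : ℂ) : gammaNum k z =
    (ellK k : ℂ) ^ 2 * ((2 * ellE k - ellK k) / ellK k) * thetaA k z ^ 2 := by
  have hK := (ellK_pos hk0 hk1).ne'
  have hK' : (ellK k : ℂ) ≠ 0 := by exact_mod_cast hK
  obtain ⟨c, hc⟩ := exists_gammaNum_eq hk0 hk1
  -- A primitive along the line of K²ζ² - (A'/A)'/4 - c, which is zero. Hence P(1) = P(0), and this
  -- equation is solved for c.
  let P : ℝ → ℂ := fun x ↦ (ellK k : ℂ) ^ 2 *
    (((ellEInt k (amplitude k (4 * ellK k * x)) / (2 * ellK k) - x : ℝ) : ℂ) +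
      I * k / (2 * ellK k) * (cn k (4 * ellK k * x) : ℝ)) -
      logDeriv (thetaA k) (x + tau k / 4) / 4 - c * x
  have hP : ∀ x, HasDerivAt P 0 x := by
    intro x
    have hD := (zetaFun_quarter hk0 hk1 x).1
    have hA := thetaA_ne_zero_of_zetaDen hk0 hk1 hD
    have h1 := hasDerivAt_logDeriv_thetaA hk0 hk1 hA
    have hl : HasDerivAt (fun x : ℝ ↦ (x : ℂ) + tau k / 4) 1 x :=
      (ofRealCLM.hasDerivAt (x := x)).add_const _
    have h2 := h1.comp x hl
    have h3 : HasDerivAt (fun x : ℝ ↦ c * (x : ℂ)) (c * 1) x :=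
      (ofRealCLM.hasDerivAt (x := x)).const_mul c
    have h4 := (((hasDerivAt_primitive_zeta_sq hk0 hk1 x).const_mul ((ellK k : ℂ) ^ 2)).sub
      (h2.div_const 4)).sub h3
    refine h4.congr_deriv ?_
    have h5 := hc (x + tau k / 4)
    rw [gammaNum, ← zetaFun_mul_thetaA hk0 hk1 hD] at h5
    generalize (x : ℂ) + tau k / 4 = w at *
    field_simp
    linear_combination 4 * h5
  have h01 : P 1 = P 0 := is_const_of_deriv_eq_zero (fun x ↦ (hP x).differentiableAt)
    (fun x ↦ (hP x).deriv) 1 0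
  have ham : amplitude k (4 * ellK k * 1) = 2 * Real.pi := by
    rw [show 4 * ellK k * 1 = 0 + 2 * ellK k + 2 * ellK k by ring, amplitude_add hk0 hk1,
      amplitude_add hk0 hk1, amplitude_zero hk0 hk1]; ring
  have h1 := logDeriv_thetaA_add_one (k := k) (tau k / 4)
  simp only [P, cn, ham, mul_zero, amplitude_zero hk0 hk1, ellEInt_two_pi, ofReal_one, ofReal_zero,
    zero_add] at h01
  rw [add_comm (1 : ℂ), h1] at h01
  have h0 : ellEInt k 0 = 0 := by simp [ellEInt]
  rw [h0, Real.cos_two_pi, Real.cos_zero] at h01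
  push_cast at h01
  have hcc : c = (ellK k : ℂ) ^ 2 * ((2 * ellE k - ellK k) / ellK k) := by
    field_simp at h01 ⊢
    linear_combination -h01 / 8
  rw [hc, hcc]

/-- The differential of the second kind is the differential of `A' / (4 A)`. -/
lemma hasDerivAt_logDeriv_thetaA_gamma {z : ℂ} (hz : thetaA k z ≠ 0) :
    HasDerivAt (fun z ↦ logDeriv (thetaA k) z / 4)
      ((ellK k : ℂ) ^ 2 * ((thetaB k z / thetaA k z) ^ 2 -
        (2 * ellE k - ellK k) / ellK k)) z := by
  refine ((hasDerivAt_logDeriv_thetaA hk0 hk1 hz).div_const 4).congr_deriv ?_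
  have h := gammaNum_eq hk0 hk1 z
  rw [gammaNum] at h
  have hK' : (ellK k : ℂ) ≠ 0 := by exact_mod_cast (ellK_pos hk0 hk1).ne'
  field_simp at h ⊢
  linear_combination -h

end

/-! ### Lifting paths on the curve to the plane -/

/-- The number `k² - k'²`. -/
def modDiff (k : ℝ) : ℂ := (k : ℂ) ^ 2 - (compl k : ℂ) ^ 2

/-- `w` is mapped to the point with homogeneous coordinates `(X₀, X₁, X₂)`. -/
def Lifts (k : ℝ) (w X₀ X₁ X₂ : ℂ) : Prop :=
  X₀ * thetaB k w - X₁ * thetaA k w = 0 ∧ X₂ * thetaA k w ^ 2 - thetaC k w * X₀ ^ 2 = 0 ∧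
    X₂ * thetaB k w ^ 2 - thetaC k w * X₁ ^ 2 = 0

/-- A path in homogeneous coordinates whose velocity is `α` times the vector field dual to
`dζ / η`. -/
structure IsFlow (k : ℝ) (Z₀ Z₁ W α : ℝ → ℂ) : Prop where
  ne_zero : ∀ s ∈ Set.Icc (0 : ℝ) 1, Z₀ s ≠ 0 ∨ Z₁ s ≠ 0
  continuous : Continuous α
  exists_deriv : ∀ s ∈ Set.Icc (0 : ℝ) 1, ∃ a b c : ℂ,
    HasDerivWithinAt Z₀ a (Set.Icc 0 1) s ∧ HasDerivWithinAt Z₁ b (Set.Icc 0 1) s ∧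
    HasDerivWithinAt W c (Set.Icc 0 1) s ∧ Z₀ s * b - Z₁ s * a = W s * α s ∧
    (4 * Z₁ s ^ 3 + 4 * modDiff k * Z₀ s ^ 2 * Z₁ s) * α s * (ellK k : ℂ) ^ 2 =
      8 * (2 * W s * a - Z₀ s * c) ∧
    (4 * Z₀ s ^ 3 + 4 * modDiff k * Z₁ s ^ 2 * Z₀ s) * α s * (ellK k : ℂ) ^ 2 =
      8 * (Z₁ s * c - 2 * W s * b)

/-- The involution ζ ↦ 1/ζ carries the chart at infinity to the finite chart. With the sign on W it
preserves dζ/η, and upstairs it is translation by 1/2 (`Lifts.add_half`). -/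
lemma IsFlow.swap {k : ℝ} {Z₀ Z₁ W α : ℝ → ℂ} (h : IsFlow k Z₀ Z₁ W α) :
    IsFlow k Z₁ Z₀ (fun s ↦ -W s) α where
  ne_zero s hs := (h.ne_zero s hs).symm
  continuous := h.continuous
  exists_deriv s hs := by
    obtain ⟨a, b, c, ha, hb, hc, h1, h2, h3⟩ := h.exists_deriv s hs
    exact ⟨b, a, -c, hb, ha, hc.neg, by linear_combination -h1, by linear_combination h3,
      by linear_combination h2⟩

/-- The vector field on the curve dual to `dζ / η`. -/
def curveField (k : ℝ) (p : ℂ × ℂ) : ℂ × ℂ :=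
  (p.2, -((ellK k : ℂ) ^ 2 / 8) * (4 * p.1 ^ 3 + 4 * modDiff k * p.1))

lemma contDiff_curveField (k : ℝ) : ContDiff ℝ 1 (curveField k) := by
  unfold curveField; fun_prop

section

variable {k : ℝ} (hk0 : 0 < k) (hk1 : k < 1)
include hk0 hk1

lemma Lifts.thetaA_ne_zero {w X₀ X₁ X₂ : ℂ} (h : Lifts k w X₀ X₁ X₂) (h0 : X₀ ≠ 0) :
    thetaA k w ≠ 0 := by
  intro hA
  have hB := (thetaA_or_thetaB_ne_zero hk0 hk1 w).resolve_left (not_not.2 hA)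
  have := h.1
  rw [hA, mul_zero, sub_zero] at this
  exact mul_ne_zero h0 hB this

lemma Lifts.add_half {w X₀ X₁ X₂ : ℂ} (h : Lifts k w X₀ X₁ X₂) :
    Lifts k (w + 1 / 2) X₁ X₀ (-X₂) := by
  have hs := thetaSign_sq hk0 hk1
  obtain ⟨h1, h2, h3⟩ := h
  refine ⟨?_, ?_, ?_⟩
  · rw [thetaB_add_half, thetaA_add_half' hk0 hk1]
    linear_combination -thetaSign k * h1
  · rw [thetaC_add_half hk0 hk1, thetaA_add_half' hk0 hk1]
    linear_combination -h3 - X₂ * thetaB k w ^ 2 * hs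
  · rw [thetaB_add_half, thetaC_add_half hk0 hk1]
    linear_combination -h2 - X₂ * thetaA k w ^ 2 * hs

lemma Lifts.of_add_half {w X₀ X₁ X₂ : ℂ} (h : Lifts k (w + 1 / 2) X₁ X₀ (-X₂)) :
    Lifts k w X₀ X₁ X₂ := by
  have h' := Lifts.add_half hk0 hk1 h
  rw [neg_neg, show w + 1 / 2 + 1 / 2 = w + 1 by ring] at h'
  unfold Lifts at h' ⊢
  rwa [thetaA_add_one, thetaB_add_one, thetaC_add_one hk0 hk1] at h'

lemma hasDerivAt_zetaTheta {w : ℂ} (hA : thetaA k w ≠ 0) :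
    HasDerivAt (fun w ↦ thetaB k w / thetaA k w) (4 * (thetaC k w / thetaA k w ^ 2)) w := by
  have h := (differentiable_thetaB hk0 hk1 w).hasDerivAt.fun_div
    (differentiable_thetaA hk0 hk1 w).hasDerivAt hA
  refine h.congr_deriv ?_
  rw [thetaC]; ring

lemma hasDerivAt_etaTheta {w : ℂ} (hA : thetaA k w ≠ 0) :
    HasDerivAt (fun w ↦ thetaC k w / thetaA k w ^ 2)
      (4 * (-((ellK k : ℂ) ^ 2 / 8) * (4 * (thetaB k w / thetaA k w) ^ 3 +
        4 * modDiff k * (thetaB k w / thetaA k w)))) w := by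
  have h := (differentiable_thetaC hk0 hk1 w).hasDerivAt.fun_div
    ((differentiable_thetaA hk0 hk1 w).hasDerivAt.fun_pow 2) (pow_ne_zero 2 hA)
  refine h.congr_deriv ?_
  have := deriv_thetaC hk0 hk1 w
  rw [modDiff]
  push_cast
  field_simp
  linear_combination 8 * this

/-- In the chart Z₀ ≠ 0 both (ζ, η) along the path and its theta expression along z solve p' = α ·
`curveField` p. This field is locally Lipschitz even at branch points, so the two solutions agree to
the right of a common value. -/
lemma IsFlow.lifts_mem_nhdsGT {Z₀ Z₁ W α z : ℝ → ℂ} (h : IsFlow k Z₀ Z₁ W α)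
    (hz : ∀ s, HasDerivAt z (α s / 4) s) {s₀ : ℝ} (hs₀ : s₀ ∈ Set.Ico (0 : ℝ) 1)
    (hZ : Z₀ s₀ ≠ 0) (hm : Lifts k (z s₀) (Z₀ s₀) (Z₁ s₀) (W s₀)) :
    {s | Lifts k (z s) (Z₀ s) (Z₁ s) (W s)} ∈ 𝓝[>] s₀ := by
  have hA0 := Lifts.thetaA_ne_zero hk0 hk1 hm hZ
  have hs₀' : s₀ ∈ Set.Icc (0 : ℝ) 1 := Set.Ico_subset_Icc_self hs₀
  have hzc : Continuous z := continuous_iff_continuousAt.2 fun s ↦ (hz s).continuousAt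
  have cA := (differentiable_thetaA hk0 hk1).continuous
  have cB := (differentiable_thetaB hk0 hk1).continuous
  have cC := (differentiable_thetaC hk0 hk1).continuous
  have hle : 𝓝[≥] s₀ ≤ 𝓝[Set.Icc 0 1] s₀ := by
    rw [← nhdsWithin_Icc_eq_nhdsGE hs₀.2]
    exact nhdsWithin_mono _ (Set.Icc_subset_Icc_left hs₀.1)
  obtain ⟨a, b, c, ha, hb, hc, -⟩ := h.exists_deriv s₀ hs₀'
  have c0 := ha.continuousWithinAt
  have c1 := hb.continuousWithinAt
  have c2 := hc.continuousWithinAt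
  let f : ℝ → ℂ × ℂ := fun s ↦ (Z₁ s / Z₀ s, W s / Z₀ s ^ 2)
  let g : ℝ → ℂ × ℂ := fun s ↦ (thetaB k (z s) / thetaA k (z s), thetaC k (z s) / thetaA k (z s) ^ 2)
  have hfg : f s₀ = g s₀ := by
    refine Prod.ext ?_ ?_
    · simp only [f, g]; rw [div_eq_div_iff hZ hA0]; linear_combination -hm.1
    · simp only [f, g]; rw [div_eq_div_iff (pow_ne_zero 2 hZ) (pow_ne_zero 2 hA0)]
      linear_combination hm.2.1
  obtain ⟨L, t, ht, hL⟩ := (contDiff_curveField k).contDiffAt.exists_lipschitzOnWith (x := f s₀)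
  have e0 : ∀ᶠ s in 𝓝[≥] s₀, Z₀ s ≠ 0 := (c0.eventually_ne hZ).filter_mono hle
  have eA : ∀ᶠ s in 𝓝[≥] s₀, thetaA k (z s) ≠ 0 :=
    ((cA.comp hzc).continuousAt.eventually_ne hA0).filter_mono nhdsWithin_le_nhds
  have ef : ∀ᶠ s in 𝓝[≥] s₀, f s ∈ t := by
    have : ContinuousWithinAt f (Set.Icc 0 1) s₀ :=
      (c1.div c0 hZ).prodMk (c2.div (c0.pow 2) (pow_ne_zero 2 hZ))
    exact (this.eventually ht).filter_mono hle
  have eg : ∀ᶠ s in 𝓝[≥] s₀, g s ∈ t := by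
    have : ContinuousAt g s₀ :=
      ((cB.comp hzc).continuousAt.div (cA.comp hzc).continuousAt hA0).prodMk
        ((cC.comp hzc).continuousAt.div ((cA.comp hzc).continuousAt.pow 2) (pow_ne_zero 2 hA0))
    rw [hfg] at ht
    exact (this.eventually ht).filter_mono nhdsWithin_le_nhds
  have e1 : ∀ᶠ s in 𝓝[≥] s₀, s < 1 :=
    (eventually_lt_nhds hs₀.2).filter_mono nhdsWithin_le_nhds
  obtain ⟨u, hu, hsub⟩ := mem_nhdsGE_iff_exists_Icc_subset.1 (e0.and (eA.and (ef.and (eg.and e1))))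
  obtain ⟨M, hM⟩ : ∃ M : NNReal, ∀ s ∈ Set.Icc s₀ u, ‖α s‖₊ ≤ M := by
    obtain ⟨M, hM⟩ := isCompact_Icc.exists_bound_of_continuousOn
      (f := α) (s := Set.Icc s₀ u) h.continuous.continuousOn
    refine ⟨M.toNNReal, fun s hs ↦ ?_⟩
    exact NNReal.le_toNNReal_of_coe_le (hM s hs)
  have hIcc : ∀ s ∈ Set.Icc s₀ u, s ∈ Set.Icc (0 : ℝ) 1 := fun s hs ↦
    ⟨hs₀.1.trans hs.1, (hsub hs).2.2.2.2.le⟩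
  have hf' : ∀ s ∈ Set.Icc s₀ u,
      HasDerivWithinAt f (α s • curveField k (f s)) (Set.Icc 0 1) s := by
    intro s hs
    obtain ⟨a, b, c, ha, hb, hc, h1, h2, -⟩ := h.exists_deriv s (hIcc s hs)
    have h0 : Z₀ s ≠ 0 := (hsub hs).1
    refine ((hb.fun_div ha h0).prodMk (hc.fun_div (ha.fun_pow 2) (pow_ne_zero 2 h0))).congr_deriv ?_
    refine Prod.ext ?_ ?_
    · simp only [curveField, f, Prod.smul_mk, smul_eq_mul]
      field_simp
      linear_combination h1
    · simp only [curveField, f, Prod.smul_mk, smul_eq_mul]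
      push_cast
      field_simp
      linear_combination h2
  have hg' : ∀ s ∈ Set.Icc s₀ u, HasDerivAt g (α s • curveField k (g s)) s := by
    intro s hs
    have hA : thetaA k (z s) ≠ 0 := (hsub hs).2.1
    have h1 := (hasDerivAt_zetaTheta hk0 hk1 hA).comp s (hz s)
    have h2 := (hasDerivAt_etaTheta hk0 hk1 hA).comp s (hz s)
    refine (h1.prodMk h2).congr_deriv ?_
    refine Prod.ext ?_ ?_
    · simp only [curveField, g, Prod.smul_mk, smul_eq_mul]; ring
    · simp only [curveField, g, Prod.smul_mk, smul_eq_mul]; ring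
  have huniq : Set.EqOn f g (Set.Icc s₀ u) := by
    refine ODE_solution_unique_of_mem_Icc_right (v := fun s p ↦ α s • curveField k p)
      (s := fun _ ↦ t) (K := M * L) ?_ (fun s hs ↦ ?_) (fun s hs ↦ ?_)
      (fun s hs ↦ (hsub (Set.Ico_subset_Icc_self hs)).2.2.1) (fun s hs ↦ ?_) (fun s hs ↦ ?_)
      (fun s hs ↦ (hsub (Set.Ico_subset_Icc_self hs)).2.2.2.1) hfg
    · intro s hs p hp q hq
      have h1 := hL hp hq
      simp only [edist_smul₀]
      calc (‖α s‖₊ : NNReal) • edist (curveField k p) (curveField k q)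
          = (‖α s‖₊ : ENNReal) * edist (curveField k p) (curveField k q) := rfl
        _ ≤ (M : ENNReal) * (L * edist p q) := by
            gcongr
            exact hM s (Set.Ico_subset_Icc_self hs)
        _ = ((M * L : NNReal) : ENNReal) * edist p q := by push_cast; ring
    · exact (hf' s hs).continuousWithinAt.mono hIcc
    · have hs' := Set.Ico_subset_Icc_self hs
      refine (hf' s hs').mono_of_mem_nhdsWithin ?_
      refine mem_of_superset (Icc_mem_nhdsGE (hsub hs').2.2.2.2) ?_
      exact Set.Icc_subset_Icc_left (hIcc s hs').1
    · exact (hg' s hs).continuousAt.continuousWithinAt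
    · exact (hg' s (Set.Ico_subset_Icc_self hs)).hasDerivWithinAt
  have hmem : Set.Ioc s₀ u ∈ 𝓝[>] s₀ := Ioc_mem_nhdsGT hu
  filter_upwards [hmem] with s hs
  have hs' := Set.Ioc_subset_Icc_self hs
  have h0 : Z₀ s ≠ 0 := (hsub hs').1
  have hA : thetaA k (z s) ≠ 0 := (hsub hs').2.1
  have heq := huniq hs'
  have h1 : Z₁ s / Z₀ s = thetaB k (z s) / thetaA k (z s) := congrArg Prod.fst heq
  have h2 : W s / Z₀ s ^ 2 = thetaC k (z s) / thetaA k (z s) ^ 2 := congrArg Prod.snd heq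
  rw [div_eq_div_iff h0 hA] at h1
  rw [div_eq_div_iff (pow_ne_zero 2 h0) (pow_ne_zero 2 hA)] at h2
  refine ⟨by linear_combination -h1, by linear_combination h2, ?_⟩
  -- The third relation of `Lifts` follows from the other two where Z₀ ≠ 0. It carries information
  -- only at infinity.
  refine mul_left_cancel₀ (pow_ne_zero 2 h0) ?_
  rw [mul_zero]
  linear_combination (-W s * (Z₁ s * thetaA k (z s) + thetaB k (z s) * Z₀ s)) * h1 +
    Z₁ s ^ 2 * h2

/-- Continuation along [0, 1]: the set of good times is closed, since `Lifts` consists of polynomial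
equations, and open to the right, in one chart or the other. -/
lemma IsFlow.lifts {Z₀ Z₁ W α z : ℝ → ℂ} (h : IsFlow k Z₀ Z₁ W α)
    (hz : ∀ s, HasDerivAt z (α s / 4) s) (h0 : Lifts k (z 0) (Z₀ 0) (Z₁ 0) (W 0)) {s : ℝ}
    (hs : s ∈ Set.Icc (0 : ℝ) 1) : Lifts k (z s) (Z₀ s) (Z₁ s) (W s) := by
  have hzc : Continuous z := continuous_iff_continuousAt.2 fun s ↦ (hz s).continuousAt
  have cA := ((differentiable_thetaA hk0 hk1).continuous.comp hzc).continuousOn (s := Set.Icc 0 1)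
  have cB := ((differentiable_thetaB hk0 hk1).continuous.comp hzc).continuousOn (s := Set.Icc 0 1)
  have cC := ((differentiable_thetaC hk0 hk1).continuous.comp hzc).continuousOn (s := Set.Icc 0 1)
  have c0 : ContinuousOn Z₀ (Set.Icc 0 1) := fun s hs ↦ by
    obtain ⟨a, b, c, ha, hb, hc, -⟩ := h.exists_deriv s hs
    exact ha.continuousWithinAt
  have c1 : ContinuousOn Z₁ (Set.Icc 0 1) := fun s hs ↦ by
    obtain ⟨a, b, c, ha, hb, hc, -⟩ := h.exists_deriv s hs
    exact hb.continuousWithinAt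
  have c2 : ContinuousOn W (Set.Icc 0 1) := fun s hs ↦ by
    obtain ⟨a, b, c, ha, hb, hc, -⟩ := h.exists_deriv s hs
    exact hc.continuousWithinAt
  let F : ℝ → ℂ × ℂ × ℂ := fun s ↦ (Z₀ s * thetaB k (z s) - Z₁ s * thetaA k (z s),
    W s * thetaA k (z s) ^ 2 - thetaC k (z s) * Z₀ s ^ 2,
    W s * thetaB k (z s) ^ 2 - thetaC k (z s) * Z₁ s ^ 2)
  have hF : ContinuousOn F (Set.Icc 0 1) :=
    ((c0.mul cB).sub (c1.mul cA)).prodMk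
      (((c2.mul (cA.pow 2)).sub (cC.mul (c0.pow 2))).prodMk
        ((c2.mul (cB.pow 2)).sub (cC.mul (c1.pow 2))))
  have hFiff : ∀ s, Lifts k (z s) (Z₀ s) (Z₁ s) (W s) ↔ s ∈ F ⁻¹' {0} := by
    intro s
    simp [F, Lifts, Prod.ext_iff]
  have hclosed : IsClosed ({s | Lifts k (z s) (Z₀ s) (Z₁ s) (W s)} ∩ Set.Icc 0 1) := by
    have := hF.preimage_isClosed_of_isClosed isClosed_Icc (isClosed_singleton (x := 0))
    rw [Set.inter_comm] at this
    convert this using 2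
    ext s; exact hFiff s
  refine hclosed.Icc_subset_of_forall_mem_nhdsWithin h0 ?_ hs
  rintro x ⟨hx, hx1⟩
  rcases h.ne_zero x (Set.Ico_subset_Icc_self hx1) with h2 | h2
  · exact IsFlow.lifts_mem_nhdsGT hk0 hk1 h hz hx1 h2 hx
  · have := IsFlow.lifts_mem_nhdsGT hk0 hk1 h.swap (z := fun s ↦ z s + 1 / 2)
      (fun s ↦ (hz s).add_const _) hx1 h2 (Lifts.add_half hk0 hk1 hx)
    filter_upwards [this] with y hy
    exact Lifts.of_add_half hk0 hk1 hy

end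

section

variable {k : ℝ} (hk0 : 0 < k) (hk1 : k < 1)
include hk0 hk1

/-! ### The parametrization is injective modulo the lattice -/

lemma deriv_thetaC' (z : ℂ) : deriv (thetaC k) z * thetaB k z - 2 * thetaC k z * deriv (thetaB k) z =
    (ellK k : ℂ) ^ 2 / 2 * (4 * thetaA k z ^ 3 + 4 * modDiff k * thetaB k z ^ 2 * thetaA k z) := by
  have h := deriv_thetaC hk0 hk1 (z + 1 / 2)
  have hs := thetaSign_sq hk0 hk1
  have hs0 : thetaSign k ≠ 0 := fun h0 ↦ by simp [h0] at hs
  have h1 : deriv (thetaC k) (z + 1 / 2) = -deriv (thetaC k) z := by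
    rw [← deriv_comp_add_const, show (fun x ↦ thetaC k (x + 1 / 2)) = -thetaC k from
      funext (thetaC_add_half hk0 hk1), deriv.neg]
  have h2 : deriv (thetaA k) (z + 1 / 2) = thetaSign k * deriv (thetaB k) z := by
    rw [← deriv_comp_add_const, show (fun x ↦ thetaA k (x + 1 / 2)) = fun x ↦
      thetaSign k * thetaB k x from funext (thetaA_add_half' hk0 hk1), deriv_const_mul _
      (differentiable_thetaB hk0 hk1 z)]
  rw [h1, h2, thetaA_add_half' hk0 hk1, thetaB_add_half, thetaC_add_half hk0 hk1] at h
  refine mul_left_cancel₀ hs0 ?_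
  rw [modDiff]
  linear_combination -h + thetaSign k * (ellK k : ℂ) ^ 2 / 2 * (4 * thetaA k z ^ 3 +
    4 * ((k : ℂ) ^ 2 - (compl k : ℂ) ^ 2) * thetaB k z ^ 2 * thetaA k z) * hs

/-- The image of the segment from z to 0. The speed is -4z because dζ/η is 4 dz upstairs. -/
lemma isFlow_segment (z : ℂ) : IsFlow k (fun s ↦ thetaA k (z - s * z)) (fun s ↦ thetaB k (z - s * z))
    (fun s ↦ thetaC k (z - s * z)) (fun _ ↦ -4 * z) where
  ne_zero s _ := thetaA_or_thetaB_ne_zero hk0 hk1 _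
  continuous := continuous_const
  exists_deriv s _ := by
    have hl : HasDerivAt (fun s : ℝ ↦ z - s * z) (-z) s := by
      simpa using ((ofRealCLM.hasDerivAt (x := s)).mul_const z).const_sub z
    have hA := ((differentiable_thetaA hk0 hk1 (z - s * z)).hasDerivAt.comp s hl).hasDerivWithinAt
      (s := Set.Icc 0 1)
    have hB := ((differentiable_thetaB hk0 hk1 (z - s * z)).hasDerivAt.comp s hl).hasDerivWithinAt
      (s := Set.Icc 0 1)
    have hC := ((differentiable_thetaC hk0 hk1 (z - s * z)).hasDerivAt.comp s hl).hasDerivWithinAt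
      (s := Set.Icc 0 1)
    refine ⟨_, _, _, hA, hB, hC, ?_, ?_, ?_⟩
    · simp only [thetaC]; ring
    · have := deriv_thetaC hk0 hk1 (z - s * z)
      simp only [modDiff]
      linear_combination -8 * z * this
    · have := deriv_thetaC' hk0 hk1 (z - s * z)
      linear_combination 8 * z * this

lemma thetaA_zero_ne_zero : thetaA k 0 ≠ 0 := by
  refine thetaA_ne_zero_of_zetaDen hk0 hk1 ?_
  have := (half_period_values hk0 hk1 0 0).2.2
  norm_num at this
  rw [this]; norm_num

lemma etaTheta_add_lattice {l : ℂ} (hl : InLattice (tau k) l) (z : ℂ) :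
    thetaC k (z + l) / thetaA k (z + l) ^ 2 = thetaC k z / thetaA k z ^ 2 := by
  refine add_lattice_eq_of_periodic (f := fun z ↦ thetaC k z / thetaA k z ^ 2)
    (fun z ↦ ?_) (fun z ↦ ?_) hl z
  · simp only [thetaA_add_one, thetaC_add_one hk0 hk1]
  · simp only [thetaA_add_tau hk0 hk1, thetaC_add_tau hk0 hk1, mul_pow]
    exact mul_div_mul_left _ _ (pow_ne_zero 2 (thetaFactor_ne_zero z))

lemma zetaTheta_add_lattice {l : ℂ} (hl : InLattice (tau k) l) (z : ℂ) :
    thetaB k (z + l) / thetaA k (z + l) = thetaB k z / thetaA k z := by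
  refine add_lattice_eq_of_periodic (f := fun z ↦ thetaB k z / thetaA k z)
    (fun z ↦ ?_) (fun z ↦ ?_) hl z
  · simp only [thetaA_add_one, thetaB_add_one]
  · simp only [thetaA_add_tau hk0 hk1, thetaB_add_tau hk0 hk1]
    exact mul_div_mul_left _ _ (thetaFactor_ne_zero z)

/-- The flow commutes with translations. Running it from z to 0 while the second lift moves from w
to w - z shows that w - z lies over the image of 0. -/
lemma inLattice_of_lifts {w z : ℂ} (h : Lifts k w (thetaA k z) (thetaB k z) (thetaC k z)) :
    InLattice (tau k) (w - z) := by
  have hτ := tau_im_pos hk0 hk1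
  have hK : (ellK k : ℂ) ≠ 0 := by exact_mod_cast (ellK_pos hk0 hk1).ne'
  have h1 := IsFlow.lifts hk0 hk1 (isFlow_segment hk0 hk1 z) (z := fun s ↦ w - s * z)
    (fun s ↦ by
      have := ((ofRealCLM.hasDerivAt (x := s)).mul_const z).const_sub w
      refine this.congr_deriv ?_
      simp; ring) (by simpa using h) (s := 1) (by simp)
  simp only [ofReal_one, one_mul, sub_self] at h1
  have hs : thetaSign k ≠ 0 := fun h0 ↦ by simpa [h0] using thetaSign_sq hk0 hk1
  have hA0 := thetaA_zero_ne_zero hk0 hk1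
  have hB0 : thetaB k 0 = 0 := by
    have : theta (tau k) 0 = 0 := (theta_eq_zero_iff hτ).2 ⟨0, 0, by simp⟩
    simp [thetaB, thetaNum, this]
  have hA := Lifts.thetaA_ne_zero hk0 hk1 h1 hA0
  have hB : thetaB k (w - z) = 0 := by
    have := h1.1
    rw [hB0, zero_mul, sub_zero] at this
    exact (mul_eq_zero.1 this).resolve_left hA0
  have hC := h1.2.1
  rw [thetaC_zero hk0 hk1] at hC
  rw [thetaB] at hB
  have hN := (mul_eq_zero.1 hB).resolve_left hs
  rcases mul_eq_zero.1 hN with h2 | h2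
  · exact (theta_eq_zero_iff hτ).1 h2
  -- The other preimages of ζ = 0 are congruent to (1 + τ)/2, where η has the opposite sign.
  · exfalso
    have hl := (theta_eq_zero_iff hτ).1 h2
    have h3 := etaTheta_add_lattice hk0 hk1 hl ((1 + tau k) / 2)
    obtain ⟨h4, h5⟩ := thetaC_half_period hk0 hk1
    rw [add_sub_cancel, h4, div_eq_div_iff (pow_ne_zero 2 hA) (pow_ne_zero 2 h5)] at h3
    have h6 : thetaC k (w - z) = -(I * ellK k / 2) * thetaA k (w - z) ^ 2 :=
      mul_right_cancel₀ (pow_ne_zero 2 h5) (by linear_combination h3)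
    rw [h6] at hC
    have : I * ellK k * (thetaA k 0 ^ 2 * thetaA k (w - z) ^ 2) = 0 := by linear_combination hC
    simp [hK, hA0, hA] at this

/-- Smoothness of the curve: the quartic has distinct roots because k is neither 0 nor 1. -/
lemma modDiff_sq_ne_one : modDiff k ^ 2 ≠ 1 := by
  have h : modDiff k = ((2 * k ^ 2 - 1 : ℝ) : ℂ) := by
    have := compl_sq hk0 hk1
    have h2 : (compl k : ℂ) ^ 2 = 1 - k ^ 2 := by exact_mod_cast this
    rw [modDiff, h2]; push_cast; ring
  rw [h]
  intro h1
  have h2 : (2 * k ^ 2 - 1 : ℝ) ^ 2 = 1 := by exact_mod_cast h1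
  have h3 : k ^ 2 * (k ^ 2 - 1) = 0 := by linear_combination h2 / 4
  rcases mul_eq_zero.1 h3 with h4 | h4 <;> nlinarith

/-! ### Integrals along paths on the curve -/

/-- The expression for dζ/η with W in the denominator breaks down at branch points. There the
differentiated equation of the curve gives the form through dη, and the two expressions combine to a
continuous α. -/
lemma CurvePath.exists_isFlow (c : CurvePath k) : ∃ α, IsFlow k c.Z₀ c.Z₁ c.W α ∧
    ∀ᵐ s, s ∈ Set.Ioc (0 : ℝ) 1 → c.dzetaOverEta s = α s := by
  have hK : (ellK k : ℂ) ≠ 0 := by exact_mod_cast (ellK_pos hk0 hk1).ne'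
  have hu := uniqueDiffOn_Icc (zero_lt_one (α := ℝ))
  let a := derivWithin c.Z₀ (Set.Icc 0 1)
  let b := derivWithin c.Z₁ (Set.Icc 0 1)
  let e := derivWithin c.W (Set.Icc 0 1)
  have ca : ContinuousOn a (Set.Icc 0 1) := c.contDiffOn_Z₀.continuousOn_derivWithin hu le_rfl
  have cb : ContinuousOn b (Set.Icc 0 1) := c.contDiffOn_Z₁.continuousOn_derivWithin hu le_rfl
  have ce : ContinuousOn e (Set.Icc 0 1) := c.contDiffOn_W.continuousOn_derivWithin hu le_rfl
  have c0 := c.contDiffOn_Z₀.continuousOn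
  have c1 := c.contDiffOn_Z₁.continuousOn
  have c2 := c.contDiffOn_W.continuousOn
  have da : ∀ s ∈ Set.Icc (0 : ℝ) 1, HasDerivWithinAt c.Z₀ (a s) (Set.Icc 0 1) s := fun s hs ↦
    (c.contDiffOn_Z₀.differentiableOn one_ne_zero s hs).hasDerivWithinAt
  have db : ∀ s ∈ Set.Icc (0 : ℝ) 1, HasDerivWithinAt c.Z₁ (b s) (Set.Icc 0 1) s := fun s hs ↦
    (c.contDiffOn_Z₁.differentiableOn one_ne_zero s hs).hasDerivWithinAt
  have de : ∀ s ∈ Set.Icc (0 : ℝ) 1, HasDerivWithinAt c.W (e s) (Set.Icc 0 1) s := fun s hs ↦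
    (c.contDiffOn_W.differentiableOn one_ne_zero s hs).hasDerivWithinAt
  -- `q1` and `q0` are the partial derivatives of the homogeneous quartic. They have no common zero
  -- on the path, and α must satisfy q1 α = m1 and q0 α = m0. Weighting by the conjugates gives one
  -- formula with positive denominator |q1|² + |q0|².
  let q1 : ℝ → ℂ := fun s ↦ 4 * c.Z₁ s ^ 3 + 4 * modDiff k * c.Z₀ s ^ 2 * c.Z₁ s
  let q0 : ℝ → ℂ := fun s ↦ 4 * c.Z₀ s ^ 3 + 4 * modDiff k * c.Z₁ s ^ 2 * c.Z₀ s
  let m1 : ℝ → ℂ := fun s ↦ 8 / (ellK k : ℂ) ^ 2 * (2 * c.W s * a s - c.Z₀ s * e s)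
  let m0 : ℝ → ℂ := fun s ↦ 8 / (ellK k : ℂ) ^ 2 * (c.Z₁ s * e s - 2 * c.W s * b s)
  let den : ℝ → ℂ := fun s ↦ q1 s * starRingEnd ℂ (q1 s) + q0 s * starRingEnd ℂ (q0 s)
  let α₀ : ℝ → ℂ := fun s ↦ (m1 s * starRingEnd ℂ (q1 s) + m0 s * starRingEnd ℂ (q0 s)) / den s
  have hq : ∀ s ∈ Set.Icc (0 : ℝ) 1, q1 s ≠ 0 ∨ q0 s ≠ 0 := by
    intro s hs
    by_contra! hcon
    obtain ⟨h1, h0⟩ := hcon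
    have h1' : c.Z₁ s * (c.Z₁ s ^ 2 + modDiff k * c.Z₀ s ^ 2) = 0 := by
      simp only [q1] at h1; linear_combination h1 / 4
    have h0' : c.Z₀ s * (c.Z₀ s ^ 2 + modDiff k * c.Z₁ s ^ 2) = 0 := by
      simp only [q0] at h0; linear_combination h0 / 4
    rcases mul_eq_zero.1 h1' with h2 | h2
    · rw [h2] at h0'
      have : c.Z₀ s = 0 := by simpa using h0'
      exact (c.ne_zero s hs).elim (· this) (· h2)
    · rcases mul_eq_zero.1 h0' with h3 | h3
      · rw [h3] at h2
        have : c.Z₁ s = 0 := by simpa using h2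
        exact (c.ne_zero s hs).elim (· h3) (· this)
      · have h4 : (1 - modDiff k ^ 2) * c.Z₀ s ^ 2 = 0 := by linear_combination h3 - modDiff k * h2
        have h5 : (1 - modDiff k ^ 2) * c.Z₁ s ^ 2 = 0 := by linear_combination h2 - modDiff k * h3
        have h6 : 1 - modDiff k ^ 2 ≠ 0 := sub_ne_zero.2 (modDiff_sq_ne_one hk0 hk1).symm
        simp [h6] at h4 h5
        exact (c.ne_zero s hs).elim (· h4) (· h5)
  have hden : ∀ s ∈ Set.Icc (0 : ℝ) 1, den s ≠ 0 := by
    intro s hs h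
    simp only [den, mul_conj] at h
    have h' : normSq (q1 s) + normSq (q0 s) = 0 := by exact_mod_cast h
    have h1 := normSq_nonneg (q1 s)
    have h2 := normSq_nonneg (q0 s)
    rcases hq s hs with h3 | h3
    · exact h3 (normSq_eq_zero.1 (by linarith))
    · exact h3 (normSq_eq_zero.1 (by linarith))
  have hcurve : ∀ s ∈ Set.Icc (0 : ℝ) 1, c.W s ^ 2 + (ellK k : ℂ) ^ 2 / 4 *
      (c.Z₁ s ^ 4 + 2 * modDiff k * c.Z₀ s ^ 2 * c.Z₁ s ^ 2 + c.Z₀ s ^ 4) = 0 := c.on_curve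
  have hdcurve : ∀ s ∈ Set.Icc (0 : ℝ) 1, 2 * c.W s * e s + (ellK k : ℂ) ^ 2 / 4 *
      (q1 s * b s + q0 s * a s) = 0 := by
    intro s hs
    have h := ((de s hs).fun_pow 2).fun_add (((((db s hs).fun_pow 4).fun_add
      ((((da s hs).fun_pow 2).const_mul (2 * modDiff k)).fun_mul ((db s hs).fun_pow 2))).fun_add
      ((da s hs).fun_pow 4)).const_mul ((ellK k : ℂ) ^ 2 / 4))
    have h0 := (hasDerivWithinAt_const s (Set.Icc 0 1) (0 : ℂ)).congr (fun x hx ↦ hcurve x hx)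
      (hcurve s hs)
    have := (hu s hs).eq_deriv _ h h0
    simp only [q1, q0]
    norm_num at this
    linear_combination this
  have hn1 : ∀ s ∈ Set.Icc (0 : ℝ) 1, q1 s * (c.Z₀ s * b s - c.Z₁ s * a s) = c.W s * m1 s := by
    intro s hs
    have h1 := hcurve s hs
    have h2 := hdcurve s hs
    simp only [q1, q0, m1] at h2 ⊢
    field_simp
    linear_combination 4 * c.Z₀ s * h2 - 16 * a s * h1
  have hn0 : ∀ s ∈ Set.Icc (0 : ℝ) 1, q0 s * (c.Z₀ s * b s - c.Z₁ s * a s) = c.W s * m0 s := by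
    intro s hs
    have h1 := hcurve s hs
    have h2 := hdcurve s hs
    simp only [q1, q0, m0] at h2 ⊢
    field_simp
    linear_combination -4 * c.Z₁ s * h2 + 16 * b s * h1
  have hm : ∀ s ∈ Set.Icc (0 : ℝ) 1, q1 s * m0 s = q0 s * m1 s := by
    intro s hs
    have h1 := hcurve s hs
    have h2 := hdcurve s hs
    simp only [q1, q0, m1, m0] at h2 ⊢
    have h3 := mul_left_cancel₀ (pow_ne_zero 2 hK)
      (show (ellK k : ℂ) ^ 2 * ((4 * c.Z₁ s ^ 3 + 4 * modDiff k * c.Z₀ s ^ 2 * c.Z₁ s) *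
          (c.Z₁ s * e s - 2 * c.W s * b s)) = (ellK k : ℂ) ^ 2 *
        ((4 * c.Z₀ s ^ 3 + 4 * modDiff k * c.Z₁ s ^ 2 * c.Z₀ s) *
          (2 * c.W s * a s - c.Z₀ s * e s)) by
        linear_combination 16 * e s * h1 - 8 * c.W s * h2)
    linear_combination 8 / (ellK k : ℂ) ^ 2 * h3
  have hα₀ : ContinuousOn α₀ (Set.Icc 0 1) := by
    have cq1 : ContinuousOn q1 (Set.Icc 0 1) := by fun_prop
    have cq0 : ContinuousOn q0 (Set.Icc 0 1) := by fun_prop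
    have cm1 : ContinuousOn m1 (Set.Icc 0 1) := by fun_prop
    have cm0 : ContinuousOn m0 (Set.Icc 0 1) := by fun_prop
    have hs1 := continuous_conj.comp_continuousOn cq1
    have hs0 := continuous_conj.comp_continuousOn cq0
    exact ((cm1.mul hs1).add (cm0.mul hs0)).div ((cq1.mul hs1).add (cq0.mul hs0)) hden
  have hα1 : ∀ s ∈ Set.Icc (0 : ℝ) 1, q1 s * α₀ s = m1 s := by
    intro s hs
    have := hden s hs
    have h1 := hm s hs
    simp only [α₀]
    rw [← mul_div_assoc, div_eq_iff this]
    simp only [den]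
    linear_combination starRingEnd ℂ (q0 s) * h1
  have hα0 : ∀ s ∈ Set.Icc (0 : ℝ) 1, q0 s * α₀ s = m0 s := by
    intro s hs
    have := hden s hs
    have h1 := hm s hs
    simp only [α₀]
    rw [← mul_div_assoc, div_eq_iff this]
    simp only [den]
    linear_combination -starRingEnd ℂ (q1 s) * h1
  have hαn : ∀ s ∈ Set.Icc (0 : ℝ) 1, c.Z₀ s * b s - c.Z₁ s * a s = c.W s * α₀ s := by
    intro s hs
    have := hden s hs
    have h1 := hn1 s hs
    have h0 := hn0 s hs
    simp only [α₀]
    rw [← mul_div_assoc, eq_div_iff this]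
    simp only [den]
    linear_combination starRingEnd ℂ (q1 s) * h1 + starRingEnd ℂ (q0 s) * h0
  let α := Set.IccExtend (zero_le_one (α := ℝ)) (Set.domRestrict (Set.Icc 0 1) α₀)
  have hα : ∀ s ∈ Set.Icc (0 : ℝ) 1, α s = α₀ s := fun s hs ↦ Set.IccExtend_of_mem _ _ hs
  refine ⟨α, ⟨c.ne_zero, (continuousOn_iff_continuous_domRestrict.1 hα₀).Icc_extend',
    fun s hs ↦ ⟨a s, b s, e s, da s hs, db s hs, de s hs, ?_, ?_, ?_⟩⟩, ?_⟩
  · rw [hα s hs, hαn s hs]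
  · rw [hα s hs]
    have := hα1 s hs
    simp only [q1, m1] at this
    rw [this]; field_simp
  · rw [hα s hs]
    have := hα0 s hs
    simp only [q0, m0] at this
    rw [this]; field_simp
  -- A zero of W with nonzero derivative is isolated, so there are only countably many. At the
  -- remaining zeros W = W' = 0, hence m1 = m0 = 0 and α = 0, which is the default value of the
  -- quotient.
  · let S : Set ℝ := {s | s ∈ Set.Ioo 0 1 ∧ c.W s = 0 ∧ e s ≠ 0}
    have hder : ∀ s ∈ Set.Ioo (0 : ℝ) 1, Set.Icc (0 : ℝ) 1 ∈ 𝓝 s := fun s hs ↦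
      Icc_mem_nhds hs.1 hs.2
    have hS : S.Countable := by
      have hsub : S ⊆ {s ∈ S | 𝓝[S ∩ Set.Ioi s] s = ⊥} := ?_
      · exact countable_setOfPred_isolated_right_within.mono hsub
      refine fun s hs ↦ ⟨hs, ?_⟩
      have h1 := (de s (Set.Ioo_subset_Icc_self hs.1)).hasDerivAt (hder s hs.1)
      have h2 := h1.eventually_ne (c := 0) hs.2.2
      rw [← empty_mem_iff_bot]
      have h3 : ∀ᶠ x in 𝓝[S ∩ Set.Ioi s] s, c.W x ≠ 0 :=
        h2.filter_mono (nhdsWithin_mono _ fun x hx ↦ ne_of_gt hx.2)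
      filter_upwards [h3, self_mem_nhdsWithin] with x hx1 hx2
      exact hx1 hx2.1.2.1
    filter_upwards [hS.ae_notMem volume, (Set.countable_singleton (1 : ℝ)).ae_notMem volume]
      with s hs1 hs2 hs
    have hs' : s ∈ Set.Ioo (0 : ℝ) 1 := ⟨hs.1, lt_of_le_of_ne hs.2 hs2⟩
    have hsI := Set.Ioo_subset_Icc_self hs'
    have hd0 : deriv c.Z₀ s = a s := ((da s hsI).hasDerivAt (hder s hs')).deriv
    have hd1 : deriv c.Z₁ s = b s := ((db s hsI).hasDerivAt (hder s hs')).deriv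
    rw [CurvePath.dzetaOverEta, hd0, hd1, hα s hsI, hαn s hsI]
    by_cases hW : c.W s = 0
    · have he : e s = 0 := by
        by_contra he
        exact hs1 ⟨hs', hW, he⟩
      simp [α₀, m1, m0, hW, he]
    · field_simp

end

/-! ### Integrals of v and γ_∞ through the lift; lifts of the base points -/

section

variable {k : ℝ}

lemma Lifts.smul {w ζ η : ℂ} (h : Lifts k w 1 ζ η) (X : ℂ) :
    Lifts k w X (ζ * X) (η * X ^ 2) := by
  obtain ⟨h1, h2, h3⟩ := h
  exact ⟨by linear_combination X * h1, by linear_combination X ^ 2 * h2,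
    by linear_combination X ^ 2 * h3⟩

lemma Lifts.of_smul {w ζ η X : ℂ} (hX : X ≠ 0) (h : Lifts k w X (ζ * X) (η * X ^ 2)) :
    Lifts k w 1 ζ η := by
  obtain ⟨h1, h2, h3⟩ := h
  exact ⟨mul_left_cancel₀ hX (by linear_combination h1),
    mul_left_cancel₀ (pow_ne_zero 2 hX) (by linear_combination h2),
    mul_left_cancel₀ (pow_ne_zero 2 hX) (by linear_combination h3)⟩

variable (hk0 : 0 < k) (hk1 : k < 1)
include hk0 hk1

lemma Lifts.div_eq {w X₀ X₁ X₂ : ℂ} (h : Lifts k w X₀ X₁ X₂) (h0 : X₀ ≠ 0) :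
    X₁ / X₀ = thetaB k w / thetaA k w := by
  rw [div_eq_div_iff h0 (h.thetaA_ne_zero hk0 hk1 h0)]
  linear_combination -h.1

/-- A path on the curve lifts to the plane, where `v = dz` and `γ_∞` is the differential of
a logarithmic derivative. -/
lemma CurvePath.lifts_intV (c : CurvePath k) {w : ℂ} (h0 : Lifts k w (c.Z₀ 0) (c.Z₁ 0) (c.W 0)) :
    Lifts k (w + c.intV) (c.Z₀ 1) (c.Z₁ 1) (c.W 1) ∧ (c.AvoidsInfty →
      c.intGamma = logDeriv (thetaA k) (w + c.intV) / 4 - logDeriv (thetaA k) w / 4) := by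
  obtain ⟨α, hα, hae⟩ := c.exists_isFlow hk0 hk1
  let z : ℝ → ℂ := fun s ↦ w + ∫ t in (0 : ℝ)..s, α t / 4
  have hz : ∀ s, HasDerivAt z (α s / 4) s := fun s ↦
    ((hα.continuous.div_const 4).integral_hasStrictDerivAt 0 s).hasDerivAt.const_add w
  have hz0 : z 0 = w := by simp [z]
  have hV : c.intV = ∫ t in (0 : ℝ)..1, α t / 4 := by
    refine intervalIntegral.integral_congr_ae ?_
    rw [Set.uIoc_of_le zero_le_one]
    filter_upwards [hae] with s hs hs1
    rw [hs hs1]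
  have hz1 : z 1 = w + c.intV := by rw [hV]
  have hl : ∀ s ∈ Set.Icc (0 : ℝ) 1, Lifts k (z s) (c.Z₀ s) (c.Z₁ s) (c.W s) := fun s hs ↦
    IsFlow.lifts hk0 hk1 hα hz (by rwa [hz0]) hs
  refine ⟨hz1 ▸ hl 1 (by simp), fun hinf ↦ ?_⟩
  have hA : ∀ s ∈ Set.Icc (0 : ℝ) 1, thetaA k (z s) ≠ 0 := fun s hs ↦
    (hl s hs).thetaA_ne_zero hk0 hk1 (hinf s hs)
  have hzc : Continuous z := continuous_iff_continuousAt.2 fun s ↦ (hz s).continuousAt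
  have hint := intervalIntegral.integral_eq_sub_of_hasDerivAt (a := 0) (b := 1)
    (f := fun s ↦ logDeriv (thetaA k) (z s) / 4) (f' := fun s ↦ (ellK k : ℂ) ^ 2 *
      ((thetaB k (z s) / thetaA k (z s)) ^ 2 - (2 * (ellE k : ℂ) - ellK k) / ellK k) * (α s / 4))
    (fun s hs ↦ by
      rw [Set.uIcc_of_le zero_le_one] at hs
      exact (hasDerivAt_logDeriv_thetaA_gamma hk0 hk1 (hA s hs)).comp s (hz s)) (by
      refine ContinuousOn.intervalIntegrable ?_
      rw [Set.uIcc_of_le zero_le_one]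
      have h1 := (((differentiable_thetaB hk0 hk1).continuous.comp hzc).continuousOn
        (s := Set.Icc 0 1)).div
        (((differentiable_thetaA hk0 hk1).continuous.comp hzc).continuousOn) hA
      exact (((h1.pow 2).sub continuousOn_const).const_smul ((ellK k : ℂ) ^ 2)).mul
        (hα.continuous.div_const 4).continuousOn)
  simp only [hz0, hz1] at hint
  rw [← hint]
  refine intervalIntegral.integral_congr_ae ?_
  rw [Set.uIoc_of_le zero_le_one]
  filter_upwards [hae] with s hs hs1
  have hs2 := Set.Ioc_subset_Icc_self hs1
  rw [hs hs1, (hl s hs2).div_eq hk0 hk1 (hinf s hs2)]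
  ring

lemma thetaA_half : thetaA k (1 / 2) = 0 := by
  have : theta (tau k) 0 = 0 := (theta_eq_zero_iff (tau_im_pos hk0 hk1)).2 ⟨0, 0, by simp⟩
  simp [thetaA, this]

lemma thetaA_half_tau : thetaA k (tau k / 2) = 0 := by
  have : theta (tau k) 0 = 0 := (theta_eq_zero_iff (tau_im_pos hk0 hk1)).2 ⟨0, 0, by simp⟩
  simp [thetaA, this]

lemma CurvePath.lifts_half_of_isAtInftyOne {c : CurvePath k} {s : ℝ} (h : c.IsAtInftyOne s) :
    Lifts k (1 / 2) (c.Z₀ s) (c.Z₁ s) (c.W s) := by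
  have hA := thetaA_half hk0 hk1
  have hC := thetaC_half hk0 hk1
  obtain ⟨h0, h1⟩ := h
  refine ⟨by rw [h0, hA]; ring, by rw [h0, hA]; ring, by rw [h1, hC]; ring⟩

/-- The lift of the branch point `P₀`. -/
lemma lifts_branchPoint : Lifts k ((1 - tau k) / 4) 1 (compl k + I * k) 0 := by
  have hK := (ellK_pos hk0 hk1).ne'
  have h0 := compl_pos hk0 hk1
  have h1 := compl_lt_one hk0 hk1
  have hre : 4 * ellK k * ((1 - tau k) / 4).re = ellK k := by
    simp [tau_re]; ring
  have him : 4 * ellK k * ((1 - tau k) / 4).im = -ellK (compl k) := by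
    simp [tau_im hk0 hk1]; field_simp
  have hD : zetaDen k ((1 - tau k) / 4) = 1 := by
    rw [zetaDen, hre, cn, amplitude_ellK hk0 hk1]
    simp
  have hd1 : ellDelta (compl k) (-(Real.pi / 2)) = k := by
    have := compl_sq hk0 hk1
    simp only [ellDelta, Real.sin_neg, Real.sin_pi_div_two]
    rw [show 1 - compl k ^ 2 * (-1) ^ 2 = k ^ 2 by rw [this]; ring, Real.sqrt_sq hk0.le]
  have hd2 : ellDelta k (Real.pi / 2) = compl k := by
    simp [ellDelta, compl]
  have hζ : zetaFun k ((1 - tau k) / 4) = compl k + I * k := by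
    rw [zetaFun, hD, hre, him, sn, sn, dn, dn, amplitude_ellK hk0 hk1, amplitude_neg_ellK h0 h1,
      hd1, hd2]
    simp; ring
  have hB := zetaFun_mul_thetaA hk0 hk1 (z := (1 - tau k) / 4) (by rw [hD]; norm_num)
  rw [hζ] at hB
  have hC : thetaC k ((1 - tau k) / 4) = 0 := by
    have h := thetaC_sq hk0 hk1 ((1 - tau k) / 4)
    rw [← hB] at h
    have hc : (compl k : ℂ) ^ 2 = 1 - k ^ 2 := by exact_mod_cast compl_sq hk0 hk1
    have hq : ((compl k : ℂ) + I * k) ^ 4 + 2 * ((k : ℂ) ^ 2 - (compl k : ℂ) ^ 2) *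
        ((compl k : ℂ) + I * k) ^ 2 + 1 = 0 := by
      have h2 : ((compl k : ℂ) + I * k) ^ 2 = 1 - 2 * k ^ 2 + 2 * I * k * compl k := by
        linear_combination hc + k ^ 2 * I_sq
      rw [show ((compl k : ℂ) + I * k) ^ 4 = (((compl k : ℂ) + I * k) ^ 2) ^ 2 by ring, h2, hc]
      linear_combination 4 * k ^ 2 * compl k ^ 2 * I_sq - 4 * (k : ℂ) ^ 2 * hc
    refine pow_eq_zero_iff (two_ne_zero) |>.1 ?_
    linear_combination h - ellK k ^ 2 / 4 * thetaA k ((1 - tau k) / 4) ^ 4 * hq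
  exact ⟨by rw [← hB]; ring, by rw [hC]; ring, by rw [hC]; ring⟩

end

/-! ### The theta function cutting out the mini-twistor section -/

/-- The section `a Z₀² - b Z₀ Z₁ - e Z₁²`, pulled back to the plane. -/
def sectionTheta (k : ℝ) (a b e z : ℂ) : ℂ :=
  a * thetaA k z ^ 2 - b * (thetaA k z * thetaB k z) - e * thetaB k z ^ 2

/-- The function `W - (a Z₀² - b Z₀ Z₁ - e Z₁²)`, pulled back to the plane. -/
def incidence (k : ℝ) (a b e z : ℂ) : ℂ := thetaC k z - sectionTheta k a b e z

/-- The `ζ i` are the solutions of the quartic obtained by restricting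
`η = a - b ζ - e ζ²` to the curve. -/
def IsFactored (k : ℝ) (a b e : ℂ) (ζ : Fin 4 → ℂ) : Prop :=
  ∀ x, (a - b * x - e * x ^ 2) ^ 2 + (ellK k : ℂ) ^ 2 / 4 * (x ^ 4 + 2 * modDiff k * x ^ 2 + 1) =
    (e ^ 2 + (ellK k : ℂ) ^ 2 / 4) * ∏ i, (x - ζ i)

lemma IsFactored.homogeneous {k : ℝ} {a b e : ℂ} {ζ : Fin 4 → ℂ} (h : IsFactored k a b e ζ)
    (X Y : ℂ) : (a * X ^ 2 - b * (X * Y) - e * Y ^ 2) ^ 2 + (ellK k : ℂ) ^ 2 / 4 *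
      (Y ^ 4 + 2 * modDiff k * X ^ 2 * Y ^ 2 + X ^ 4) =
    (e ^ 2 + (ellK k : ℂ) ^ 2 / 4) * ∏ i, (Y - ζ i * X) := by
  rcases eq_or_ne X 0 with rfl | hX
  · simp; ring
  · have h1 := h (Y / X)
    have h2 : ∏ i, (Y - ζ i * X) = X ^ 4 * ∏ i, (Y / X - ζ i) := by
      rw [show X ^ 4 = ∏ _i : Fin 4, X by simp, ← Finset.prod_mul_distrib]
      exact Finset.prod_congr rfl fun i _ ↦ by field_simp
    rw [h2]
    obtain ⟨y, rfl⟩ : ∃ y, Y = y * X := ⟨Y / X, by field_simp⟩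
    rw [mul_div_cancel_right₀ _ hX] at h1 ⊢
    linear_combination X ^ 4 * h1

lemma IsFactored.sum_eq {k : ℝ} {a b e : ℂ} {ζ : Fin 4 → ℂ} (h : IsFactored k a b e ζ) :
    (e ^ 2 + (ellK k : ℂ) ^ 2 / 4) * ∑ i, ζ i = -2 * b * e := by
  have h1 := h 1
  have h2 := h (-1)
  have h3 := h 2
  have h4 := h (-2)
  simp only [Fin.prod_univ_four, Fin.sum_univ_four] at h1 h2 h3 h4 ⊢
  -- The difference of values at ±1 and ±2 that extracts the cubic coefficient of a quartic.
  linear_combination (h3 - h4 - 2 * h1 + 2 * h2) / 12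

section

variable {k : ℝ} (hk0 : 0 < k) (hk1 : k < 1)
include hk0 hk1

lemma differentiable_sectionTheta (a b e : ℂ) : Differentiable ℂ (sectionTheta k a b e) := by
  have := differentiable_thetaA hk0 hk1
  have := differentiable_thetaB hk0 hk1
  unfold sectionTheta
  fun_prop

lemma differentiable_incidence (a b e : ℂ) : Differentiable ℂ (incidence k a b e) :=
  (differentiable_thetaC hk0 hk1).sub (differentiable_sectionTheta hk0 hk1 a b e)

lemma incidence_add_one (a b e z : ℂ) : incidence k a b e (z + 1) = incidence k a b e z := by
  simp only [incidence, sectionTheta, thetaA_add_one, thetaB_add_one, thetaC_add_one hk0 hk1]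

lemma incidence_add_tau (a b e z : ℂ) :
    incidence k a b e (z + tau k) = thetaFactor k z ^ 2 * incidence k a b e z := by
  simp only [incidence, sectionTheta, thetaA_add_tau hk0 hk1, thetaB_add_tau hk0 hk1,
    thetaC_add_tau hk0 hk1]
  ring

lemma thetaA_add_lattice_eq_zero_iff {l : ℂ} (hl : InLattice (tau k) l) (z : ℂ) :
    thetaA k (z + l) = 0 ↔ thetaA k z = 0 := by
  refine Iff.of_eq (add_lattice_eq_of_periodic (f := fun z ↦ thetaA k z = 0)
    (fun z ↦ ?_) (fun z ↦ ?_) hl z)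
  · simp only [thetaA_add_one]
  · simp only [thetaA_add_tau hk0 hk1, mul_eq_zero, thetaFactor_ne_zero, false_or]

lemma hasDerivAt_sectionTheta (a b e z : ℂ) : HasDerivAt (sectionTheta k a b e)
    (a * (2 * thetaA k z * deriv (thetaA k) z) -
      b * (deriv (thetaA k) z * thetaB k z + thetaA k z * deriv (thetaB k) z) -
      e * (2 * thetaB k z * deriv (thetaB k) z)) z := by
  have hA := (differentiable_thetaA hk0 hk1 z).hasDerivAt
  have hB := (differentiable_thetaB hk0 hk1 z).hasDerivAt
  have h := (((hA.fun_pow 2).const_mul a).fun_sub ((hA.fun_mul hB).const_mul b)).fun_sub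
    ((hB.fun_pow 2).const_mul e)
  refine h.congr_deriv ?_
  norm_num

variable {a b e : ℂ} {ζ : Fin 4 → ℂ}

/-- The norm to the ζ-line: the product with the conjugate under η ↦ -η is the quartic in ζ. -/
lemma incidence_mul (h : IsFactored k a b e ζ) (z : ℂ) :
    incidence k a b e z * (-thetaC k z - sectionTheta k a b e z) =
      (e ^ 2 + (ellK k : ℂ) ^ 2 / 4) * ∏ i, (thetaB k z - ζ i * thetaA k z) := by
  have h1 := h.homogeneous (thetaA k z) (thetaB k z)
  have h2 := thetaC_sq hk0 hk1 z
  rw [← h1, incidence, modDiff, sectionTheta]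
  linear_combination -h2

/-- The condition on e is that the quartic has degree 4, that is, none of its four zeros has escaped
to infinity. -/
lemma incidence_ne_zero_of_thetaA (he : e ^ 2 + (ellK k : ℂ) ^ 2 / 4 ≠ 0) {w : ℂ}
    (hA : thetaA k w = 0) : incidence k a b e w ≠ 0 := by
  have hB := (thetaA_or_thetaB_ne_zero hk0 hk1 w).resolve_left (not_not.2 hA)
  intro h
  have h2 := thetaC_sq hk0 hk1 w
  have h3 : (e ^ 2 + (ellK k : ℂ) ^ 2 / 4) * thetaB k w ^ 4 = 0 := by
    simp only [incidence, sectionTheta, hA] at h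
    rw [hA] at h2
    linear_combination h2 - (thetaC k w - e * thetaB k w ^ 2) * h
  exact mul_ne_zero he (pow_ne_zero 4 hB) h3

/-- At a branch point the derivative of `W` does not vanish. -/
lemma deriv_thetaC_ne_zero {w : ℂ} (hA : thetaA k w ≠ 0) (hC : thetaC k w = 0) :
    deriv (thetaC k) w ≠ 0 := by
  intro h
  have hK : (ellK k : ℂ) ≠ 0 := by exact_mod_cast (ellK_pos hk0 hk1).ne'
  have h1 := deriv_thetaC hk0 hk1 w
  have h2 := thetaC_sq hk0 hk1 w
  rw [h, hC] at h1
  rw [hC] at h2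
  have h3 : (ellK k : ℂ) ^ 2 * (thetaB k w *
      (thetaB k w ^ 2 + modDiff k * thetaA k w ^ 2)) = 0 := by
    rw [modDiff]; linear_combination h1 / 2
  have h4 : (ellK k : ℂ) ^ 2 * (thetaB k w ^ 4 + 2 * modDiff k * thetaA k w ^ 2 * thetaB k w ^ 2 +
      thetaA k w ^ 4) = 0 := by
    rw [modDiff]; linear_combination 4 * h2
  replace h3 := (mul_eq_zero.1 h3).resolve_left (pow_ne_zero 2 hK)
  replace h4 := (mul_eq_zero.1 h4).resolve_left (pow_ne_zero 2 hK)
  rcases mul_eq_zero.1 h3 with h5 | h5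
  · simp [h5, hA] at h4
  · have h6 : (1 - modDiff k ^ 2) * thetaA k w ^ 4 = 0 := by
      linear_combination h4 - (thetaB k w ^ 2 + modDiff k * thetaA k w ^ 2) * h5
    exact mul_ne_zero (sub_ne_zero.2 (modDiff_sq_ne_one hk0 hk1).symm) (pow_ne_zero 4 hA) h6

/-- Up to the factor A² the section is a polynomial in ζ, and ζ' = 0 at a branch point. -/
lemma deriv_sectionTheta_eq_zero {w : ℂ} (hA : thetaA k w ≠ 0) (hC : thetaC k w = 0)
    (h : sectionTheta k a b e w = 0) : deriv (sectionTheta k a b e) w = 0 := by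
  rw [(hasDerivAt_sectionTheta hk0 hk1 a b e w).deriv]
  refine mul_left_cancel₀ hA ?_
  rw [thetaC] at hC
  rw [sectionTheta] at h
  linear_combination 2 * deriv (thetaA k) w * h +
    4 * (-b * thetaA k w - 2 * e * thetaB k w) * hC

lemma analyticOrderAt_factor_of_ne {w x : ℂ} (h : thetaB k w - x * thetaA k w ≠ 0) :
    analyticOrderAt (fun z ↦ thetaB k z - x * thetaA k z) w = 0 := by
  have d : Differentiable ℂ fun z ↦ thetaB k z - x * thetaA k z :=
    (differentiable_thetaB hk0 hk1).sub ((differentiable_thetaA hk0 hk1).const_mul x)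
  exact (d.analyticAt w).analyticOrderAt_eq_zero.2 h

lemma deriv_factor {w x : ℂ} (h : thetaB k w - x * thetaA k w = 0) :
    deriv (fun z ↦ thetaB k z - x * thetaA k z) w * thetaA k w = 4 * thetaC k w := by
  rw [((differentiable_thetaB hk0 hk1 w).hasDerivAt.fun_sub
    ((differentiable_thetaA hk0 hk1 w).hasDerivAt.const_mul x)).deriv, thetaC]
  linear_combination deriv (thetaA k) w * h

lemma analyticOrderAt_incidence_add (h : IsFactored k a b e ζ)
    (he : e ^ 2 + (ellK k : ℂ) ^ 2 / 4 ≠ 0) (w : ℂ) :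
    analyticOrderAt (incidence k a b e) w +
      analyticOrderAt (fun z ↦ -thetaC k z - sectionTheta k a b e z) w =
    ∑ i, analyticOrderAt (fun z ↦ thetaB k z - ζ i * thetaA k z) w := by
  have dA := differentiable_thetaA hk0 hk1
  have dB := differentiable_thetaB hk0 hk1
  have dC := differentiable_thetaC hk0 hk1
  have dS := differentiable_sectionTheta hk0 hk1 a b e
  have d1 : Differentiable ℂ (fun z ↦ -thetaC k z - sectionTheta k a b e z) := by fun_prop
  have hd : ∀ i, AnalyticAt ℂ (fun z ↦ thetaB k z - ζ i * thetaA k z) w := fun i ↦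
    (dB.sub (dA.const_mul (ζ i))).analyticAt w
  rw [← analyticOrderAt_mul ((differentiable_incidence hk0 hk1 a b e).analyticAt w)
    (d1.analyticAt w), show incidence k a b e * (fun z ↦ -thetaC k z - sectionTheta k a b e z) =
      (fun _ ↦ e ^ 2 + (ellK k : ℂ) ^ 2 / 4) * ((((fun z ↦ thetaB k z - ζ 0 * thetaA k z) *
        (fun z ↦ thetaB k z - ζ 1 * thetaA k z)) * (fun z ↦ thetaB k z - ζ 2 * thetaA k z)) *
        (fun z ↦ thetaB k z - ζ 3 * thetaA k z)) from funext fun z ↦ by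
      simp only [Pi.mul_apply, incidence_mul hk0 hk1 h, Fin.prod_univ_four],
    analyticOrderAt_mul analyticAt_const ((((hd 0).mul (hd 1)).mul (hd 2)).mul (hd 3)),
    analyticOrderAt_mul (((hd 0).mul (hd 1)).mul (hd 2)) (hd 3),
    analyticOrderAt_mul ((hd 0).mul (hd 1)) (hd 2), analyticOrderAt_mul (hd 0) (hd 1),
    analyticAt_const.analyticOrderAt_eq_zero.2 he, zero_add, Fin.sum_univ_four]

lemma inLattice_iff_of_lifts {w z x y : ℂ} (hA : thetaA k w ≠ 0) (hz : Lifts k z 1 x y) :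
    InLattice (tau k) (w - z) ↔
      thetaB k w = x * thetaA k w ∧ thetaC k w = y * thetaA k w ^ 2 := by
  have hAz := hz.thetaA_ne_zero hk0 hk1 one_ne_zero
  have hB : thetaB k z = x * thetaA k z := by linear_combination hz.1
  have hC : thetaC k z = y * thetaA k z ^ 2 := by linear_combination -hz.2.1
  constructor
  · intro hl
    have h1 := zetaTheta_add_lattice hk0 hk1 hl z
    have h2 := etaTheta_add_lattice hk0 hk1 hl z
    rw [add_sub_cancel] at h1 h2
    rw [hB, mul_div_cancel_right₀ _ hAz, div_eq_iff hA] at h1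
    rw [hC, mul_div_cancel_right₀ _ (pow_ne_zero 2 hAz), div_eq_iff (pow_ne_zero 2 hA)] at h2
    exact ⟨h1, h2⟩
  · rintro ⟨h1, h2⟩
    have h := hz.smul (thetaA k w)
    rw [← h1, ← h2] at h
    obtain ⟨m, n, hmn⟩ := inLattice_of_lifts hk0 hk1 h
    exact ⟨-m, -n, by push_cast; linear_combination -hmn⟩

open Classical in
-- The multiplicity on the curve equals the multiplicity of the root. Away from branch points the
-- conjugate factor is nonzero and each ζ - ζ_i has a simple zero. At a branch point both conjugate
-- factors have a simple zero and each ζ - ζ_i vanishes at least doubly, so exactly one index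
-- contributes.
lemma analyticOrderAt_incidence (h : IsFactored k a b e ζ)
    (he : e ^ 2 + (ellK k : ℂ) ^ 2 / 4 ≠ 0) {z : Fin 4 → ℂ}
    (hz : ∀ i, Lifts k (z i) 1 (ζ i) (a - b * ζ i - e * ζ i ^ 2)) (w : ℂ) :
    analyticOrderAt (incidence k a b e) w =
      ∑ i, if InLattice (tau k) (w - z i) then 1 else 0 := by
  have hΨ := (differentiable_incidence hk0 hk1 a b e).analyticAt w
  by_cases hA : thetaA k w = 0
  · rw [hΨ.analyticOrderAt_eq_zero.2 (incidence_ne_zero_of_thetaA hk0 hk1 he hA)]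
    refine (Finset.sum_eq_zero fun i _ ↦ if_neg fun hl ↦ ?_).symm
    refine (hz i).thetaA_ne_zero hk0 hk1 one_ne_zero ?_
    rwa [← thetaA_add_lattice_eq_zero_iff hk0 hk1 hl, add_sub_cancel]
  by_cases h0 : incidence k a b e w = 0
  swap
  · rw [hΨ.analyticOrderAt_eq_zero.2 h0]
    refine (Finset.sum_eq_zero fun i _ ↦ if_neg fun hl ↦ h0 ?_).symm
    obtain ⟨h1, h2⟩ := (inLattice_iff_of_lifts hk0 hk1 hA (hz i)).1 hl
    rw [incidence, sectionTheta, h1, h2]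
    ring
  have hsec : thetaC k w = sectionTheta k a b e w := sub_eq_zero.1 h0
  have hiff : ∀ i, InLattice (tau k) (w - z i) ↔ thetaB k w - ζ i * thetaA k w = 0 := by
    intro i
    rw [inLattice_iff_of_lifts hk0 hk1 hA (hz i), sub_eq_zero, and_iff_left_iff_imp]
    intro h1
    rw [hsec, sectionTheta, h1]
    ring
  simp only [hiff]
  have hadd := analyticOrderAt_incidence_add hk0 hk1 h he w
  have dC := differentiable_thetaC hk0 hk1
  have dS := differentiable_sectionTheta hk0 hk1 a b e
  have d1 : Differentiable ℂ (fun z ↦ -thetaC k z - sectionTheta k a b e z) := by fun_prop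
  have d2 : ∀ x, Differentiable ℂ fun z ↦ thetaB k z - x * thetaA k z := fun x ↦
    (differentiable_thetaB hk0 hk1).sub ((differentiable_thetaA hk0 hk1).const_mul x)
  by_cases hC : thetaC k w = 0
  · have hS := hsec.symm.trans hC
    have hC' := deriv_thetaC_ne_zero hk0 hk1 hA hC
    have hS' := deriv_sectionTheta_eq_zero hk0 hk1 hA hC hS
    have o1 : analyticOrderAt (incidence k a b e) w = 1 :=
      hΨ.analyticOrderAt_eq_one_of_zero_deriv_ne_zero h0 (by
        rw [show incidence k a b e = fun z ↦ thetaC k z - sectionTheta k a b e z from rfl,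
          deriv_fun_sub (dC w) (dS w), hS', sub_zero]
        exact hC')
    have o2 : analyticOrderAt (fun z ↦ -thetaC k z - sectionTheta k a b e z) w = 1 :=
      (d1.analyticAt w).analyticOrderAt_eq_one_of_zero_deriv_ne_zero (by simp [hC, hS]) (by
        rw [((dC w).hasDerivAt.fun_neg.fun_sub (dS w).hasDerivAt).deriv, hS', sub_zero]
        exact neg_ne_zero.2 hC')
    have hle : ∀ i, 2 * (if thetaB k w - ζ i * thetaA k w = 0 then (1 : ℕ∞) else 0) ≤
        analyticOrderAt (fun z ↦ thetaB k z - ζ i * thetaA k z) w := by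
      intro i
      split_ifs with hi
      · rw [mul_one]
        refine two_le_analyticOrderAt ((d2 (ζ i)).analyticAt w) hi ?_
        have := deriv_factor hk0 hk1 hi
        rw [hC, mul_zero] at this
        exact (mul_eq_zero.1 this).resolve_right hA
      · simp
    rw [o1] at hadd ⊢
    rw [o2] at hadd
    obtain ⟨i, hi⟩ : ∃ i, thetaB k w - ζ i * thetaA k w = 0 := by
      by_contra! hcon
      rw [Finset.sum_eq_zero fun i _ ↦ analyticOrderAt_factor_of_ne hk0 hk1 (hcon i)] at hadd
      norm_num at hadd
    refine le_antisymm ?_ ?_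
    · refine le_trans ?_ (Finset.single_le_sum (fun _ _ ↦ zero_le) (Finset.mem_univ i))
      rw [if_pos hi]
    -- Twice the number of vanishing factors is at most the total order 1 + 1.
    · have h3 := Finset.sum_le_sum fun i (_ : i ∈ Finset.univ) ↦ hle i
      rw [← Finset.mul_sum, ← hadd, one_add_one_eq_two, Finset.sum_boole] at h3
      rw [Finset.sum_boole]
      norm_cast at h3 ⊢
      omega
  · have o2 : analyticOrderAt (fun z ↦ -thetaC k z - sectionTheta k a b e z) w = 0 :=
      (d1.analyticAt w).analyticOrderAt_eq_zero.2 (by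
        rw [← hsec]
        intro h3
        exact hC (by linear_combination -h3 / 2))
    rw [o2, add_zero] at hadd
    rw [hadd]
    refine Finset.sum_congr rfl fun i _ ↦ ?_
    split_ifs with hi
    · refine ((d2 (ζ i)).analyticAt w).analyticOrderAt_eq_one_of_zero_deriv_ne_zero hi ?_
      intro h3
      have := deriv_factor hk0 hk1 hi
      rw [h3, zero_mul] at this
      exact hC (by linear_combination -this / 4)
    · exact analyticOrderAt_factor_of_ne hk0 hk1 hi

end

/-! ### Abel's theorem for the mini-twistor section -/

/-- H'/H is entire and elliptic, hence a constant d. Period 1 makes d an integer multiple of 2πi,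
and the factor at τ determines s modulo 1. -/
lemma exists_eq_exp_of_quasiperiodic {τ : ℂ} (hτ : 0 < τ.im) {H : ℂ → ℂ} (hH : Differentiable ℂ H)
    (h0 : ∀ z, H z ≠ 0) {s : ℂ} (h1 : ∀ z, H (z + 1) = H z)
    (h2 : ∀ z, H (z + τ) = expTwoPi s * H z) :
    ∃ n m : ℤ, s = n * τ + m ∧ ∀ z, H z = H 0 * expTwoPi (n * z) := by
  have hd : Differentiable ℂ fun z ↦ deriv H z / H z := hH.deriv.div hH h0
  have e1 : ∀ z, deriv H (z + 1) = deriv H z := fun z ↦ by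
    rw [← deriv_comp_add_const]; simp only [h1]
  have e2 : ∀ z, deriv H (z + τ) = expTwoPi s * deriv H z := fun z ↦ by
    rw [← deriv_comp_add_const]; simp only [h2]; exact deriv_const_mul _ (hH z)
  obtain ⟨d, hc⟩ := exists_eq_const_of_periodic hτ hd (fun z ↦ by rw [e1, h1]) (fun z ↦ by
    rw [e2, h2, mul_div_mul_left _ _ (expTwoPi_ne_zero s)])
  have hexp : ∀ z, H z = H 0 * exp (d * z) := by
    have hder : ∀ z, HasDerivAt (fun z ↦ H z * exp (-(d * z))) 0 z := by
      intro z
      have h3 := (((hasDerivAt_id z).const_mul d).fun_neg).cexp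
      refine ((hH z).hasDerivAt.fun_mul h3).congr_deriv ?_
      have h4 := hc z
      rw [div_eq_iff (h0 z)] at h4
      rw [h4]; simp; ring
    intro z
    have h5 := is_const_of_deriv_eq_zero (fun z ↦ (hder z).differentiableAt)
      (fun z ↦ (hder z).deriv) z 0
    simp only [mul_zero, neg_zero, exp_zero, mul_one] at h5
    rw [← h5, mul_assoc, ← Complex.exp_add, neg_add_cancel, exp_zero, mul_one]
  have hd1 : exp d = 1 := by
    have h3 := h1 0
    rw [zero_add, hexp 1, mul_one] at h3
    exact mul_left_cancel₀ (h0 0) (by rw [h3, mul_one])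
  obtain ⟨n, hn⟩ := exp_eq_one_iff.1 hd1
  have hexp' : ∀ z, H z = H 0 * expTwoPi (n * z) := fun z ↦ by
    rw [hexp z, expTwoPi, hn]
    congr 2; ring
  have h4 := h2 0
  rw [zero_add, hexp' τ, mul_comm] at h4
  have h5 : expTwoPi (s - n * τ) = 1 := by
    rw [sub_eq_add_neg, expTwoPi_add, ← mul_right_cancel₀ (h0 0) h4, ← expTwoPi_add,
      ← sub_eq_add_neg, sub_self]
    simp [expTwoPi]
  obtain ⟨m, hm⟩ := expTwoPi_eq_one_iff.1 h5
  exact ⟨n, m, by linear_combination hm, hexp'⟩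

section

variable {k : ℝ} (hk0 : 0 < k) (hk1 : k < 1) {a b e : ℂ} {ζ : Fin 4 → ℂ}
include hk0 hk1

/-- The theta function with the given zeros. -/
def thetaProd (k : ℝ) (z : Fin 4 → ℂ) (w : ℂ) : ℂ := ∏ i, theta (tau k) (w - z i)

lemma differentiable_thetaProd (z : Fin 4 → ℂ) : Differentiable ℂ (thetaProd k z) := by
  have h : ∀ i, Differentiable ℂ fun w ↦ theta (tau k) (w - z i) := fun i ↦
    differentiable_theta_sub (tau_im_pos hk0 hk1) (z i)
  unfold thetaProd
  fun_prop

open Classical in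
lemma analyticOrderAt_thetaProd (z : Fin 4 → ℂ) (w : ℂ) :
    analyticOrderAt (thetaProd k z) w = ∑ i, if InLattice (tau k) (w - z i) then 1 else 0 := by
  have hτ := tau_im_pos hk0 hk1
  have hd : ∀ i, AnalyticAt ℂ (fun w ↦ theta (tau k) (w - z i)) w := fun i ↦
    (differentiable_theta_sub hτ (z i)).analyticAt w
  rw [show thetaProd k z = ((((fun w ↦ theta (tau k) (w - z 0)) *
      (fun w ↦ theta (tau k) (w - z 1))) * (fun w ↦ theta (tau k) (w - z 2))) *
      (fun w ↦ theta (tau k) (w - z 3))) from funext fun w ↦ by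
        simp only [thetaProd, Pi.mul_apply, Fin.prod_univ_four],
    analyticOrderAt_mul (((hd 0).mul (hd 1)).mul (hd 2)) (hd 3),
    analyticOrderAt_mul ((hd 0).mul (hd 1)) (hd 2), analyticOrderAt_mul (hd 0) (hd 1),
    Fin.sum_univ_four]
  simp only [analyticOrderAt_theta_sub hτ]

lemma eventually_thetaProd_ne_zero (z : Fin 4 → ℂ) (w : ℂ) :
    ∀ᶠ u in 𝓝[≠] w, thetaProd k z u ≠ 0 := by
  classical
  have h := ((differentiable_thetaProd hk0 hk1 z).analyticAt w).eventually_eq_zero_or_eventually_ne_zero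
  refine h.resolve_left fun h0 ↦ ?_
  have h1 := analyticOrderAt_eq_top.2 h0
  rw [analyticOrderAt_thetaProd hk0 hk1, Finset.sum_boole] at h1
  exact ENat.natCast_ne_top _ h1

omit hk0 hk1 in
lemma thetaProd_add_one (z : Fin 4 → ℂ) (w : ℂ) : thetaProd k z (w + 1) = thetaProd k z w := by
  simp only [thetaProd, add_sub_right_comm, theta_add_one]

lemma thetaProd_add_tau (z : Fin 4 → ℂ) (w : ℂ) :
    thetaProd k z (w + tau k) = expTwoPi (∑ i, z i - 4 * w) * thetaProd k z w := by
  simp only [thetaProd, add_sub_right_comm, theta_add_tau (tau_im_pos hk0 hk1),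
    Fin.prod_univ_four, Fin.sum_univ_four]
  rw [show z 0 - 4 * w + z 1 + z 2 + z 3 = -(w - z 0) + -(w - z 1) + -(w - z 2) + -(w - z 3) by
    ring, expTwoPi_add, expTwoPi_add, expTwoPi_add]
  ring

omit hk0 hk1 in
lemma thetaFactor_sq (w : ℂ) : thetaFactor k w ^ 2 = expTwoPi (tau k - 4 * w) := by
  rw [thetaFactor, neg_sq, sq, ← expTwoPi_add]
  congr 1; ring

/-- Both sides have the same zeros, so Ψ / ∏ θ(w - z_i) has no zeros or poles. Under τ its factor is
the constant e^{2πi(τ - ∑ z_i)}, and `exists_eq_exp_of_quasiperiodic` applies. -/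
lemma exists_incidence_eq (h : IsFactored k a b e ζ)
    (he : e ^ 2 + (ellK k : ℂ) ^ 2 / 4 ≠ 0) {z : Fin 4 → ℂ}
    (hz : ∀ i, Lifts k (z i) 1 (ζ i) (a - b * ζ i - e * ζ i ^ 2)) :
    ∃ n m : ℤ, ∃ c : ℂ, ∑ i, z i = (1 - n) * tau k - m ∧
      ∀ w, incidence k a b e w = c * expTwoPi (n * w) * thetaProd k z w := by
  classical
  have dΨ := differentiable_incidence hk0 hk1 a b e
  have dT := differentiable_thetaProd hk0 hk1 z
  have hord : ∀ w, meromorphicOrderAt (fun w ↦ incidence k a b e w / thetaProd k z w) w = 0 := by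
    intro w
    have h1 := (dΨ.analyticAt w)
    have h2 := (dT.analyticAt w)
    have h3 := meromorphicOrderAt_div h1.meromorphicAt h2.meromorphicAt
    rw [h1.meromorphicOrderAt_eq, h2.meromorphicOrderAt_eq, analyticOrderAt_thetaProd hk0 hk1,
      analyticOrderAt_incidence hk0 hk1 h he hz, Finset.sum_boole] at h3
    refine h3.trans ?_
    exact LinearOrderedAddCommGroupWithTop.sub_self_eq_zero_of_ne_top (by simp)
  obtain ⟨H, dH, hH, -, hH0⟩ := exists_differentiable_of_meromorphicOrderAt_nonneg
    (f := fun w ↦ incidence k a b e w / thetaProd k z w)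
    (fun w ↦ (dΨ.analyticAt w).meromorphicAt.div (dT.analyticAt w).meromorphicAt)
    (fun w ↦ (hord w).ge)
  have hprod : ∀ w, incidence k a b e w = H w * thetaProd k z w := fun w ↦
    eq_of_eventuallyEq_nhdsNE (g := fun w ↦ H w * thetaProd k z w) (dΨ w).continuousAt
      (dH.mul dT w).continuousAt (by
        filter_upwards [hH w, eventually_thetaProd_ne_zero hk0 hk1 z w] with u hu hu0
        rw [← hu, div_mul_cancel₀ _ hu0])
  have hper : ∀ {p : ℂ} {s : ℂ}, (∀ w, thetaProd k z w ≠ 0 → H (w + p) = s * H w) →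
      ∀ w, H (w + p) = s * H w := fun {p s} hp w ↦
    eq_of_eventuallyEq_nhdsNE (f := fun w ↦ H (w + p)) (g := fun w ↦ s * H w)
      (dH.continuous.comp (continuous_add_const p)).continuousAt
      (dH.continuous.const_mul s).continuousAt
      ((eventually_thetaProd_ne_zero hk0 hk1 z w).mono hp)
  obtain ⟨n, m, hs, hexp⟩ := exists_eq_exp_of_quasiperiodic (tau_im_pos hk0 hk1) dH
    (fun w ↦ hH0 w (hord w)) (s := tau k - ∑ i, z i)
    (fun w ↦ by
      refine (hper (s := 1) (fun w hw ↦ ?_) w).trans (one_mul _)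
      refine mul_right_cancel₀ hw ?_
      rw [one_mul, ← hprod, ← thetaProd_add_one, ← hprod, incidence_add_one hk0 hk1])
    (hper fun w hw ↦ by
      refine mul_right_cancel₀ (mul_ne_zero (expTwoPi_ne_zero (∑ i, z i - 4 * w)) hw) ?_
      rw [← thetaProd_add_tau hk0 hk1, ← hprod, incidence_add_tau hk0 hk1, thetaFactor_sq, hprod,
        thetaProd_add_tau hk0 hk1,
        show tau k - 4 * w = (tau k - ∑ i, z i) + (∑ i, z i - 4 * w) by ring, expTwoPi_add]
      ring)
  exact ⟨n, m, H 0, by linear_combination -hs, fun w ↦ by rw [hprod, hexp]⟩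

lemma logDeriv_incidence {z : Fin 4 → ℂ} {n : ℤ} {c : ℂ}
    (h : ∀ w, incidence k a b e w = c * expTwoPi (n * w) * thetaProd k z w) {w : ℂ}
    (hw : incidence k a b e w ≠ 0) :
    logDeriv (incidence k a b e) w =
      2 * Real.pi * I * n + ∑ i, logDeriv (theta (tau k)) (w - z i) := by
  have hτ := tau_im_pos hk0 hk1
  rw [h w] at hw
  have hT := right_ne_zero_of_mul hw
  have hE := left_ne_zero_of_mul hw
  have hc := left_ne_zero_of_mul hE
  have hθ : ∀ i ∈ Finset.univ, theta (tau k) (w - z i) ≠ 0 := fun i hi ↦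
    Finset.prod_ne_zero_iff.1 hT i hi
  have dE : Differentiable ℂ fun w ↦ c * expTwoPi (n * w) :=
    (differentiable_expTwoPi.comp (differentiable_id.const_mul (n : ℂ))).const_mul c
  rw [show incidence k a b e = fun w ↦ c * expTwoPi (n * w) * thetaProd k z w from funext h,
    logDeriv_mul w hE hT (dE w) (differentiable_thetaProd hk0 hk1 z w), logDeriv_const_mul _ _ hc]
  congr 1
  · have h1 := (hasDerivAt_expTwoPi (n * w)).comp w ((hasDerivAt_id w).const_mul (n : ℂ))
    rw [logDeriv_apply, show (fun w ↦ expTwoPi (n * w)) = expTwoPi ∘ fun w ↦ (n : ℂ) * w from rfl,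
      h1.deriv]
    have := expTwoPi_ne_zero (n * w)
    field_simp
  · rw [show thetaProd k z = fun w ↦ ∏ i, theta (tau k) (w - z i) from rfl,
      logDeriv_prod hθ (fun i _ ↦ differentiable_theta_sub hτ (z i) w)]
    refine Finset.sum_congr rfl fun i _ ↦ ?_
    rw [logDeriv_apply, logDeriv_apply, deriv_comp_sub_const]

end

/-! ### Logarithmic derivatives at the points over infinity -/

section

variable {τ : ℂ} (hτ : 0 < τ.im)
include hτ

omit hτ in
lemma InLattice.neg {z : ℂ} (h : InLattice τ z) : InLattice τ (-z) := by
  obtain ⟨m, n, rfl⟩ := h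
  exact ⟨-m, -n, by push_cast; ring⟩

lemma not_inLattice_half : ¬InLattice τ (1 / 2) := by
  have := not_inLattice_of_coords hτ (a := 0) (b := 1 / 2) (Or.inr fun n hn ↦ by
    have h : ((1 : ℤ) : ℝ) = ((2 * n : ℤ) : ℝ) := by push_cast; linarith
    have := Int.cast_injective h
    omega)
  simpa using this

lemma not_inLattice_half_tau : ¬InLattice τ (τ / 2) := by
  have := not_inLattice_of_coords hτ (a := 1 / 2) (b := 0) (Or.inl fun n hn ↦ by
    have h : ((1 : ℤ) : ℝ) = ((2 * n : ℤ) : ℝ) := by push_cast; linarith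
    have := Int.cast_injective h
    omega)
  simpa [div_eq_inv_mul] using this

lemma not_inLattice_quarter : ¬InLattice τ ((1 + τ) / 4) := by
  have := not_inLattice_of_coords hτ (a := 1 / 4) (b := 1 / 4) (Or.inl fun n hn ↦ by
    have h : ((1 : ℤ) : ℝ) = ((4 * n : ℤ) : ℝ) := by push_cast; linarith
    have := Int.cast_injective h
    omega)
  rwa [show ((1 / 4 : ℝ) : ℂ) * τ + ((1 / 4 : ℝ) : ℂ) = (1 + τ) / 4 by push_cast; ring] at this

lemma logDeriv_theta_half : logDeriv (theta τ) (1 / 2) = Real.pi * I := by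
  have h1 := logDeriv_theta_neg hτ (not_inLattice_half hτ)
  have h2 := logDeriv_theta_add_one (τ := τ) (-(1 / 2))
  rw [show -(1 / 2 : ℂ) + 1 = 1 / 2 by ring, h1] at h2
  linear_combination h2 / 2

/-- The points τ/2 and -τ/2 are related both by the reflection and by the shift, which determines
the value. The same argument with the period 1 gives the value at 1/2. -/
lemma logDeriv_theta_half_tau : logDeriv (theta τ) (τ / 2) = 0 := by
  have h0 := not_inLattice_half_tau hτ
  have h1 := logDeriv_theta_neg hτ h0
  have h2 := logDeriv_theta_add_tau hτ (z := -(τ / 2)) fun h ↦ h0 (by simpa using h.neg)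
  rw [show -(τ / 2) + τ = τ / 2 by ring, h1] at h2
  linear_combination h2 / 2

end

section

variable {k : ℝ} (hk0 : 0 < k) (hk1 : k < 1)
include hk0 hk1

lemma logDeriv_thetaA {z : ℂ} (hz : thetaA k z ≠ 0) : logDeriv (thetaA k) z =
    logDeriv (theta (tau k)) (z - 1 / 2) + logDeriv (theta (tau k)) (z - tau k / 2) := by
  have hτ := tau_im_pos hk0 hk1
  rw [thetaA] at hz
  rw [show thetaA k = fun z ↦ theta (tau k) (z - 1 / 2) * theta (tau k) (z - tau k / 2) from rfl,
    logDeriv_mul z (left_ne_zero_of_mul hz) (right_ne_zero_of_mul hz)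
      (differentiable_theta_sub hτ _ z) (differentiable_theta_sub hτ _ z)]
  simp only [logDeriv_apply, deriv_comp_sub_const]

lemma logDeriv_thetaB {z : ℂ} (hz : thetaB k z ≠ 0) : logDeriv (thetaB k) z =
    logDeriv (theta (tau k)) z + logDeriv (theta (tau k)) (z - (1 + tau k) / 2) := by
  have hτ := tau_im_pos hk0 hk1
  rw [thetaB, thetaNum] at hz
  have hz' := right_ne_zero_of_mul hz
  rw [show thetaB k = fun z ↦ thetaSign k * (theta (tau k) z *
      theta (tau k) (z - (1 + tau k) / 2)) from rfl,
    logDeriv_const_mul _ _ (left_ne_zero_of_mul hz),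
    logDeriv_mul z (left_ne_zero_of_mul hz') (right_ne_zero_of_mul hz')
      (differentiable_theta hτ z) (differentiable_theta_sub hτ _ z)]
  simp only [logDeriv_apply, deriv_comp_sub_const]

/-- The two arguments are -(1 + τ)/4 and (1 + τ)/4 - τ. Under reflection and shift the unknown
values cancel and the constants 2πi + 2πi remain. -/
lemma logDeriv_thetaA_branchPoint :
    logDeriv (thetaA k) ((1 - tau k) / 4) = 4 * Real.pi * I := by
  have hτ := tau_im_pos hk0 hk1
  have h0 := not_inLattice_quarter hτ
  rw [logDeriv_thetaA hk0 hk1 ((lifts_branchPoint hk0 hk1).thetaA_ne_zero hk0 hk1 one_ne_zero),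
    show (1 - tau k) / 4 - 1 / 2 = -((1 + tau k) / 4) by ring, logDeriv_theta_neg hτ h0]
  have h1 := logDeriv_theta_add_tau hτ (z := (1 - tau k) / 4 - tau k / 2) (by
    rintro ⟨m, n, h⟩
    exact h0 ⟨m + 1, n, by push_cast; linear_combination h⟩)
  rw [show (1 - tau k) / 4 - tau k / 2 + tau k = (1 + tau k) / 4 by ring] at h1
  linear_combination -h1

lemma thetaB_ne_zero_of_thetaA {z : ℂ} (hz : thetaA k z = 0) : thetaB k z ≠ 0 :=
  (thetaA_or_thetaB_ne_zero hk0 hk1 z).resolve_left (not_not.2 hz)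

lemma logDeriv_thetaB_half : logDeriv (thetaB k) (1 / 2) = 3 * Real.pi * I := by
  have hτ := tau_im_pos hk0 hk1
  rw [logDeriv_thetaB hk0 hk1 (thetaB_ne_zero_of_thetaA hk0 hk1 (thetaA_half hk0 hk1)),
    show 1 / 2 - (1 + tau k) / 2 = -(tau k / 2) by ring,
    logDeriv_theta_neg hτ (not_inLattice_half_tau hτ), logDeriv_theta_half hτ,
    logDeriv_theta_half_tau hτ]
  ring

lemma logDeriv_thetaB_half_tau : logDeriv (thetaB k) (tau k / 2) = Real.pi * I := by
  have hτ := tau_im_pos hk0 hk1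
  rw [logDeriv_thetaB hk0 hk1 (thetaB_ne_zero_of_thetaA hk0 hk1 (thetaA_half_tau hk0 hk1)),
    show tau k / 2 - (1 + tau k) / 2 = -(1 / 2) by ring,
    logDeriv_theta_neg hτ (not_inLattice_half hτ), logDeriv_theta_half hτ,
    logDeriv_theta_half_tau hτ]
  ring

/-- The logarithmic derivative of the incidence function at a point over `ζ = ∞`. -/
lemma logDeriv_incidence_of_thetaA {a b e p ε : ℂ} (hA : thetaA k p = 0) (hε : ε ^ 2 = 1)
    (hC : thetaC k p = -(ε * (I * ellK k / 2)) * thetaB k p ^ 2)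
    (h0 : incidence k a b e p ≠ 0) :
    logDeriv (incidence k a b e) p =
      2 * logDeriv (thetaB k) p + 4 * ε * I * ellK k * b / (2 * e - ε * I * ellK k) := by
  have hK : (ellK k : ℂ) ≠ 0 := by exact_mod_cast (ellK_pos hk0 hk1).ne'
  have hB := thetaB_ne_zero_of_thetaA hk0 hk1 hA
  have hε0 : ε ≠ 0 := fun h ↦ by simp [h] at hε
  have hA' : deriv (thetaA k) p = 2 * ε * I * ellK k * thetaB k p := by
    have h1 := hC
    rw [thetaC, hA] at h1
    refine mul_left_cancel₀ hB ?_
    linear_combination -4 * h1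
  have hC' : deriv (thetaC k) p = -(ε * I * ellK k) * (thetaB k p * deriv (thetaB k) p) := by
    have h1 := thetaC_mul_deriv hk0 hk1 p
    rw [hA, hC] at h1
    refine mul_left_cancel₀ (mul_ne_zero (mul_ne_zero (mul_ne_zero hε0 I_ne_zero) hK)
      (pow_ne_zero 2 hB)) ?_
    linear_combination -h1 + (ellK k : ℂ) ^ 2 * thetaB k p ^ 3 * deriv (thetaB k) p *
      (ε ^ 2 * I_sq - hε)
  have hval : incidence k a b e p = (2 * e - ε * I * ellK k) * thetaB k p ^ 2 / 2 := by
    rw [incidence, sectionTheta, hA, hC]; ring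
  have hne : 2 * e - ε * I * ellK k ≠ 0 := fun h ↦ h0 (by rw [hval, h]; ring)
  have hder : deriv (incidence k a b e) p = (2 * e - ε * I * ellK k) *
      (thetaB k p * deriv (thetaB k) p) + 2 * ε * I * ellK k * b * thetaB k p ^ 2 := by
    have hd : HasDerivAt (incidence k a b e) _ p := (differentiable_thetaC hk0 hk1 p).hasDerivAt.sub
      (hasDerivAt_sectionTheta hk0 hk1 a b e p)
    rw [hd.deriv, hC', hA', hA]
    ring
  rw [logDeriv_apply, logDeriv_apply, hder, hval]
  field_simp
  ring

variable {a b e : ℂ} {ζ : Fin 4 → ℂ}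

/-- The sum of the logarithmic derivatives of the incidence function at the two points over
`ζ = ∞`, evaluated through its factorization. -/
lemma logDeriv_incidence_add (he : e ^ 2 + (ellK k : ℂ) ^ 2 / 4 ≠ 0) {z : Fin 4 → ℂ} {n : ℤ} {c : ℂ}
    (hz : ∀ i, thetaA k (z i) ≠ 0)
    (h : ∀ w, incidence k a b e w = c * expTwoPi (n * w) * thetaProd k z w) :
    logDeriv (incidence k a b e) (1 / 2) + logDeriv (incidence k a b e) (tau k / 2) =
      4 * Real.pi * I * n + 16 * Real.pi * I - ∑ i, logDeriv (thetaA k) (z i) := by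
  have hτ := tau_im_pos hk0 hk1
  -- The zeros of A are the points over infinity. Reflection therefore turns the sum over these two
  -- points into A'/A at z_i, with a constant 2πi for each.
  have key : ∀ i, logDeriv (theta (tau k)) (1 / 2 - z i) +
      logDeriv (theta (tau k)) (tau k / 2 - z i) =
      4 * Real.pi * I - logDeriv (thetaA k) (z i) := by
    intro i
    have h0 := hz i
    rw [thetaA] at h0
    have h1 : ¬InLattice (tau k) (z i - 1 / 2) := fun hl ↦
      left_ne_zero_of_mul h0 ((theta_eq_zero_iff hτ).2 hl)
    have h2 : ¬InLattice (tau k) (z i - tau k / 2) := fun hl ↦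
      right_ne_zero_of_mul h0 ((theta_eq_zero_iff hτ).2 hl)
    rw [logDeriv_thetaA hk0 hk1 (hz i), ← neg_sub (z i) (1 / 2), ← neg_sub (z i) (tau k / 2),
      logDeriv_theta_neg hτ h1, logDeriv_theta_neg hτ h2]
    ring
  rw [logDeriv_incidence hk0 hk1 h
      (incidence_ne_zero_of_thetaA hk0 hk1 he (thetaA_half hk0 hk1)),
    logDeriv_incidence hk0 hk1 h
      (incidence_ne_zero_of_thetaA hk0 hk1 he (thetaA_half_tau hk0 hk1)),
    add_add_add_comm, ← Finset.sum_add_distrib, Finset.sum_congr rfl fun i _ ↦ key i,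
    Finset.sum_sub_distrib]
  simp only [Finset.sum_const, Finset.card_univ, Fintype.card_fin, nsmul_eq_mul]
  push_cast
  ring

/-- Abel's theorem on the curve, for differentials of the first and second kind. -/
theorem exists_sum_lifts (h : IsFactored k a b e ζ) (he : e ^ 2 + (ellK k : ℂ) ^ 2 / 4 ≠ 0)
    {z : Fin 4 → ℂ} (hz : ∀ i, Lifts k (z i) 1 (ζ i) (a - b * ζ i - e * ζ i ^ 2)) :
    ∃ n m : ℤ, ∑ i, z i = (1 - n) * tau k - m ∧
      ∑ i, logDeriv (thetaA k) (z i) = 4 * Real.pi * I * n + 8 * Real.pi * I +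
        2 * (ellK k : ℂ) ^ 2 * b / (e ^ 2 + (ellK k : ℂ) ^ 2 / 4) := by
  obtain ⟨n, m, c, hsum, hfac⟩ := exists_incidence_eq hk0 hk1 h he hz
  refine ⟨n, m, hsum, ?_⟩
  have h1 := logDeriv_incidence_add hk0 hk1 he
    (fun i ↦ (hz i).thetaA_ne_zero hk0 hk1 one_ne_zero) hfac
  rw [logDeriv_incidence_of_thetaA hk0 hk1 (ε := 1) (thetaA_half hk0 hk1) (by ring)
      (by rw [thetaC_half hk0 hk1]; ring)
      (incidence_ne_zero_of_thetaA hk0 hk1 he (thetaA_half hk0 hk1)),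
    logDeriv_incidence_of_thetaA hk0 hk1 (ε := -1) (thetaA_half_tau hk0 hk1) (by ring)
      (by rw [thetaC_half_tau hk0 hk1]; ring)
      (incidence_ne_zero_of_thetaA hk0 hk1 he (thetaA_half_tau hk0 hk1)),
    logDeriv_thetaB_half hk0 hk1, logDeriv_thetaB_half_tau hk0 hk1] at h1
  -- The leading coefficient is a quarter of the product of the denominators at the two points over
  -- infinity. Adding the two fractions cancels the terms in be.
  have hfac2 : e ^ 2 + (ellK k : ℂ) ^ 2 / 4 =
      (2 * e - 1 * I * ellK k) * (2 * e - -1 * I * ellK k) / 4 := by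
    linear_combination (ellK k : ℂ) ^ 2 / 4 * I_sq
  have hu : 2 * e - 1 * I * ellK k ≠ 0 := fun h0 ↦ he (by rw [hfac2, h0]; ring)
  have hv : 2 * e - -1 * I * ellK k ≠ 0 := fun h0 ↦ he (by rw [hfac2, h0]; ring)
  have h2 : 4 * 1 * I * ellK k * b / (2 * e - 1 * I * ellK k) +
      4 * -1 * I * ellK k * b / (2 * e - -1 * I * ellK k) =
      -(2 * (ellK k : ℂ) ^ 2 * b / (e ^ 2 + (ellK k : ℂ) ^ 2 / 4)) := by
    rw [hfac2, div_add_div _ _ hu hv, div_div_eq_mul_div, ← neg_div]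
    congr 1
    linear_combination 8 * (ellK k : ℂ) ^ 2 * b * I_sq
  linear_combination h1 - h2

end

/-! ### From the root multiset and correlated contours to the lifts -/

section

variable {k : ℝ}

lemma isFactored_of_roots {x₁ x₂ x₃ : ℝ} {ζ : Fin 4 → ℂ}
    (h : (atiyahWard k x₁ x₂ x₃).roots = (Finset.univ : Finset (Fin 4)).val.map ζ) :
    IsFactored k (x₂ - I * x₁) (2 * x₃) (x₂ + I * x₁) ζ := by
  set ℓ := (atiyahWard k x₁ x₂ x₃).leadingCoeff
  have h1 : ∀ x : ℂ, ((x₂ - I * x₁ : ℂ) - 2 * x₃ * x - (x₂ + I * x₁) * x ^ 2) ^ 2 +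
      (ellK k : ℂ) ^ 2 / 4 * (x ^ 4 + 2 * modDiff k * x ^ 2 + 1) = ℓ * ∏ i, (x - ζ i) := by
    intro x
    have h2 := congrArg (Polynomial.eval x)
      (IsAlgClosed.splits (atiyahWard k x₁ x₂ x₃)).eq_prod_roots
    rw [h, Multiset.map_map, eval_mul, eval_C, eval_multiset_prod, Multiset.map_map] at h2
    simp only [Function.comp_def, eval_sub, eval_X, eval_C] at h2
    refine Eq.trans ?_ h2
    simp [atiyahWard, modDiff]
  have hℓ : ℓ = ((x₂ + I * x₁ : ℂ)) ^ 2 + (ellK k : ℂ) ^ 2 / 4 := by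
    have e0 := h1 0
    have e1 := h1 1
    have e2 := h1 (-1)
    have e3 := h1 2
    have e4 := h1 (-2)
    simp only [Fin.prod_univ_four] at e0 e1 e2 e3 e4
    -- A fourth difference extracts the leading coefficient on both sides.
    linear_combination -(e3 + e4 - 4 * e1 - 4 * e2 + 6 * e0) / 24
  intro x
  rw [h1 x, hℓ]

lemma CurvePath.lifts_of_isAt {c : CurvePath k} {s : ℝ} {ζ η w : ℂ} (h : c.IsAt s ζ η) :
    Lifts k w (c.Z₀ s) (c.Z₁ s) (c.W s) ↔ Lifts k w 1 ζ η := by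
  obtain ⟨h0, h1, h2⟩ := h
  rw [h1, h2]
  exact ⟨fun h ↦ h.of_smul h0, fun h ↦ h.smul _⟩

lemma logDeriv_thetaA_add_int (z : ℂ) (m : ℤ) :
    logDeriv (thetaA k) (z + m) = logDeriv (thetaA k) z := by
  have h : Function.Periodic (logDeriv (thetaA k)) 1 := fun z ↦ logDeriv_thetaA_add_one z
  simpa using h.int_mul m z

variable (hk0 : 0 < k) (hk1 : k < 1)
include hk0 hk1

/-- Since (1 - τ)/4 + (1 + τ)/4 = 1/2, correlated contours have lifts whose end points differ by an
integer. A'/A has period 1, so it takes the same value at both. The term πi is a quarter of A'/A at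
the lift of P₀. -/
lemma CurvePath.intGamma_eq_of_correlated {δ c : CurvePath k} (hc : c.AvoidsInfty)
    (h0 : c.IsAt 0 (compl k + I * k) 0) (h : δ.Correlated c) :
    c.intGamma = logDeriv (thetaA k) (1 / 2 + δ.intV) / 4 - Real.pi * I := by
  obtain ⟨m, hm⟩ := h
  have h1 := (c.lifts_intV hk0 hk1 ((CurvePath.lifts_of_isAt h0).2
    (lifts_branchPoint hk0 hk1))).2 hc
  rw [h1, logDeriv_thetaA_branchPoint hk0 hk1, hm,
    show 1 / 2 + (c.intV - (1 + tau k) / 4 + m) = (1 - tau k) / 4 + c.intV + m by ring,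
    logDeriv_thetaA_add_int]
  ring

end

end TwoMonopole

end

open TwoMonopole in
theorem proposition4p1 (k : ℝ) (hk0 : 0 < k) (hk1 : k < 1) (x₁ x₂ x₃ : ℝ)
    (hx : (TwoMonopole.ellK k : ℂ) ^ 2 - 4 * ((x₁ : ℂ) - Complex.I * x₂) ^ 2 ≠ 0)
    (ζ η : Fin 4 → ℂ)
    -- the four solutions of the Atiyah–Ward equation, with multiplicity
    (hζ : (TwoMonopole.atiyahWard k x₁ x₂ x₃).roots = (Finset.univ : Finset (Fin 4)).val.map ζ)
    (hη : ∀ i, η i = TwoMonopole.miniTwistor x₁ x₂ x₃ (ζ i))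
    -- contours from `∞₁` to the four points
    (δ : Fin 4 → TwoMonopole.CurvePath k)
    (hδ0 : ∀ i, (δ i).IsAtInftyOne 0) (hδ1 : ∀ i, (δ i).IsAt 1 (ζ i) (η i)) :
    ∃ N M : ℤ,
      ∑ i, (δ i).intV = N * TwoMonopole.tau k + M ∧
      -- contours from `P₀ = (k' + i k, 0)` to the four points
      ∀ c : Fin 4 → TwoMonopole.CurvePath k,
        (∀ i, (c i).AvoidsInfty) →
        (∀ i, (c i).IsAt 0 ((TwoMonopole.compl k : ℂ) + Complex.I * k) 0) →
        (∀ i, (c i).IsAt 1 (ζ i) (η i)) →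
        (∀ i, (δ i).Correlated (c i)) →
          ∑ i, (c i).intGamma =
              4 * (TwoMonopole.ellK k : ℂ) ^ 2 * x₃ /
                ((TwoMonopole.ellK k : ℂ) ^ 2 - 4 * ((x₁ : ℂ) - Complex.I * x₂) ^ 2)
              - Complex.I * Real.pi * (N + 1) ∧
          ∑ i, TwoMonopole.mu x₁ x₂ x₃ N (ζ i) (c i) = 3 * Complex.I * Real.pi * N := by
  have hfac := isFactored_of_roots hζ
  -- Here e = x₂ + ix₁ = i x_-, so e² = -x_-².
  have heq : ((x₂ + I * x₁ : ℂ)) ^ 2 + (ellK k : ℂ) ^ 2 / 4 =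
      ((ellK k : ℂ) ^ 2 - 4 * ((x₁ : ℂ) - I * x₂) ^ 2) / 4 := by
    linear_combination (x₁ ^ 2 + x₂ ^ 2 : ℂ) * I_sq
  have he : ((x₂ + I * x₁ : ℂ)) ^ 2 + (ellK k : ℂ) ^ 2 / 4 ≠ 0 := by
    rw [heq]; exact div_ne_zero hx (by norm_num)
  have hz : ∀ i, Lifts k (1 / 2 + (δ i).intV) 1 (ζ i)
      ((x₂ - I * x₁) - 2 * x₃ * ζ i - (x₂ + I * x₁) * ζ i ^ 2) := by
    intro i
    have h := ((δ i).lifts_intV hk0 hk1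
      (CurvePath.lifts_half_of_isAtInftyOne hk0 hk1 (hδ0 i))).1
    rw [CurvePath.lifts_of_isAt (hδ1 i), hη] at h
    exact h
  obtain ⟨n, m, hsum, hlog⟩ := exists_sum_lifts hk0 hk1 hfac he hz
  rw [Finset.sum_add_distrib] at hsum
  simp only [Finset.sum_const, Finset.card_univ, Fintype.card_fin, nsmul_eq_mul] at hsum
  -- The four lifts start at 1/2 and contribute 2 to ∑ z_i = (1 - n)τ - m.
  refine ⟨1 - n, -m - 2, ?_, fun c hc hc0 hc1 hcor ↦ ?_⟩
  · push_cast at hsum ⊢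
    linear_combination hsum
  have hγ : ∑ i, (c i).intGamma = 4 * (ellK k : ℂ) ^ 2 * x₃ /
      ((ellK k : ℂ) ^ 2 - 4 * ((x₁ : ℂ) - I * x₂) ^ 2) - I * Real.pi * ((1 - n : ℤ) + 1) := by
    rw [Finset.sum_congr rfl fun i _ ↦ CurvePath.intGamma_eq_of_correlated hk0 hk1 (hc i) (hc0 i)
      (hcor i), Finset.sum_sub_distrib, ← Finset.sum_div, hlog, heq]
    simp only [Finset.sum_const, Finset.card_univ, Fintype.card_fin, nsmul_eq_mul]
    push_cast
    field_simp
    ring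
  refine ⟨hγ, ?_⟩
  have hvieta := hfac.sum_eq
  rw [heq] at hvieta
  have hsumζ : ∑ i, ζ i = -16 * x₃ * (x₂ + I * x₁) /
      ((ellK k : ℂ) ^ 2 - 4 * ((x₁ : ℂ) - I * x₂) ^ 2) := by
    rw [eq_div_iff hx]
    linear_combination 4 * hvieta
  -- The four terms iπ/4 in β₁ add up to iπ, which removes the 1 from -iπ(N + 1). With 4iπN this
  -- leaves 3iπN, and Vieta cancels the rational part.
  have hμ : ∑ i, mu x₁ x₂ x₃ (1 - n) (ζ i) (c i) = ∑ i, (c i).intGamma + I * Real.pi +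
      4 * (I * Real.pi * (1 - n : ℤ)) - I * (((x₁ : ℂ) - I * x₂) * ∑ i, ζ i - 4 * I * x₃) := by
    simp only [mu, betaOne, Fin.sum_univ_four]
    ring
  rw [hμ, hγ, hsumζ]
  push_cast
  field_simp
  linear_combination (4 * (ellK k : ℂ) ^ 2 * x₃ + 16 * x₃ * I * x₁ * x₂ -
    16 * x₃ * I ^ 2 * x₂ ^ 2) * I_sq
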